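/- Notation. Identify $\mathbb P(\mathbb C^2)$ with the boundary at infinity of hyperbolic $3$-space $\mathbb H^3$. For $\xi_0,\dots,\xi_3\in\mathbb P(\mathbb C^2)$ let $\mathrm{Vol}_{\mathbb H^3}(\xi_0,\dots,\xi_3)$ be the signed hyperbolic volume of the ideal simplex with these vertices, the orientation being normalized so that $(\infty,0,1,z)$ is positively oriented for $\operatorname{Im} z>0$, where $z=\left[\begin{smallmatrix}z\\1\end{smallmatrix}\right]$ and $\infty=\left[\begin{smallmatrix}1\\0\end{smallmatrix}\right]$; let $v_3$ be the maximal volume of an ideal simplex in $\mathbb H^3$. An ideal simplex is regular if its vertices are distinct and every permutation of its vertices is induced by an isometry of $\mathbb H^3$. For a finite-dimensional complex vector space $V$ and vectors $w_0,\dots,w_3$ spanning $V$, put $\mathrm{Vol}[V;w_0,\dots,w_3]=\mathrm{Vol}_{\mathbb H^3}([w_0],\dots,[w_3])$, computed through any linear isomorphism $V\cong\mathbb C^2$, if $\dim V=2$ and all $w_i\neq0$, and $\mathrm{Vol}[V;w_0,\dots,w_3]=0$ otherwise. A complete flag $F$ in $\mathbb C^n$ is a chain of subspaces $F^0\subset F^1\subset\dots\subset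 F^n$ with $\dim F^j=j$; let $\mathcal F(\mathbb C^n)$ be the set of complete flags. For $F_0,\dots,F_3\in\mathcal F(\mathbb C^n)$ choose vectors $v_i^{1},\dots,v_i^{n}$ with $F_i^{j}=\mathbb C v_i^{j}+F_i^{j-1}$ for $1\le j\le n$ and set $$B_n(F_0,\dots,F_3)=\sum_{0\le j_0,\dots,j_3\le n-1}\mathrm{Vol}\left[\frac{\langle F_0^{j_0+1},\dots,F_3^{j_3+1}\rangle}{\langle F_0^{j_0},\dots,F_3^{j_3}\rangle};\,v_0^{j_0+1},\dots,v_3^{j_3+1}\right],$$ which does not depend on the choice of the vectors. The Veronese embedding $\varphi_n:\mathbb P(\mathbb C^2)\to\mathcal F(\mathbb C^n)$ sends $\left[\begin{smallmatrix}x\\y\end{smallmatrix}\right]$ to the complete flag whose $(n-i)$-dimensional space, $0\le i\le n$, has as basis the vectors $$\Big(\underbrace{0,\dots,0}_{k},\,x^i,\,\tbinom i1x^{i-1}y,\,\dots,\,\tbinom il x^{i-l}y^l,\,\dots,\,y^i,\,\underbrace{0,\dots,0}_{n-i-k-1}\Big)^T,\qquad k=0,\dots,n-i-1.$$ Theorem.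 Let $n$ be a natural number and let $F_0,\dots,F_3\in\mathcal F(\mathbb C^n)$. Then $$B_n(F_0,\dots,F_3)=\frac{n(n^2-1)}{6}\,v_3$$ if and only if there exist $g\in\mathrm{GL}(n,\mathbb C)$ and a positively oriented regular ideal simplex with vertices $\xi_0,\dots,\xi_3\in\mathbb P(\mathbb C^2)$ such that $F_i=g\,\varphi_n(\xi_i)$ for $i=0,\dots,3$. -/

import Mathlib

open scoped LinearAlgebra.Projectivization

/-! ### Hyperbolic 3-space and ideal simplices

Hyperbolic 3-space is used in the projective (Klein) model: the open unit ball of Euclidean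
3-space, in which geodesic segments are straight segments, the boundary is the unit sphere and the
hyperbolic volume element is `dx / (1 - |x|²)²`. -/

/-- The complex projective line `P(ℂ²)`, which is the boundary of hyperbolic 3-space. -/
abbrev CP1 : Type := ℙ ℂ (Fin 2 → ℂ)

/-- The Klein ball carries the hyperbolic volume measure (extended by zero outside the ball). -/
noncomputable def kleinVolume : MeasureTheory.Measure (EuclideanSpace ℝ (Fin 3)) :=
  (MeasureTheory.volume.restrict (Metric.ball 0 1)).withDensity
    fun x => ENNReal.ofReal (((1 - ‖x‖ ^ 2) ^ 2)⁻¹)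

/-- The point of the unit sphere that corresponds to the line through `v = (x, y) ≠ 0`, namely
`(2 Re (x̄ y), 2 Im (x̄ y), |x|² - |y|²) / (|x|² + |y|²)`. -/
noncomputable def spherePoint (v : Fin 2 → ℂ) : EuclideanSpace ℝ (Fin 3) :=
  !₂[2 * (starRingEnd ℂ (v 0) * v 1).re / (Complex.normSq (v 0) + Complex.normSq (v 1)),
     2 * (starRingEnd ℂ (v 0) * v 1).im / (Complex.normSq (v 0) + Complex.normSq (v 1)),
     (Complex.normSq (v 0) - Complex.normSq (v 1)) /
       (Complex.normSq (v 0) + Complex.normSq (v 1))]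

theorem spherePoint_smul (t : ℂ) (ht : t ≠ 0) (v : Fin 2 → ℂ) :
    spherePoint (t • v) = spherePoint v := by
  have h : Complex.normSq t ≠ 0 := by simpa using ht
  have e : starRingEnd ℂ (t * v 0) * (t * v 1)
      = (Complex.normSq t : ℂ) * (starRingEnd ℂ (v 0) * v 1) := by
    rw [Complex.normSq_eq_conj_mul_self, map_mul]; ring
  simp only [spherePoint, Pi.smul_apply, smul_eq_mul]
  rw [e, Complex.re_ofReal_mul, Complex.im_ofReal_mul]
  simp only [Complex.normSq_mul, ← mul_add, ← mul_sub, mul_left_comm (2 : ℝ),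
    mul_div_mul_left _ _ h]

/-- The identification of `P(ℂ²)` with the unit sphere, the boundary of the Klein ball. -/
noncomputable def boundaryPoint : CP1 → EuclideanSpace ℝ (Fin 3) :=
  Projectivization.lift (fun v : { v : Fin 2 → ℂ // v ≠ 0 } => spherePoint v) (by
    rintro a b t h
    have ht : t ≠ 0 := by
      rintro rfl
      exact a.2 (by simpa using h)
    change spherePoint (a : Fin 2 → ℂ) = spherePoint (b : Fin 2 → ℂ)
    rw [h, spherePoint_smul t ht])

/-- The (unsigned) hyperbolic volume of the ideal simplex with vertices `ξ 0, …, ξ 3`, that is of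
the convex hull of these boundary points. -/
noncomputable def simplexVolume (ξ : Fin 4 → CP1) : ℝ :=
  kleinVolume.real (convexHull ℝ (Set.range fun i => boundaryPoint (ξ i)))

/-- The determinant whose sign is the orientation of the ordered simplex `ξ 0, …, ξ 3`. With this
convention the simplex `∞, 0, 1, z` is positively oriented exactly if `Im z > 0`, where `z` stands
for the line through `(z, 1)` and `∞` for the line through `(1, 0)`. -/
noncomputable def orientationDet (ξ : Fin 4 → CP1) : ℝ :=
  Matrix.det (Matrix.of fun i j : Fin 3 => boundaryPoint (ξ i.succ) j - boundaryPoint (ξ 0) j)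

/-- The ordered ideal simplex is positively oriented (in particular nondegenerate). -/
def PositivelyOriented (ξ : Fin 4 → CP1) : Prop := 0 < orientationDet ξ

/-- The signed hyperbolic volume of the ordered ideal simplex `ξ 0, …, ξ 3`. -/
noncomputable def signedVolume (ξ : Fin 4 → CP1) : ℝ :=
  Real.sign (orientationDet ξ) * simplexVolume ξ

/-- The maximal volume `v₃` of an ideal simplex in hyperbolic 3-space. -/
noncomputable def maxSimplexVolume : ℝ := ⨆ ξ : Fin 4 → CP1, simplexVolume ξ

/-- An ideal simplex is regular if its vertices are distinct and each permutation of them is induced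
by an isometry of hyperbolic 3-space. On the boundary `P(ℂ²)` the isometries are the
projectivizations of the linear automorphisms of `ℂ²` (those that preserve the orientation) and of
the conjugate-linear ones (those that reverse it). -/
def IsRegularSimplex (ξ : Fin 4 → CP1) : Prop :=
  Function.Injective ξ ∧ ∀ s : Equiv.Perm (Fin 4),
    (∃ f : (Fin 2 → ℂ) ≃ₗ[ℂ] (Fin 2 → ℂ),
      ∀ i, Projectivization.map f.toLinearMap f.injective (ξ i) = ξ (s i)) ∨
    (∃ f : (Fin 2 → ℂ) ≃ₛₗ[starRingEnd ℂ] (Fin 2 → ℂ),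
      ∀ i, Projectivization.map f.toLinearMap f.injective (ξ i) = ξ (s i))

/-! ### The volume of a configuration of four vectors -/

/-- The function `Vol` on configurations `[V; v 0, …, v 3]` of vectors in a finite-dimensional
complex vector space: it vanishes unless `dim V = 2` and all `v i` are nonzero, and then it is the
signed volume of the ideal simplex that the vectors define after the choice of an isomorphism of `V`
with `ℂ²`. -/
noncomputable def configVolume (V : Type) [AddCommGroup V] [Module ℂ V] [Module.Finite ℂ V]
    (v : Fin 4 → V) : ℝ :=
  open Classical in
  if h : Module.finrank ℂ V = 2 ∧ ∀ i, v i ≠ 0 then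
    signedVolume fun i =>
      Projectivization.mk ℂ ((Module.finBasisOfFinrankEq ℂ V h.1).equivFun (v i))
        ((LinearEquiv.map_ne_zero_iff _).2 (h.2 i))
  else 0

theorem configVolume_congr (V : Type) [AddCommGroup V] [Module ℂ V] [Module.Finite ℂ V]
    (v w : Fin 4 → V) (h : ∀ i, ∃ c : ℂ, c ≠ 0 ∧ v i = c • w i) :
    configVolume V v = configVolume V w := by
  have hz : ∀ i, v i ≠ 0 ↔ w i ≠ 0 := fun i => by
    obtain ⟨c, hc, e⟩ := h i
    simp [e, hc]
  unfold configVolume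
  by_cases hw : Module.finrank ℂ V = 2 ∧ ∀ i, w i ≠ 0
  · rw [dif_pos hw, dif_pos ⟨hw.1, fun i => (hz i).2 (hw.2 i)⟩]
    congr 1
    funext i
    obtain ⟨c, hc, e⟩ := h i
    rw [Projectivization.mk_eq_mk_iff']
    exact ⟨c, by rw [e, map_smul]⟩
  · rw [dif_neg hw, dif_neg fun hv => hw ⟨hv.1, fun i => (hz i).1 (hv.2 i)⟩]

/-! ### Flags -/

/-- A complete flag `F⁰ ⊂ F¹ ⊂ … ⊂ Fⁿ` in `ℂⁿ`, with `dim Fʲ = j`. -/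
@[ext]
structure CompleteFlag (n : ℕ) where
  /-- The space of dimension `j`. -/
  space : Fin (n + 1) → Submodule ℂ (Fin n → ℂ)
  mono : Monotone space
  finrank_space : ∀ j, Module.finrank ℂ (space j) = (j : ℕ)

/-- The natural action of `GL(n, ℂ)` on complete flags. -/
noncomputable instance (n : ℕ) : SMul (GL (Fin n) ℂ) (CompleteFlag n) where
  smul g F :=
    { space := fun j => (F.space j).map (Matrix.GeneralLinearGroup.toLin g).toLinearEquiv.toLinearMap
      mono := fun _ _ h => Submodule.map_mono (F.mono h)
      finrank_space := fun j => by
        rw [← F.finrank_space j]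
        exact LinearEquiv.finrank_map_eq _ _ }

theorem CompleteFlag.smul_space (n : ℕ) (g : GL (Fin n) ℂ) (F : CompleteFlag n) (j : Fin (n + 1)) :
    (g • F).space j = (F.space j).map (Matrix.mulVecLin (g : Matrix (Fin n) (Fin n) ℂ)) := rfl

/-- An affine flag: a complete flag `F` with vectors `v¹, …, vⁿ` such that
`Fʲ = ℂ vʲ + Fʲ⁻¹`. The vector `vʲ⁺¹` is `vec j`. -/
structure AffineFlag (n : ℕ) where
  /-- The underlying flag. -/
  flag : CompleteFlag n
  /-- The vectors. -/
  vec : Fin n → (Fin n → ℂ)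
  space_succ : ∀ j : Fin n,
    flag.space j.succ = Submodule.span ℂ {vec j} ⊔ flag.space j.castSucc

theorem AffineFlag.vec_mem {n : ℕ} (A : AffineFlag n) (j : Fin n) :
    A.vec j ∈ A.flag.space j.succ := by
  rw [A.space_succ]
  exact Submodule.mem_sup_left (Submodule.mem_span_singleton_self _)

theorem CompleteFlag.exists_affineFlag {n : ℕ} (F : CompleteFlag n) :
    ∃ A : AffineFlag n, A.flag = F := by
  have key : ∀ j : Fin n, ∃ v : Fin n → ℂ,
      F.space j.succ = Submodule.span ℂ {v} ⊔ F.space j.castSucc := by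
    intro j
    have hle : F.space j.castSucc ≤ F.space j.succ := F.mono j.castSucc_lt_succ.le
    have hnot : ¬ F.space j.succ ≤ F.space j.castSucc := fun h => by
      have := Submodule.finrank_mono h
      rw [F.finrank_space, F.finrank_space] at this
      simp at this
    obtain ⟨v, hv, hv'⟩ := SetLike.not_le_iff_exists.1 hnot
    refine ⟨v, (Submodule.eq_of_le_of_finrank_le
      (sup_le ((Submodule.span_singleton_le_iff_mem _ _).2 hv) hle) ?_).symm⟩
    have hlt : F.space j.castSucc < Submodule.span ℂ {v} ⊔ F.space j.castSucc :=
      lt_of_le_of_ne le_sup_right fun h => hv' (h ▸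
        Submodule.mem_sup_left (Submodule.mem_span_singleton_self v))
    have := Submodule.finrank_lt_finrank_of_lt hlt
    rw [F.finrank_space] at this
    rw [F.finrank_space]
    simpa using this
  choose v hv using key
  exact ⟨⟨F, v, hv⟩, rfl⟩

/-! ### The invariant `B_n` -/

/-- The quotient `⟨F₀^{j₀+1}, …, F₃^{j₃+1}⟩ / ⟨F₀^{j₀}, …, F₃^{j₃}⟩`. -/
abbrev FlagQuotient {n : ℕ} (F : Fin 4 → CompleteFlag n) (J : Fin 4 → Fin n) : Type :=
  ↥(⨆ i, (F i).space (J i).succ) ⧸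
    (⨆ i, (F i).space (J i).castSucc).submoduleOf (⨆ i, (F i).space (J i).succ)

/-- The invariant `B_n` of four affine flags: the sum of
`Vol [⟨F₀^{j₀+1}, …, F₃^{j₃+1}⟩ / ⟨F₀^{j₀}, …, F₃^{j₃}⟩; v₀^{j₀+1}, …, v₃^{j₃+1}]` over all
`0 ≤ j₀, …, j₃ ≤ n - 1`. -/
noncomputable def affineB (n : ℕ) (A : Fin 4 → AffineFlag n) : ℝ :=
  ∑ J : Fin 4 → Fin n,
    configVolume (FlagQuotient (fun i => (A i).flag) J) fun i =>
      Submodule.Quotient.mk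
        ⟨(A i).vec (J i), Submodule.mem_iSup_of_mem i ((A i).vec_mem (J i))⟩

/-- The invariant `B_n` of four complete flags, through any affine flags over them. -/
noncomputable def flagB (n : ℕ) (F : Fin 4 → CompleteFlag n) : ℝ :=
  affineB n fun i => (F i).exists_affineFlag.choose

/-- The value of `B_n` on affine flags depends only on the underlying flags. -/
theorem flagB_flag (n : ℕ) (A : Fin 4 → AffineFlag n) :
    flagB n (fun i => (A i).flag) = affineB n A := by
  have key : ∀ A A' : Fin 4 → AffineFlag n, (∀ i, (A i).flag = (A' i).flag) →
      affineB n A = affineB n A' := by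
    intro A A' h
    obtain ⟨F, hF⟩ : ∃ F : Fin 4 → CompleteFlag n, F = fun i => (A i).flag := ⟨_, rfl⟩
    obtain ⟨v, hv⟩ : ∃ v : Fin 4 → Fin n → (Fin n → ℂ), v = fun i => (A i).vec := ⟨_, rfl⟩
    obtain ⟨w, hw⟩ : ∃ w : Fin 4 → Fin n → (Fin n → ℂ), w = fun i => (A' i).vec := ⟨_, rfl⟩
    have hvs : ∀ i j, (F i).space j.succ = Submodule.span ℂ {v i j} ⊔ (F i).space j.castSucc := by
      subst hF hv; exact fun i j => (A i).space_succ j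
    have hws : ∀ i j, (F i).space j.succ = Submodule.span ℂ {w i j} ⊔ (F i).space j.castSucc := by
      subst hF hw; intro i j; simp only [h i]; exact (A' i).space_succ j
    have hA : A = fun i => ⟨F i, v i, hvs i⟩ := by subst hF hv; rfl
    have hA' : A' = fun i => ⟨F i, w i, hws i⟩ := by
      funext i
      have h1 : F i = (A' i).flag := by rw [hF]; exact h i
      have h2 : w i = (A' i).vec := by rw [hw]
      generalize A' i = B at h1 h2
      obtain ⟨B1, B2, B3⟩ := B
      simp only at h1 h2
      subst h1
      congr 1
      exact h2.symm
    rw [hA, hA']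
    refine Finset.sum_congr rfl fun J _ => configVolume_congr _ _ _ fun i => ?_
    have hmem : v i (J i) ∈ Submodule.span ℂ {w i (J i)} ⊔ (F i).space (J i).castSucc := by
      rw [← hws, hvs]
      exact Submodule.mem_sup_left (Submodule.mem_span_singleton_self _)
    obtain ⟨a, ha, f, hf, e⟩ := Submodule.mem_sup.1 hmem
    obtain ⟨c, rfl⟩ := Submodule.mem_span_singleton.1 ha
    refine ⟨c, ?_, ?_⟩
    · rintro rfl
      have h1 : (F i).space (J i).succ = (F i).space (J i).castSucc := by
        rw [hvs]
        refine sup_eq_right.2 ((Submodule.span_singleton_le_iff_mem _ _).2 ?_)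
        rw [← e]
        simpa using hf
      have h2 := congrArg (fun S : Submodule ℂ (Fin n → ℂ) => Module.finrank ℂ S) h1
      simp only [(F i).finrank_space] at h2
      simp at h2
    · rw [← Submodule.Quotient.mk_smul]
      refine (Submodule.Quotient.eq _).2 ?_
      change v i (J i) - c • w i (J i) ∈ ⨆ i, (F i).space (J i).castSucc
      refine Submodule.mem_iSup_of_mem i ?_
      have : v i (J i) - c • w i (J i) = f := by rw [← e]; simp
      rwa [this]
  exact key _ _ fun i => (A i).flag.exists_affineFlag.choose_spec

/-! ### The Veronese embedding -/

/-- The vector `(0, …, 0, xⁱ, …, (i choose l) xⁱ⁻ˡ yˡ, …, yⁱ, 0, …, 0)` of `ℂⁿ` that begins with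
`k` zeros, where `v = (x, y)`. -/
def veroneseVec (n i k : ℕ) (v : Fin 2 → ℂ) : Fin n → ℂ := fun m =>
  if k ≤ (m : ℕ) then
    (i.choose (m - k) : ℂ) * v 0 ^ (i - (m - k)) * v 1 ^ ((m : ℕ) - k)
  else 0

/-- The space of dimension `n - i = d` of the Veronese flag: it is spanned by the vectors above with
`k = 0, …, d - 1`. -/
def veroneseSpace (n d : ℕ) (v : Fin 2 → ℂ) : Submodule ℂ (Fin n → ℂ) :=
  Submodule.span ℂ (Set.range fun k : Fin d => veroneseVec n (n - d) k v)

theorem veroneseVec_eq_coeff (n i k : ℕ) (v : Fin 2 → ℂ) (m : Fin n) :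
    veroneseVec n i k v m = (Polynomial.X ^ k *
      (Polynomial.C (v 1) * Polynomial.X + Polynomial.C (v 0)) ^ i).coeff (m : ℕ) := by
  rw [Polynomial.coeff_X_pow_mul', veroneseVec]
  congr 1
  generalize (m : ℕ) - k = l
  rw [add_pow, Polynomial.finsetSum_coeff]
  have h : ∀ r : ℕ, ((Polynomial.C (v 1) * Polynomial.X) ^ r * Polynomial.C (v 0) ^ (i - r) *
      (i.choose r : Polynomial ℂ)).coeff l
        = if l = r then (i.choose r : ℂ) * v 0 ^ (i - r) * v 1 ^ r else 0 := by
    intro r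
    have : (Polynomial.C (v 1) * Polynomial.X) ^ r * Polynomial.C (v 0) ^ (i - r) *
        (i.choose r : Polynomial ℂ)
          = Polynomial.C ((i.choose r : ℂ) * v 0 ^ (i - r) * v 1 ^ r) * Polynomial.X ^ r := by
      simp only [map_mul, map_pow, map_natCast]; ring
    rw [this, Polynomial.coeff_C_mul_X_pow]
  simp only [h, Finset.sum_ite_eq, Finset.mem_range]
  split_ifs with hl
  · rfl
  · rw [Nat.choose_eq_zero_of_lt (by lia)]; simp

theorem veroneseSpace_le_succ (n d : ℕ) (hd : d < n) (v : Fin 2 → ℂ) :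
    veroneseSpace n d v ≤ veroneseSpace n (d + 1) v := by
  refine Submodule.span_le.2 ?_
  rintro _ ⟨k, rfl⟩
  have h : veroneseVec n (n - d) k v = v 0 • veroneseVec n (n - (d + 1)) k v
      + v 1 • veroneseVec n (n - (d + 1)) (k + 1) v := by
    funext m
    simp only [Pi.add_apply, Pi.smul_apply, smul_eq_mul, veroneseVec_eq_coeff]
    rw [show n - d = n - (d + 1) + 1 by lia, ← Polynomial.coeff_C_mul, ← Polynomial.coeff_C_mul,
      ← Polynomial.coeff_add]
    congr 1
    ring
  change veroneseVec n (n - d) k v ∈ veroneseSpace n (d + 1) v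
  rw [h]
  exact add_mem
    (Submodule.smul_mem _ _ (Submodule.subset_span ⟨⟨k, by have := k.2; lia⟩, rfl⟩))
    (Submodule.smul_mem _ _ (Submodule.subset_span ⟨⟨k + 1, by have := k.2; lia⟩, rfl⟩))

theorem finrank_veroneseSpace (n d : ℕ) (hd : d ≤ n) (v : Fin 2 → ℂ) (hv : v ≠ 0) :
    Module.finrank ℂ (veroneseSpace n d v) = d := by
  have hli : LinearIndependent ℂ fun k : Fin d => veroneseVec n (n - d) k v := by
    rw [Fintype.linearIndependent_iff]
    intro c hc
    set Q : Polynomial ℂ :=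
      (Polynomial.C (v 1) * Polynomial.X + Polynomial.C (v 0)) ^ (n - d) with hQ
    have hQ0 : Q ≠ 0 := by
      refine pow_ne_zero _ fun h => hv ?_
      have h0 := congrArg (fun p => Polynomial.coeff p 0) h
      have h1 := congrArg (fun p => Polynomial.coeff p 1) h
      funext i
      fin_cases i
      · simpa using h0
      · simpa using h1
    have hQd : Q.natDegree ≤ n - d :=
      (Polynomial.natDegree_pow_le_of_le _ Polynomial.natDegree_linear_le).trans (by simp)
    set P : Polynomial ℂ := ∑ k : Fin d, Polynomial.C (c k) * Polynomial.X ^ (k : ℕ) with hP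
    have hPQ : P * Q = 0 := by
      ext m
      rw [Polynomial.coeff_zero]
      have hsum : (P * Q).coeff m
          = ∑ k : Fin d, c k * (Polynomial.X ^ (k : ℕ) * Q).coeff m := by
        rw [hP, Finset.sum_mul, Polynomial.finsetSum_coeff]
        exact Finset.sum_congr rfl fun k _ => by rw [mul_assoc, Polynomial.coeff_C_mul]
      by_cases hm : m < n
      · have := congrFun hc ⟨m, hm⟩
        simpa [hsum, veroneseVec_eq_coeff] using this
      · rw [hsum]
        refine Finset.sum_eq_zero fun k _ => ?_
        rw [Polynomial.coeff_eq_zero_of_natDegree_lt, mul_zero]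
        refine lt_of_le_of_lt Polynomial.natDegree_mul_le ?_
        rw [Polynomial.natDegree_X_pow]
        have := k.2
        lia
    have hP0 : P = 0 := (mul_eq_zero.1 hPQ).resolve_right hQ0
    intro k
    have := congrArg (fun p => Polynomial.coeff p (k : ℕ)) hP0
    simpa [hP, Polynomial.finsetSum_coeff, Polynomial.coeff_X_pow, Fin.val_inj] using this
  rw [veroneseSpace, finrank_span_eq_card hli, Fintype.card_fin]

theorem veroneseSpace_smul_le (n d : ℕ) (t : ℂ) (v : Fin 2 → ℂ) :
    veroneseSpace n d (t • v) ≤ veroneseSpace n d v := by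
  refine Submodule.span_le.2 ?_
  rintro _ ⟨k, rfl⟩
  have h : veroneseVec n (n - d) k (t • v) = t ^ (n - d) • veroneseVec n (n - d) k v := by
    funext m
    simp only [veroneseVec, Pi.smul_apply, smul_eq_mul]
    split_ifs with hk
    · rcases le_or_gt ((m : ℕ) - k) (n - d) with hl | hl
      · nth_rewrite 3 [← Nat.sub_add_cancel hl]
        rw [mul_pow, mul_pow, pow_add]
        ring
      · rw [Nat.choose_eq_zero_of_lt hl]; simp
    · simp
  change veroneseVec n (n - d) k (t • v) ∈ veroneseSpace n d v
  rw [h]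
  exact Submodule.smul_mem _ _ (Submodule.subset_span ⟨k, rfl⟩)

/-- The Veronese embedding `φ_n` of `P(ℂ²)` into the space of complete flags of `ℂⁿ`. -/
noncomputable def veronese (n : ℕ) : CP1 → CompleteFlag n :=
  Projectivization.lift
    (fun v : { v : Fin 2 → ℂ // v ≠ 0 } =>
      { space := fun j => veroneseSpace n j v
        mono := Fin.monotone_iff_le_succ.2 fun j => veroneseSpace_le_succ n j j.2 v
        finrank_space := fun j => finrank_veroneseSpace n j (Nat.lt_succ_iff.1 j.2) v v.2 })
    (by
      rintro a b t h
      have ht : t ≠ 0 := by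
        rintro rfl
        exact a.2 (by simpa using h)
      have h' : (b : Fin 2 → ℂ) = t⁻¹ • (a : Fin 2 → ℂ) := by rw [h, inv_smul_smul₀ ht]
      ext1
      funext j
      apply le_antisymm
      · change veroneseSpace n j (a : Fin 2 → ℂ) ≤ veroneseSpace n j (b : Fin 2 → ℂ)
        rw [h]
        exact veroneseSpace_smul_le n j t b
      · change veroneseSpace n j (b : Fin 2 → ℂ) ≤ veroneseSpace n j (a : Fin 2 → ℂ)
        rw [h']
        exact veroneseSpace_smul_le n j t⁻¹ a)

/-! Every summand of `B_n` is a signed volume of an ideal simplex, hence at most v₃. The theorem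
therefore asks how many summands can be nonzero, and for which quadruples of flags that many of them
equal v₃.

Volumes. In barycentric coordinates on an ideal simplex in the Klein ball, `1 - |x|²` is a quadratic
form in the squared edge lengths. The volume thus becomes an explicit triple integral over an octant
(`kleinVolume_convexHull`), and this evaluates to Lobachevsky's formula in the dihedral angles
(`simplexVolume_eq_angleVolume`). Those angles are the angles of the plane triangle with sides
`pairing₀₁`, `pairing₀₂` and their difference. Averaging two unequal angles increases the volume, so
the maximum occurs only when all angles are π/3. Hence the signed volume is v₃ exactly when the
cross-ratio `pairing₀₁ / pairing₀₂` is exp(πi/3) (`signedVolume_eq_maxSimplexVolume_iff`).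

Counting. A nonzero summand at `J` makes `J` good (`IsGood`): the quotient is a plane carrying four
distinct lines. A good `J` can be recovered from three dimensions a ≤ b < c < n
(`IsGood.eq_of_dimTriple_eq`), and there are n(n²-1)/6 such triples. Equality in the theorem
therefore means that every triple is realised and that every good term equals v₃. Realising every
triple puts any three of the flags in general position. The joint distribution of any two indices
over the good set is then that of the quadruples with sum n - 2, and a second-moment comparison
shows that the good set consists of exactly these (`goodSet_eq_balancedSet`).

Rigidity. This leaves the `IsExtremal` quadruples: good and of cross-ratio exp(πi/3) at every `J`
with sum n - 2. The flags F₁, F₂ and the line of F₀ can be moved to a standard position by GL(n, ℂ).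
The cross-ratio then determines F₃ one dimension at a time, and by the symmetry exchanging F₀ and F₃
it determines all of F₀. So any two extremal quadruples are congruent (`IsExtremal.exists_smul_eq`).

Existence. With ℂⁿ viewed as the binary forms of degree n - 1, the Veronese flag of a point consists
of the multiples of powers of its linear form. A product of directional derivatives identifies the
quotient at each `J` of sum n - 2 with ℂ², carrying the four lines to the four given points
(`isExtremal_veronese`). -/

/-! ### The volume function of an ideal simplex in terms of its dihedral angles -/

/-- The primitive of `log ∘ sin` that vanishes at `0`. -/
noncomputable def logSinInt (x : ℝ) : ℝ := ∫ t in (0 : ℝ)..x, Real.log (Real.sin t)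

theorem continuous_logSinInt : Continuous logSinInt :=
  intervalIntegral.continuous_primitive (fun _ _ => intervalIntegrable_log_sin) 0

theorem logSinInt_zero : logSinInt 0 = 0 := by simp [logSinInt]

theorem hasDerivAt_logSinInt {x : ℝ} (h0 : 0 < x) (hpi : x < Real.pi) :
    HasDerivAt logSinInt (Real.log (Real.sin x)) x := by
  have hs : Real.sin x ≠ 0 := (Real.sin_pos_of_pos_of_lt_pi h0 hpi).ne'
  refine intervalIntegral.integral_hasDerivAt_right intervalIntegrable_log_sin ?_
    (Real.continuous_sin.continuousAt.log hs)
  exact (Real.measurable_log.comp Real.measurable_sin).stronglyMeasurable.stronglyMeasurableAtFilter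

theorem logSinInt_pi_sub (x : ℝ) : logSinInt (Real.pi - x) = logSinInt Real.pi - logSinInt x := by
  have h := intervalIntegral.integral_comp_sub_left (a := 0) (b := x)
    (fun t => Real.log (Real.sin t)) Real.pi
  simp only [Real.sin_pi_sub, sub_zero] at h
  have h2 := intervalIntegral.integral_add_adjacent_intervals
    (μ := MeasureTheory.volume) (f := fun t => Real.log (Real.sin t)) (a := 0) (b := Real.pi - x)
    (c := Real.pi) intervalIntegrable_log_sin intervalIntegrable_log_sin
  simp only [logSinInt]
  linarith

/-- The derivative `log sin (m + t) - log sin (m - t)` is positive because the sines differ by `2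
cos m sin t`. Comparing with `t = 0` shows that equalising two angles increases the volume;
comparing with `t = m` shows that the volume is positive. -/
theorem strictMonoOn_logSinInt_add_sub {m : ℝ} (hm : m < Real.pi / 2) :
    StrictMonoOn (fun t => logSinInt (m + t) + logSinInt (m - t)) (Set.Icc 0 m) := by
  refine strictMonoOn_of_deriv_pos (convex_Icc _ _) ?_ ?_
  · exact ((continuous_logSinInt.comp (by fun_prop)).add
      (continuous_logSinInt.comp (by fun_prop))).continuousOn
  · intro t hmem
    rw [interior_Icc] at hmem
    obtain ⟨h1, h2⟩ := hmem
    have d1 := (hasDerivAt_logSinInt (x := m + t) (by linarith) (by linarith)).comp_const_add m t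
    have d2 := (hasDerivAt_logSinInt (x := m - t) (by linarith) (by linarith)).comp_const_sub m t
    have d := d1.add d2
    rw [show (fun t => logSinInt (m + t) + logSinInt (m - t)) =
      ((fun t => logSinInt (m + t)) + fun t => logSinInt (m - t)) from rfl, d.deriv]
    have hlt : Real.sin (m - t) < Real.sin (m + t) := by
      have : Real.sin (m + t) - Real.sin (m - t) = 2 * (Real.cos m * Real.sin t) := by
        rw [Real.sin_add, Real.sin_sub]; ring
      have hc : 0 < Real.cos m :=
        Real.cos_pos_of_mem_Ioo ⟨by linarith [Real.pi_pos], by linarith⟩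
      have hst : 0 < Real.sin t := Real.sin_pos_of_pos_of_lt_pi h1 (by linarith)
      have := mul_pos hc hst
      linarith
    have hpos : 0 < Real.sin (m - t) :=
      Real.sin_pos_of_pos_of_lt_pi (by linarith) (by linarith)
    have := Real.log_lt_log hpos hlt
    linarith

theorem two_mul_logSinInt_lt {x y : ℝ} (hx : 0 ≤ x) (hxy : x < y) (h : x + y < Real.pi) :
    2 * logSinInt ((x + y) / 2) < logSinInt x + logSinInt y := by
  have := strictMonoOn_logSinInt_add_sub (m := (x + y) / 2) (by linarith)
    (Set.left_mem_Icc.2 (by linarith))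
    (⟨by linarith, by linarith⟩ : (y - x) / 2 ∈ Set.Icc 0 ((x + y) / 2)) (by linarith)
  simp only [add_zero, sub_zero] at this
  rw [show (x + y) / 2 + (y - x) / 2 = y by ring, show (x + y) / 2 - (y - x) / 2 = x by ring] at this
  linarith

/-- The volume of the ideal simplex with dihedral angles `β`, `γ` and `π - β - γ`. -/
noncomputable def angleVolume (β γ : ℝ) : ℝ := logSinInt (β + γ) - logSinInt β - logSinInt γ

theorem angleVolume_swap (β γ : ℝ) : angleVolume β γ = angleVolume γ β := by
  rw [angleVolume, angleVolume, add_comm β γ]; ring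

/-- Together with `angleVolume_swap` this gives symmetry in all three dihedral angles. -/
theorem angleVolume_rotate (β γ : ℝ) :
    angleVolume β γ = angleVolume γ (Real.pi - β - γ) := by
  rw [angleVolume, angleVolume, show γ + (Real.pi - β - γ) = Real.pi - β by ring,
    logSinInt_pi_sub, show Real.pi - β - γ = Real.pi - (β + γ) by ring, logSinInt_pi_sub]
  ring

theorem angleVolume_lt_of_ne {β γ : ℝ} (hβ : 0 ≤ β) (hγ : 0 ≤ γ) (h : β + γ < Real.pi)
    (hne : β ≠ γ) : angleVolume β γ < angleVolume ((β + γ) / 2) ((β + γ) / 2) := by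
  rcases hne.lt_or_gt with hlt | hlt
  · have := two_mul_logSinInt_lt hβ hlt h
    simp only [angleVolume, add_halves]
    linarith
  · have := two_mul_logSinInt_lt hγ hlt (by linarith)
    rw [add_comm γ β] at this
    simp only [angleVolume, add_halves]
    linarith

theorem angleVolume_pos {β γ : ℝ} (hβ : 0 < β) (hγ : 0 < γ) (h : β + γ < Real.pi) :
    0 < angleVolume β γ := by
  wlog hle : β ≤ γ generalizing β γ
  · rw [angleVolume_swap]
    exact this hγ hβ (by linarith) (by linarith)
  have := strictMonoOn_logSinInt_add_sub (m := (β + γ) / 2) (by linarith)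
    (⟨by linarith, by linarith⟩ : (γ - β) / 2 ∈ Set.Icc 0 ((β + γ) / 2))
    (Set.right_mem_Icc.2 (by linarith)) (by linarith)
  simp only [sub_self, logSinInt_zero, add_halves] at this
  rw [show (β + γ) / 2 + (γ - β) / 2 = γ by ring, show (β + γ) / 2 - (γ - β) / 2 = β by ring] at this
  simp only [angleVolume]
  linarith

theorem angleVolume_pi_div_three_pos : 0 < angleVolume (Real.pi / 3) (Real.pi / 3) :=
  angleVolume_pos (by linarith [Real.pi_pos]) (by linarith [Real.pi_pos])
    (by linarith [Real.pi_pos])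

/-- A maximum point has positive volume, which excludes β = 0 and β + γ = π, where the volume
vanishes. Two unequal angles could be averaged with the third kept fixed, which would increase the
volume; so all three angles agree. -/
theorem eq_pi_div_three_of_forall_angleVolume_le {β γ : ℝ} (hβ : 0 ≤ β) (hγ : 0 ≤ γ)
    (h : β + γ ≤ Real.pi)
    (hmax : ∀ β' γ' : ℝ, 0 ≤ β' → 0 ≤ γ' → β' + γ' ≤ Real.pi →
      angleVolume β' γ' ≤ angleVolume β γ) : β = Real.pi / 3 ∧ γ = Real.pi / 3 := by
  have hpi := Real.pi_pos
  have hpos : 0 < angleVolume β γ := angleVolume_pi_div_three_pos.trans_le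
    (hmax _ _ (by linarith) (by linarith) (by linarith))
  have hβ0 : β ≠ 0 := by
    rintro rfl
    simp [angleVolume, logSinInt_zero] at hpos
  have hlt : β + γ < Real.pi := by
    refine lt_of_le_of_ne h fun he => ?_
    rw [angleVolume, he, show γ = Real.pi - β by linarith, logSinInt_pi_sub] at hpos
    simp at hpos
  have h1 : β = γ := by
    by_contra hne
    have := angleVolume_lt_of_ne hβ hγ hlt hne
    exact absurd (hmax _ _ (by linarith) (by linarith) (by linarith)) (not_le.2 this)
  have h2 : γ = Real.pi - β - γ := by
    by_contra hne
    have hβ' : 0 < β := lt_of_le_of_ne hβ hβ0.symm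
    have := angleVolume_lt_of_ne hγ (by linarith) (by linarith) hne
    rw [← angleVolume_rotate] at this
    exact absurd (hmax _ _ (by linarith) (by linarith) (by linarith)) (not_le.2 this)
  exact ⟨by linarith, by linarith⟩

/-- A maximum exists on the compact triangle of angles, and the preceding lemma locates it. -/
theorem angleVolume_le {β γ : ℝ} (hβ : 0 ≤ β) (hγ : 0 ≤ γ) (h : β + γ ≤ Real.pi) :
    angleVolume β γ ≤ angleVolume (Real.pi / 3) (Real.pi / 3) := by
  have hcomp : IsCompact {p : ℝ × ℝ | 0 ≤ p.1 ∧ 0 ≤ p.2 ∧ p.1 + p.2 ≤ Real.pi} := by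
    refine (isCompact_Icc (a := ((0 : ℝ), (0 : ℝ))) (b := (Real.pi, Real.pi))).of_isClosed_subset
      ?_ ?_
    · exact (isClosed_le continuous_const continuous_fst).inter
        ((isClosed_le continuous_const continuous_snd).inter
          (isClosed_le (continuous_fst.add continuous_snd) continuous_const))
    · rintro ⟨x, y⟩ ⟨h1, h2, h3⟩
      simp only at h1 h2 h3
      exact ⟨⟨h1, h2⟩, ⟨by change x ≤ _; linarith, by change y ≤ _; linarith⟩⟩
  have hcont : Continuous fun p : ℝ × ℝ => angleVolume p.1 p.2 := by
    have := continuous_logSinInt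
    unfold angleVolume
    fun_prop
  obtain ⟨⟨x, y⟩, ⟨h1, h2, h3⟩, hxy⟩ := hcomp.exists_isMaxOn ⟨(β, γ), hβ, hγ, h⟩ hcont.continuousOn
  have hmax : ∀ β' γ' : ℝ, 0 ≤ β' → 0 ≤ γ' → β' + γ' ≤ Real.pi →
      angleVolume β' γ' ≤ angleVolume x y := fun β' γ' a b c => hxy (a := (β', γ')) ⟨a, b, c⟩
  obtain ⟨rfl, rfl⟩ := eq_pi_div_three_of_forall_angleVolume_le h1 h2 h3 hmax
  exact hmax _ _ hβ hγ h

theorem angleVolume_eq_iff {β γ : ℝ} (hβ : 0 ≤ β) (hγ : 0 ≤ γ) (h : β + γ ≤ Real.pi) :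
    angleVolume β γ = angleVolume (Real.pi / 3) (Real.pi / 3) ↔
      β = Real.pi / 3 ∧ γ = Real.pi / 3 := by
  refine ⟨fun he => eq_pi_div_three_of_forall_angleVolume_le hβ hγ h fun a b ha hb hab => ?_, ?_⟩
  · rw [he]
    exact angleVolume_le ha hb hab
  · rintro ⟨rfl, rfl⟩
    rfl

/-! ### Evaluation of the volume integral -/

open MeasureTheory in
theorem lintegral_Ioi_eq_of_hasDerivAt {g g' : ℝ → ℝ} {l : ℝ}
    (hd : ∀ x ∈ Set.Ici (0 : ℝ), HasDerivAt g (g' x) x) (hpos : ∀ x ∈ Set.Ioi (0 : ℝ), 0 ≤ g' x)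
    (hl : Filter.Tendsto g Filter.atTop (nhds l)) :
    ∫⁻ x in Set.Ioi (0 : ℝ), ENNReal.ofReal (g' x) = ENNReal.ofReal (l - g 0) := by
  rw [← integral_Ioi_of_hasDerivAt_of_nonneg' hd hpos hl,
    ofReal_integral_eq_lintegral_ofReal (integrableOn_Ioi_deriv_of_nonneg' hd hpos hl)]
  exact (ae_restrict_iff' measurableSet_Ioi).2 (.of_forall hpos)

theorem lintegral_inv_sq_linear {a b : ℝ} (ha : 0 < a) (hb : 0 < b) :
    ∫⁻ x in Set.Ioi (0 : ℝ), ENNReal.ofReal (((a + b * x) ^ 2)⁻¹) = ENNReal.ofReal ((a * b)⁻¹) := by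
  have hp : ∀ x ∈ Set.Ici (0 : ℝ), 0 < a + b * x := fun x hx =>
    add_pos_of_pos_of_nonneg ha (mul_nonneg hb.le hx)
  have := lintegral_Ioi_eq_of_hasDerivAt (g := fun x => -(b⁻¹ * (a + b * x)⁻¹))
    (g' := fun x => ((a + b * x) ^ 2)⁻¹) (l := 0) ?_ ?_ ?_
  · rw [this]
    congr 1
    field_simp
    ring
  · intro x hx
    have h1 : HasDerivAt (fun x => a + b * x) b x := by
      simpa using ((hasDerivAt_id x).const_mul b).const_add a
    have h2 := ((h1.inv (hp x hx).ne').const_mul b⁻¹).neg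
    refine h2.congr_deriv ?_
    have := (hp x hx).ne'
    field_simp
  · intro x hx
    positivity
  · have h1 : Filter.Tendsto (fun x : ℝ => a + b * x) Filter.atTop Filter.atTop :=
      Filter.tendsto_atTop_add_const_left _ _ (Filter.tendsto_id.const_mul_atTop hb)
    simpa using ((tendsto_inv_atTop_zero.comp h1).const_mul b⁻¹).neg

theorem lintegral_inv_linear_mul_linear {a b c d : ℝ} (ha : 0 < a) (hb : 0 < b) (hc : 0 < c)
    (hd : 0 < d) (h : 0 < b * c - a * d) :
    ∫⁻ x in Set.Ioi (0 : ℝ), ENNReal.ofReal (((a + b * x) * (c + d * x))⁻¹) =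
      ENNReal.ofReal (Real.log (b * c / (a * d)) / (b * c - a * d)) := by
  have hp : ∀ x ∈ Set.Ici (0 : ℝ), 0 < a + b * x := fun x hx =>
    add_pos_of_pos_of_nonneg ha (mul_nonneg hb.le hx)
  have hq : ∀ x ∈ Set.Ici (0 : ℝ), 0 < c + d * x := fun x hx =>
    add_pos_of_pos_of_nonneg hc (mul_nonneg hd.le hx)
  have := lintegral_Ioi_eq_of_hasDerivAt
    (g := fun x => Real.log ((a + b * x) / (c + d * x)) / (b * c - a * d))
    (g' := fun x => ((a + b * x) * (c + d * x))⁻¹)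
    (l := Real.log (b / d) / (b * c - a * d)) ?_ ?_ ?_
  · rw [this, ← sub_div]
    congr 2
    simp only [mul_zero, add_zero]
    rw [← Real.log_div (by positivity) (by positivity)]
    congr 1
    field_simp
  · intro x hx
    have h1 : HasDerivAt (fun x => a + b * x) b x := by
      simpa using ((hasDerivAt_id x).const_mul b).const_add a
    have h2 : HasDerivAt (fun x => c + d * x) d x := by
      simpa using ((hasDerivAt_id x).const_mul d).const_add c
    have hp' := hp x hx
    have hq' := hq x hx
    refine (((h1.div h2 hq'.ne').log (div_pos hp' hq').ne').div_const _).congr_deriv ?_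
    simp only [Pi.div_apply]
    rw [div_eq_iff h.ne']
    field_simp
    ring
  · intro x hx
    have := mul_pos (hp x (Set.Ioi_subset_Ici_self hx)) (hq x (Set.Ioi_subset_Ici_self hx))
    positivity
  · have h1 : Filter.Tendsto (fun x : ℝ => (a * x⁻¹ + b) / (c * x⁻¹ + d)) Filter.atTop
        (nhds ((a * 0 + b) / (c * 0 + d))) :=
      ((tendsto_inv_atTop_zero.const_mul a).add_const b).div
        ((tendsto_inv_atTop_zero.const_mul c).add_const d) (by simp [hd.ne'])
    have h2 : Filter.Tendsto (fun x : ℝ => (a + b * x) / (c + d * x)) Filter.atTop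
        (nhds (b / d)) := by
      simp only [mul_zero, zero_add] at h1
      refine h1.congr' ?_
      filter_upwards [Filter.eventually_gt_atTop 0] with x hx
      rw [← mul_div_mul_right _ _ hx.ne']
      congr 1 <;> field_simp
    exact (h2.log (div_pos hb hd).ne').div_const _

theorem exists_polar {u v : ℝ} (hv : 0 < v) :
    ∃ r φ : ℝ, 0 < r ∧ 0 < φ ∧ φ < Real.pi ∧ r * Real.cos φ = u ∧ r * Real.sin φ = v := by
  have hz : (⟨u, v⟩ : ℂ) ≠ 0 := fun h => hv.ne' (congrArg Complex.im h)
  have hr : 0 < ‖(⟨u, v⟩ : ℂ)‖ := norm_pos_iff.2 hz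
  have hs : ‖(⟨u, v⟩ : ℂ)‖ * Real.sin (Complex.arg ⟨u, v⟩) = v := by
    rw [Complex.sin_arg]; field_simp
  have hsin : 0 < Real.sin (Complex.arg ⟨u, v⟩) := pos_of_mul_pos_right (hs.symm ▸ hv) hr.le
  refine ⟨‖(⟨u, v⟩ : ℂ)‖, Complex.arg ⟨u, v⟩, hr, ?_, ?_, ?_, hs⟩
  · by_contra hle
    exact absurd (Real.sin_nonpos_of_nonpos_of_neg_pi_le (not_lt.1 hle)
      (Complex.neg_pi_lt_arg _).le) (not_le.2 hsin)
  · refine lt_of_le_of_ne (Complex.arg_le_pi _) fun h => ?_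
    rw [h, Real.sin_pi] at hsin
    exact hsin.false
  · rw [Complex.cos_arg hz]; field_simp

/-- The angle `φ` that a side of a triangle with angle `γ` is seen under. -/
theorem image_sin_div_sin {γ : ℝ} (hγ0 : 0 < γ) (hγ : γ < Real.pi) :
    (fun φ => Real.sin φ / Real.sin (γ - φ)) '' Set.Ioo 0 γ = Set.Ioi 0 := by
  have hsγ := Real.sin_pos_of_pos_of_lt_pi hγ0 hγ
  ext y
  constructor
  · rintro ⟨φ, ⟨h1, h2⟩, rfl⟩
    exact div_pos (Real.sin_pos_of_pos_of_lt_pi h1 (by linarith))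
      (Real.sin_pos_of_pos_of_lt_pi (by linarith) (by linarith))
  · intro hy
    -- φ is the argument of `1 + y exp(iγ)`, the diagonal of the parallelogram with sides 1 and y
    -- enclosing the angle γ.
    obtain ⟨r, φ, hr, h1, h2, hc, hs⟩ := exists_polar (u := 1 + y * Real.cos γ)
      (mul_pos hy hsγ)
    have hd : r * Real.sin (γ - φ) = Real.sin γ := by
      rw [Real.sin_sub]
      linear_combination Real.sin γ * hc - Real.cos γ * hs
    have hpos : 0 < Real.sin (γ - φ) := pos_of_mul_pos_right (hd.symm ▸ hsγ) hr.le
    have hlt : φ < γ := by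
      by_contra hle
      exact absurd (Real.sin_nonpos_of_nonpos_of_neg_pi_le (x := γ - φ) (by linarith)
        (by linarith)) (not_le.2 hpos)
    refine ⟨φ, ⟨h1, hlt⟩, ?_⟩
    change Real.sin φ / Real.sin (γ - φ) = y
    rw [div_eq_iff hpos.ne']
    refine mul_left_cancel₀ hr.ne' ?_
    linear_combination hs - y * hd

theorem injOn_sin_div_sin {γ : ℝ} (hγ0 : 0 < γ) (hγ : γ < Real.pi) :
    Set.InjOn (fun φ => Real.sin φ / Real.sin (γ - φ)) (Set.Ioo 0 γ) := by
  have hsγ := Real.sin_pos_of_pos_of_lt_pi hγ0 hγ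
  rintro x ⟨hx1, hx2⟩ y ⟨hy1, hy2⟩ h
  have h1 : Real.sin (γ - x) ≠ 0 :=
    (Real.sin_pos_of_pos_of_lt_pi (by linarith) (by linarith)).ne'
  have h2 : Real.sin (γ - y) ≠ 0 :=
    (Real.sin_pos_of_pos_of_lt_pi (by linarith) (by linarith)).ne'
  simp only at h
  rw [div_eq_div_iff h1 h2, Real.sin_sub, Real.sin_sub] at h
  have h3 : Real.sin γ * Real.sin (x - y) = 0 := by
    rw [Real.sin_sub]; linear_combination h
  have h4 := (mul_eq_zero.1 h3).resolve_left hsγ.ne'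
  have h5 := (Real.sin_eq_zero_iff_of_lt_of_lt (by linarith) (by linarith)).1 h4
  linarith

/-- Gives the sign of the logarithm in the next integrand. -/
theorem sin_mul_sin_sub_sin_mul_sin (β γ φ : ℝ) :
    Real.sin (β + φ) * Real.sin (β + γ - φ) - Real.sin φ * Real.sin (γ - φ) =
      Real.sin β * Real.sin (β + γ) := by
  rw [show β + γ - φ = β + (γ - φ) by ring, show β + γ = β + ((γ - φ) + φ) by ring]
  generalize γ - φ = ψ
  simp only [Real.sin_add, Real.cos_add]
  linear_combination (Real.sin φ * Real.sin ψ) * Real.sin_sq_add_cos_sq β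

open MeasureTheory in
-- Each factor of the numerator contributes `logSinInt (β + γ) - logSinInt β` and each factor of the
-- denominator contributes `logSinInt γ`, which accounts for the factor 2.
theorem lintegral_log_sin_ratio {β γ : ℝ} (hβ : 0 < β) (hγ : 0 < γ) (h : β + γ < Real.pi) :
    ∫⁻ φ in Set.Ioo 0 γ, ENNReal.ofReal (Real.log (Real.sin (β + φ) * Real.sin (β + γ - φ) /
      (Real.sin φ * Real.sin (γ - φ)))) = ENNReal.ofReal (2 * angleVolume β γ) := by
  have h_int : ∀ c a b : ℝ, IntervalIntegrable (fun φ => Real.log (Real.sin (c + φ))) volume a b := by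
    intro c a b
    have := (intervalIntegrable_log_sin (a := c + a) (b := c + b)).comp_add_left c
    simpa [Function.comp_def] using this
  have h_int' : ∀ c a b : ℝ, IntervalIntegrable (fun φ => Real.log (Real.sin (c - φ))) volume a b := by
    intro c a b
    have := (intervalIntegrable_log_sin (a := c - a) (b := c - b)).comp_sub_left c
    simpa [Function.comp_def] using this
  have hi0 := h_int 0 0 γ
  simp only [zero_add] at hi0
  have hI : ∫ φ in (0 : ℝ)..γ, (Real.log (Real.sin (β + φ)) + Real.log (Real.sin (β + γ - φ)) -
      Real.log (Real.sin φ) - Real.log (Real.sin (γ - φ))) = 2 * angleVolume β γ := by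
    rw [intervalIntegral.integral_sub (((h_int _ _ _).add (h_int' _ _ _)).sub hi0) (h_int' _ _ _),
      intervalIntegral.integral_sub ((h_int _ _ _).add (h_int' _ _ _)) hi0,
      intervalIntegral.integral_add (h_int _ _ _) (h_int' _ _ _),
      intervalIntegral.integral_comp_add_left (fun x => Real.log (Real.sin x)),
      intervalIntegral.integral_comp_sub_left (fun x => Real.log (Real.sin x)),
      intervalIntegral.integral_comp_sub_left (fun x => Real.log (Real.sin x))]
    simp only [add_zero, sub_zero, add_sub_cancel_right, sub_self]
    have := intervalIntegral.integral_add_adjacent_intervals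
      (μ := volume) (f := fun t => Real.log (Real.sin t)) (a := 0) (b := β)
      (c := β + γ) intervalIntegrable_log_sin intervalIntegrable_log_sin
    simp only [angleVolume, logSinInt]
    linarith
  have hI2 := (((h_int β 0 γ).add (h_int' (β + γ) 0 γ)).sub hi0).sub (h_int' γ 0 γ)
  rw [intervalIntegrable_iff_integrableOn_Ioo_of_le hγ.le] at hI2
  rw [← hI, intervalIntegral.integral_of_le hγ.le, integral_Ioc_eq_integral_Ioo,
    ofReal_integral_eq_lintegral_ofReal]
  · refine setLIntegral_congr_fun measurableSet_Ioo fun φ hφ => ?_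
    obtain ⟨h1, h2⟩ := hφ
    have s1 : 0 < Real.sin (β + φ) := Real.sin_pos_of_pos_of_lt_pi (by linarith) (by linarith)
    have s2 : 0 < Real.sin (β + γ - φ) := Real.sin_pos_of_pos_of_lt_pi (by linarith) (by linarith)
    have s3 : 0 < Real.sin φ := Real.sin_pos_of_pos_of_lt_pi (by linarith) (by linarith)
    have s4 : 0 < Real.sin (γ - φ) := Real.sin_pos_of_pos_of_lt_pi (by linarith) (by linarith)
    rw [Real.log_div (by positivity) (by positivity), Real.log_mul s1.ne' s2.ne',
      Real.log_mul s3.ne' s4.ne']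
    congr 1
    ring
  · exact hI2
  · refine (ae_restrict_iff' measurableSet_Ioo).2 (.of_forall fun φ hφ => ?_)
    obtain ⟨h1, h2⟩ := hφ
    have s1 : 0 < Real.sin (β + φ) := Real.sin_pos_of_pos_of_lt_pi (by linarith) (by linarith)
    have s2 : 0 < Real.sin (β + γ - φ) := Real.sin_pos_of_pos_of_lt_pi (by linarith) (by linarith)
    have s3 : 0 < Real.sin φ := Real.sin_pos_of_pos_of_lt_pi (by linarith) (by linarith)
    have s4 : 0 < Real.sin (γ - φ) := Real.sin_pos_of_pos_of_lt_pi (by linarith) (by linarith)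
    have hle : Real.log (Real.sin φ * Real.sin (γ - φ)) ≤
        Real.log (Real.sin (β + φ) * Real.sin (β + γ - φ)) := by
      refine Real.log_le_log (by positivity) ?_
      have := sin_mul_sin_sub_sin_mul_sin β γ φ
      have p := mul_pos (Real.sin_pos_of_pos_of_lt_pi hβ (by linarith))
        (Real.sin_pos_of_pos_of_lt_pi (by linarith : 0 < β + γ) h)
      linarith
    rw [Real.log_mul s1.ne' s2.ne', Real.log_mul s3.ne' s4.ne'] at hle
    simp only [Pi.zero_apply]
    linarith

open MeasureTheory in
-- The substitution `y = sin φ / sin (γ - φ)` turns the quadratic into `sin² γ / sin² (γ - φ)`,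
-- which cancels the Jacobian up to `sin γ`, and turns the argument of the logarithm into the ratio
-- of sines integrated above.
theorem lintegral_log_div_quadratic {β γ ρ : ℝ} (hβ : 0 < β) (hγ : 0 < γ) (h : β + γ < Real.pi)
    (hρ : ρ = Real.sin (β + γ) / Real.sin β) :
    ∫⁻ y in Set.Ioi (0 : ℝ), ENNReal.ofReal
      (Real.log ((1 + ρ * y) * (1 + y / ρ) / ((ρ + 1 / ρ - 2 * Real.cos γ) * y)) /
        (1 + 2 * Real.cos γ * y + y ^ 2)) =
      ENNReal.ofReal (2 * angleVolume β γ / Real.sin γ) := by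
  have hsβ : 0 < Real.sin β := Real.sin_pos_of_pos_of_lt_pi hβ (by linarith)
  have hsγ : 0 < Real.sin γ := Real.sin_pos_of_pos_of_lt_pi hγ (by linarith)
  have hsα : 0 < Real.sin (β + γ) := Real.sin_pos_of_pos_of_lt_pi (by linarith) h
  rw [← image_sin_div_sin hγ (by linarith), lintegral_image_eq_lintegral_abs_deriv_mul
    (f' := fun φ => Real.sin γ / Real.sin (γ - φ) ^ 2) measurableSet_Ioo ?_
    (injOn_sin_div_sin hγ (by linarith))]
  · rw [div_eq_inv_mul (2 * angleVolume β γ), ENNReal.ofReal_mul (by positivity), ← lintegral_log_sin_ratio hβ hγ h,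
      ← lintegral_const_mul' _ _ (by simp)]
    refine setLIntegral_congr_fun measurableSet_Ioo fun φ hφ => ?_
    obtain ⟨h1, h2⟩ := hφ
    have s1 : 0 < Real.sin (β + φ) := Real.sin_pos_of_pos_of_lt_pi (by linarith) (by linarith)
    have s2 : 0 < Real.sin (β + γ - φ) := Real.sin_pos_of_pos_of_lt_pi (by linarith) (by linarith)
    have s3 : 0 < Real.sin φ := Real.sin_pos_of_pos_of_lt_pi (by linarith) (by linarith)
    have s4 : 0 < Real.sin (γ - φ) := Real.sin_pos_of_pos_of_lt_pi (by linarith) (by linarith)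
    have i1 : Real.sin β * Real.sin (γ - φ) + Real.sin (β + γ) * Real.sin φ =
        Real.sin γ * Real.sin (β + φ) := by
      rw [show γ = (γ - φ) + φ by ring, show γ - φ + φ - φ = γ - φ by ring]
      generalize γ - φ = ψ
      simp only [Real.sin_add, Real.cos_add]
      linear_combination -(Real.sin β * Real.sin ψ) * Real.sin_sq_add_cos_sq φ
    have i2 : Real.sin (β + γ) * Real.sin (γ - φ) + Real.sin β * Real.sin φ =
        Real.sin γ * Real.sin (β + γ - φ) := by
      rw [show β + γ - φ = β + (γ - φ) by ring, show γ = (γ - φ) + φ by ring,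
        show γ - φ + φ - φ = γ - φ by ring]
      generalize γ - φ = ψ
      simp only [Real.sin_add, Real.cos_add]
      linear_combination -(Real.sin β * Real.sin φ) * Real.sin_sq_add_cos_sq ψ
    have i3 : Real.sin (γ - φ) ^ 2 + 2 * Real.cos γ * Real.sin φ * Real.sin (γ - φ) +
        Real.sin φ ^ 2 = Real.sin γ ^ 2 := by
      rw [show γ = (γ - φ) + φ by ring, show γ - φ + φ - φ = γ - φ by ring]
      generalize γ - φ = ψ
      simp only [Real.sin_add, Real.cos_add]
      linear_combination -Real.sin φ ^ 2 * Real.sin_sq_add_cos_sq ψ -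
        Real.sin ψ ^ 2 * Real.sin_sq_add_cos_sq φ
    have i4 : Real.sin (β + γ) ^ 2 + Real.sin β ^ 2 - 2 * Real.cos γ * Real.sin (β + γ) *
        Real.sin β = Real.sin γ ^ 2 := by
      simp only [Real.sin_add]
      linear_combination Real.sin γ ^ 2 * Real.sin_sq_add_cos_sq β -
        Real.sin β ^ 2 * Real.sin_sq_add_cos_sq γ
    have e1 : 1 + ρ * (Real.sin φ / Real.sin (γ - φ)) =
        Real.sin γ * Real.sin (β + φ) / (Real.sin β * Real.sin (γ - φ)) := by
      rw [← i1, hρ]; field_simp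
    have e2 : 1 + Real.sin φ / Real.sin (γ - φ) / ρ =
        Real.sin γ * Real.sin (β + γ - φ) / (Real.sin (β + γ) * Real.sin (γ - φ)) := by
      rw [← i2, hρ]; field_simp
    have e3 : 1 + 2 * Real.cos γ * (Real.sin φ / Real.sin (γ - φ)) +
        (Real.sin φ / Real.sin (γ - φ)) ^ 2 = Real.sin γ ^ 2 / Real.sin (γ - φ) ^ 2 := by
      rw [← i3]; field_simp
    have e4 : ρ + 1 / ρ - 2 * Real.cos γ =
        Real.sin γ ^ 2 / (Real.sin β * Real.sin (β + γ)) := by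
      rw [← i4, hρ]; field_simp
    rw [e1, e2, e3, e4, abs_of_pos (by positivity), ← ENNReal.ofReal_mul (by positivity),
      ← ENNReal.ofReal_mul (by positivity)]
    congr 1
    have e5 : Real.sin γ * Real.sin (β + φ) / (Real.sin β * Real.sin (γ - φ)) *
        (Real.sin γ * Real.sin (β + γ - φ) / (Real.sin (β + γ) * Real.sin (γ - φ))) /
        (Real.sin γ ^ 2 / (Real.sin β * Real.sin (β + γ)) *
          (Real.sin φ / Real.sin (γ - φ))) =
        Real.sin (β + φ) * Real.sin (β + γ - φ) / (Real.sin φ * Real.sin (γ - φ)) := by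
      field_simp
    rw [e5]
    field_simp
  · rintro φ ⟨h1, h2⟩
    have s4 : 0 < Real.sin (γ - φ) := Real.sin_pos_of_pos_of_lt_pi (by linarith) (by linarith)
    have d2 := (Real.hasDerivAt_sin (γ - φ)).comp_const_sub γ φ
    refine (((Real.hasDerivAt_sin φ).div d2 s4.ne').congr_deriv ?_).hasDerivWithinAt
    congr 1
    have : Real.sin γ = Real.sin ((γ - φ) + φ) := by ring_nf
    rw [this, Real.sin_add]
    ring

open MeasureTheory in
theorem lintegral_Ioi_comp_mul {κ : ℝ} (hκ : 0 < κ) (g : ℝ → ENNReal) :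
    ∫⁻ x in Set.Ioi (0 : ℝ), g x =
      ENNReal.ofReal κ * ∫⁻ y in Set.Ioi (0 : ℝ), g (κ * y) := by
  have himg : (fun y => κ * y) '' Set.Ioi (0 : ℝ) = Set.Ioi 0 := by
    simpa using Set.image_mul_left_Ioi hκ 0
  conv_lhs => rw [← himg]
  rw [lintegral_image_eq_lintegral_abs_deriv_mul (f' := fun _ => κ) measurableSet_Ioi
    (fun x _ => by simpa using ((hasDerivAt_id x).const_mul κ).hasDerivWithinAt)
    (fun x _ y _ h => mul_left_cancel₀ hκ.ne' h), lintegral_const_mul' _ _ (by simp),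
    abs_of_pos hκ]

/-- The hypotheses are the sine and cosine laws of a triangle whose squared sides are the opposite
products `e₀₁e₂₃`, `e₀₂e₁₃`, `e₀₃e₁₂`; here `s` is the product of the first two sides and γ the
angle between them. The z-integrand is the inverse square of a linear function, the y-integrand the
inverse of a product of two linear functions, and what remains in x is the integral of
`lintegral_log_div_quadratic`. -/
theorem lintegral_inv_sq_bilinear {e₀₁ e₀₂ e₀₃ e₁₂ e₁₃ e₂₃ s β γ : ℝ} (h₀₁ : 0 < e₀₁) (h₀₂ : 0 < e₀₂)
    (h₀₃ : 0 < e₀₃) (h₁₂ : 0 < e₁₂) (h₁₃ : 0 < e₁₃) (h₂₃ : 0 < e₂₃) (hs : 0 < s)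
    (hs2 : s ^ 2 = e₀₁ * e₂₃ * (e₀₂ * e₁₃)) (hβ : 0 < β) (hγ : 0 < γ) (h : β + γ < Real.pi)
    (hsin : s * Real.sin β = e₀₂ * e₁₃ * Real.sin (β + γ))
    (hcos : e₀₁ * e₂₃ + e₀₂ * e₁₃ - e₀₃ * e₁₂ = 2 * s * Real.cos γ) :
    ∫⁻ x in Set.Ioi (0 : ℝ), ∫⁻ y in Set.Ioi (0 : ℝ), ∫⁻ z in Set.Ioi (0 : ℝ),
      ENNReal.ofReal (((e₀₁ * z + e₀₂ * y + e₀₃ * x + e₁₂ * z * y + e₁₃ * z * x +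
        e₂₃ * y * x) ^ 2)⁻¹) = ENNReal.ofReal (2 * angleVolume β γ / (s * Real.sin γ)) := by
  have hsβ : 0 < Real.sin β := Real.sin_pos_of_pos_of_lt_pi hβ (by linarith)
  have hsγ : 0 < Real.sin γ := Real.sin_pos_of_pos_of_lt_pi hγ (by linarith)
  have hquad : ∀ x : ℝ, 0 < x →
      0 < (e₀₂ + e₂₃ * x) * (e₀₁ + e₁₃ * x) - e₀₃ * x * e₁₂ := by
    intro x hx
    have h1 : (e₀₂ + e₂₃ * x) * (e₀₁ + e₁₃ * x) - e₀₃ * x * e₁₂ =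
        e₀₁ * e₀₂ + 2 * s * Real.cos γ * x + e₁₃ * e₂₃ * x ^ 2 := by
      linear_combination x * hcos
    rw [h1]
    have h2 : 0 < e₀₁ * e₀₂ * (e₀₁ * e₀₂ + 2 * s * Real.cos γ * x + e₁₃ * e₂₃ * x ^ 2) := by
      have : e₀₁ * e₀₂ * (e₀₁ * e₀₂ + 2 * s * Real.cos γ * x + e₁₃ * e₂₃ * x ^ 2) =
          (e₀₁ * e₀₂ + s * Real.cos γ * x) ^ 2 + (s * Real.sin γ * x) ^ 2 := by
        linear_combination -x ^ 2 * hs2 - s ^ 2 * x ^ 2 * Real.sin_sq_add_cos_sq γ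
      rw [this]
      positivity
    exact pos_of_mul_pos_right h2 (by positivity)
  have hstep : ∀ x ∈ Set.Ioi (0 : ℝ), ∫⁻ y in Set.Ioi (0 : ℝ), ∫⁻ z in Set.Ioi (0 : ℝ),
      ENNReal.ofReal (((e₀₁ * z + e₀₂ * y + e₀₃ * x + e₁₂ * z * y + e₁₃ * z * x +
        e₂₃ * y * x) ^ 2)⁻¹) = ENNReal.ofReal (Real.log ((e₀₂ + e₂₃ * x) * (e₀₁ + e₁₃ * x) /
          (e₀₃ * x * e₁₂)) / ((e₀₂ + e₂₃ * x) * (e₀₁ + e₁₃ * x) - e₀₃ * x * e₁₂)) := by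
    intro x hx
    have hx' : 0 < x := hx
    rw [← lintegral_inv_linear_mul_linear (by positivity) (by positivity) (by positivity)
      h₁₂ (hquad x hx)]
    refine MeasureTheory.setLIntegral_congr_fun measurableSet_Ioi fun y hy => ?_
    have hy' : 0 < y := hy
    have := lintegral_inv_sq_linear (a := e₀₃ * x + (e₀₂ + e₂₃ * x) * y)
      (b := e₀₁ + e₁₃ * x + e₁₂ * y) (by positivity) (by positivity)
    rw [← this]
    refine MeasureTheory.setLIntegral_congr_fun measurableSet_Ioi fun z _ => ?_
    congr 3
    ring
  rw [MeasureTheory.setLIntegral_congr_fun measurableSet_Ioi hstep,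
    -- This scaling makes the quadratic denominator `e₀₁e₀₂ (1 + 2 cos γ y + y²)`.
    lintegral_Ioi_comp_mul (κ := s / (e₁₃ * e₂₃)) (by positivity)]
  have hρ : s / (e₀₂ * e₁₃) = Real.sin (β + γ) / Real.sin β := by
    rw [div_eq_div_iff (by positivity) hsβ.ne']; linarith
  have hρ' : s / (e₀₂ * e₁₃) + 1 / (s / (e₀₂ * e₁₃)) - 2 * Real.cos γ = e₀₃ * e₁₂ / s := by
    field_simp
    linear_combination hs2 + (e₀₂ * e₁₃) * hcos
  have hκ : e₁₃ * e₂₃ * (s / (e₁₃ * e₂₃)) ^ 2 = e₀₁ * e₀₂ := by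
    field_simp
    linear_combination hs2
  rw [show 2 * angleVolume β γ / (s * Real.sin γ) = s⁻¹ * (2 * angleVolume β γ / Real.sin γ) by
      field_simp, ENNReal.ofReal_mul (by positivity), ← lintegral_log_div_quadratic hβ hγ h hρ,
    ← MeasureTheory.lintegral_const_mul' _ _ (by simp),
    ← MeasureTheory.lintegral_const_mul' _ _ (by simp)]
  refine MeasureTheory.setLIntegral_congr_fun measurableSet_Ioi fun y hy => ?_
  have hy' : 0 < y := hy
  rw [← ENNReal.ofReal_mul (by positivity), ← ENNReal.ofReal_mul (by positivity), hρ']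
  congr 1
  have q1 : (e₀₂ + e₂₃ * (s / (e₁₃ * e₂₃) * y)) * (e₀₁ + e₁₃ * (s / (e₁₃ * e₂₃) * y)) -
      e₀₃ * (s / (e₁₃ * e₂₃) * y) * e₁₂ =
      e₀₁ * e₀₂ * (1 + 2 * Real.cos γ * y + y ^ 2) := by
    have : s / (e₁₃ * e₂₃) * s = e₀₁ * e₀₂ := by
      rw [← hκ]; field_simp
    linear_combination (s / (e₁₃ * e₂₃) * y) * hcos + y ^ 2 * hκ + 2 * Real.cos γ * y * this
  have q2 : (e₀₂ + e₂₃ * (s / (e₁₃ * e₂₃) * y)) * (e₀₁ + e₁₃ * (s / (e₁₃ * e₂₃) * y)) /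
      (e₀₃ * (s / (e₁₃ * e₂₃) * y) * e₁₂) =
      (1 + s / (e₀₂ * e₁₃) * y) * (1 + y / (s / (e₀₂ * e₁₃))) / (e₀₃ * e₁₂ / s * y) := by
    have a1 : e₀₂ + e₂₃ * (s / (e₁₃ * e₂₃) * y) = e₀₂ * (1 + s / (e₀₂ * e₁₃) * y) := by
      field_simp
    have a2 : e₀₁ + e₁₃ * (s / (e₁₃ * e₂₃) * y) = e₀₁ * (1 + y / (s / (e₀₂ * e₁₃))) := by
      field_simp
      linear_combination y * hs2
    rw [a1, a2, div_eq_div_iff (by positivity) (by positivity)]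
    have a3 : s / (e₁₃ * e₂₃) = e₀₁ * e₀₂ / s := by
      field_simp
      linear_combination hs2
    rw [a3]
    ring
  rw [q1, q2]
  generalize Real.log _ = l
  have a3 : s / (e₁₃ * e₂₃) = e₀₁ * e₀₂ / s := by
    field_simp
    linear_combination hs2
  have hq : 0 < 1 + 2 * Real.cos γ * y + y ^ 2 := by
    have : 1 + 2 * Real.cos γ * y + y ^ 2 = (1 + Real.cos γ * y) ^ 2 + (Real.sin γ * y) ^ 2 := by
      linear_combination -y ^ 2 * Real.sin_sq_add_cos_sq γ
    rw [this]
    positivity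
  rw [a3]
  field_simp

/-! ### Hyperbolic volume of an ideal simplex in barycentric coordinates -/

section

open MeasureTheory

theorem mem_convexHull_range_iff {E ι : Type*} [AddCommGroup E] [Module ℝ E] [Fintype ι]
    {x : ι → E} {z : E} : z ∈ convexHull ℝ (Set.range x) ↔
      ∃ w : ι → ℝ, (∀ i, 0 ≤ w i) ∧ ∑ i, w i = 1 ∧ ∑ i, w i • x i = z := by
  classical
  constructor
  · intro hz
    have hconv : Convex ℝ ((Fintype.linearCombination ℝ x) '' stdSimplex ℝ ι) :=
      (convex_stdSimplex ℝ ι).linear_image _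
    have hsub : Set.range x ⊆ (Fintype.linearCombination ℝ x) '' stdSimplex ℝ ι := by
      rintro _ ⟨i, rfl⟩
      exact ⟨Pi.single i 1, single_mem_stdSimplex ℝ i, by simp⟩
    obtain ⟨w, ⟨h1, h2⟩, h3⟩ := convexHull_min hsub hconv hz
    exact ⟨w, h1, h2, by simpa [Fintype.linearCombination_apply] using h3⟩
  · rintro ⟨w, h1, h2, h3⟩
    exact mem_convexHull_of_exists_fintype w x h1 h2 (fun i => Set.mem_range_self i) h3

/-- The matrix of edge vectors at the vertex `x 0`. -/
def edgeMatrix (x : Fin 4 → EuclideanSpace ℝ (Fin 3)) : Matrix (Fin 3) (Fin 3) ℝ :=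
  Matrix.of fun i j => x i.succ j - x 0 j

theorem affineIndependent_iff_det_edgeMatrix_ne_zero (x : Fin 4 → EuclideanSpace ℝ (Fin 3)) :
    AffineIndependent ℝ x ↔ (edgeMatrix x).det ≠ 0 := by
  rw [affineIndependent_iff_linearIndependent_vsub ℝ x 0,
    ← linearIndependent_equiv (finSuccAboveEquiv 0), ← isUnit_iff_ne_zero,
    ← Matrix.isUnit_iff_isUnit_det, ← Matrix.linearIndependent_rows_iff_isUnit,
    ← LinearMap.linearIndependent_iff (WithLp.linearEquiv 2 ℝ (Fin 3 → ℝ)).toLinearMap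
      (LinearEquiv.ker _)]
  rfl

theorem kleinVolume_absolutelyContinuous : kleinVolume ≪ volume :=
  (withDensity_absolutelyContinuous _ _).trans Measure.restrict_le_self.absolutelyContinuous

theorem kleinVolume_convexHull_of_det_eq_zero (x : Fin 4 → EuclideanSpace ℝ (Fin 3))
    (h : (edgeMatrix x).det = 0) : kleinVolume (convexHull ℝ (Set.range x)) = 0 := by
  refine kleinVolume_absolutelyContinuous (measure_mono_null (convexHull_subset_affineSpan _)
    (Measure.addHaar_affineSubspace volume _ fun htop => ?_))
  refine (affineIndependent_iff_det_edgeMatrix_ne_zero x).1 ?_ h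
  rw [affineIndependent_iff_finrank_vectorSpan_eq ℝ x (n := 3) (by simp),
    ← direction_affineSpan, htop, AffineSubspace.direction_top, finrank_top]
  simp

/-- The projective parametrization of the interior of a simplex by the positive octant, in
barycentric coordinates with the first weight normalized to `1`. -/
noncomputable def octantMap (c : Fin 3 → ℝ) : Fin 3 → ℝ := fun i => c i / (1 + (c 0 + c 1 + c 2))

/-- The Jacobian matrix of `octantMap`. -/
noncomputable def octantJacobian (c : Fin 3 → ℝ) : Matrix (Fin 3) (Fin 3) ℝ :=
  Matrix.of fun i j => (if i = j then (1 + (c 0 + c 1 + c 2)) - c i else -c i) /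
    (1 + (c 0 + c 1 + c 2)) ^ 2

theorem hasFDerivAt_octantMap {c : Fin 3 → ℝ} (h : 1 + (c 0 + c 1 + c 2) ≠ 0) :
    HasFDerivAt octantMap (Matrix.toLin' (octantJacobian c)).toContinuousLinearMap c := by
  rw [hasFDerivAt_pi']
  intro i
  have hp : ∀ k : Fin 3, HasFDerivAt (fun c : Fin 3 → ℝ => c k)
      (ContinuousLinearMap.proj k : (Fin 3 → ℝ) →L[ℝ] ℝ) c := fun k => hasFDerivAt_apply k c
  have hs : HasFDerivAt (fun c : Fin 3 → ℝ => 1 + (c 0 + c 1 + c 2)) _ c :=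
    (((hp 0).add (hp 1)).add (hp 2)).const_add 1
  have := (hp i).mul ((hasDerivAt_inv h).comp_hasFDerivAt c hs)
  refine this.congr_fderiv ?_
  ext v
  simp only [ContinuousLinearMap.coe_comp, Function.comp_apply, ContinuousLinearMap.proj_apply,
    LinearMap.coe_toContinuousLinearMap', Matrix.toLin'_apply, Matrix.mulVec, dotProduct,
    Fin.sum_univ_three, octantJacobian, Matrix.of_apply]
  fin_cases i <;> simp <;> field_simp <;> ring

theorem det_octantJacobian {c : Fin 3 → ℝ} (h : 1 + (c 0 + c 1 + c 2) ≠ 0) :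
    (octantJacobian c).det = ((1 + (c 0 + c 1 + c 2)) ^ 4)⁻¹ := by
  rw [Matrix.det_fin_three]
  simp [octantJacobian]
  field_simp
  ring

/-- The positive octant. -/
def octant : Set (Fin 3 → ℝ) := {c | ∀ i, 0 < c i}

theorem measurableSet_octant : MeasurableSet octant := by
  rw [octant, Set.ofPred_forall]
  exact MeasurableSet.iInter fun i => measurableSet_lt measurable_const (measurable_pi_apply i)

theorem one_add_pos_of_mem_octant {c : Fin 3 → ℝ} (hc : c ∈ octant) :
    0 < 1 + (c 0 + c 1 + c 2) := by
  have h0 := hc 0; have h1 := hc 1; have h2 := hc 2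
  linarith

theorem injOn_octantMap : Set.InjOn octantMap octant := by
  intro c hc c' hc' h
  have hs := one_add_pos_of_mem_octant hc
  have hs' := one_add_pos_of_mem_octant hc'
  have hi : ∀ i, c i / (1 + (c 0 + c 1 + c 2)) = c' i / (1 + (c' 0 + c' 1 + c' 2)) :=
    fun i => congrFun h i
  have h0 := hi 0; have h1 := hi 1; have h2 := hi 2
  rw [div_eq_div_iff hs.ne' hs'.ne'] at h0 h1 h2
  have he : 1 + (c 0 + c 1 + c 2) = 1 + (c' 0 + c' 1 + c' 2) := by linarith
  funext i
  have := hi i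
  rw [he] at this
  exact (div_left_inj' hs'.ne').1 this

/-- The quadratic form of the squared edge lengths, in barycentric coordinates `(1, c)`. -/
noncomputable def edgeForm (x : Fin 4 → EuclideanSpace ℝ (Fin 3)) (c : Fin 3 → ℝ) : ℝ :=
  ‖x 1 - x 0‖ ^ 2 * c 0 + ‖x 2 - x 0‖ ^ 2 * c 1 + ‖x 3 - x 0‖ ^ 2 * c 2 +
    ‖x 2 - x 1‖ ^ 2 * c 0 * c 1 + ‖x 3 - x 1‖ ^ 2 * c 0 * c 2 + ‖x 3 - x 2‖ ^ 2 * c 1 * c 2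

/-- For points of the unit sphere and weights of sum 1, `1 - ‖∑ wᵢxᵢ‖²` equals `∑_{i<j} wᵢwⱼ‖xᵢ -
xⱼ‖²`. -/
theorem one_sub_norm_sq_eq (x : Fin 4 → EuclideanSpace ℝ (Fin 3)) (hx : ∀ i, ‖x i‖ = 1)
    {c : Fin 3 → ℝ} (h : 1 + (c 0 + c 1 + c 2) ≠ 0) :
    1 - ‖WithLp.toLp 2 (WithLp.ofLp (x 0) + (edgeMatrix x).transpose.mulVec (octantMap c))‖ ^ 2 =
      edgeForm x c / (1 + (c 0 + c 1 + c 2)) ^ 2 := by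
  have hx' : ∀ i, x i 0 ^ 2 + x i 1 ^ 2 + x i 2 ^ 2 = 1 := by
    intro i
    have := EuclideanSpace.real_norm_sq_eq (x i)
    rw [hx i, Fin.sum_univ_three] at this
    linarith
  have h0 := hx' 0; have h1 := hx' 1; have h2 := hx' 2; have h3 := hx' 3
  rw [eq_div_iff (pow_ne_zero 2 h)]
  have key : ∀ k, x 0 k + (edgeMatrix x).transpose.mulVec (octantMap c) k =
      (x 0 k + c 0 * x 1 k + c 1 * x 2 k + c 2 * x 3 k) / (1 + (c 0 + c 1 + c 2)) := by
    intro k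
    simp only [Matrix.mulVec, dotProduct, Fin.sum_univ_three, Matrix.transpose_apply, edgeMatrix,
      Matrix.of_apply, octantMap, Fin.succ_zero_eq_one, Fin.succ_one_eq_two,
      show Fin.succ (2 : Fin 3) = 3 from rfl]
    field_simp
    ring
  simp only [edgeForm, EuclideanSpace.real_norm_sq_eq, Fin.sum_univ_three,
    Pi.add_apply, key, PiLp.sub_apply]
  field_simp
  linear_combination (-1 - c 0 - c 1 - c 2) * h0 + (-1 - c 0 - c 1 - c 2) * c 0 * h1 +
    (-1 - c 0 - c 1 - c 2) * c 1 * h2 + (-1 - c 0 - c 1 - c 2) * c 2 * h3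

end

section

open MeasureTheory

/-- The projective parametrization of the interior of the simplex with vertices `x`. -/
noncomputable def simplexMap (x : Fin 4 → EuclideanSpace ℝ (Fin 3)) (c : Fin 3 → ℝ) : Fin 3 → ℝ :=
  WithLp.ofLp (x 0) + (edgeMatrix x).transpose.mulVec (octantMap c)

theorem simplexMap_apply (x : Fin 4 → EuclideanSpace ℝ (Fin 3)) {c : Fin 3 → ℝ}
    (h : 1 + (c 0 + c 1 + c 2) ≠ 0) (k : Fin 3) : simplexMap x c k =
      (x 0 k + c 0 * x 1 k + c 1 * x 2 k + c 2 * x 3 k) / (1 + (c 0 + c 1 + c 2)) := by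
  simp only [simplexMap, Pi.add_apply, Matrix.mulVec, dotProduct, Fin.sum_univ_three,
    Matrix.transpose_apply, edgeMatrix, Matrix.of_apply, octantMap, Fin.succ_zero_eq_one,
    Fin.succ_one_eq_two, show Fin.succ (2 : Fin 3) = 3 from rfl]
  field_simp
  ring

theorem hasFDerivAt_simplexMap (x : Fin 4 → EuclideanSpace ℝ (Fin 3)) {c : Fin 3 → ℝ}
    (h : 1 + (c 0 + c 1 + c 2) ≠ 0) :
    HasFDerivAt (simplexMap x) (Matrix.toLin' ((edgeMatrix x).transpose *
      octantJacobian c)).toContinuousLinearMap c := by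
  have h1 := (((Matrix.toLin' (edgeMatrix x).transpose).toContinuousLinearMap.hasFDerivAt).comp c
    (hasFDerivAt_octantMap h)).const_add (WithLp.ofLp (x 0))
  refine h1.congr_fderiv ?_
  ext v
  simp

theorem injOn_simplexMap {x : Fin 4 → EuclideanSpace ℝ (Fin 3)} (hD : (edgeMatrix x).det ≠ 0) :
    Set.InjOn (simplexMap x) octant := by
  intro c hc c' hc' h
  have hinj : Function.Injective (edgeMatrix x).transpose.mulVec := by
    rw [Matrix.mulVec_injective_iff_isUnit, Matrix.isUnit_iff_isUnit_det, Matrix.det_transpose]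
    exact isUnit_iff_ne_zero.2 hD
  exact injOn_octantMap hc hc' (hinj (add_left_cancel h))

theorem edgeForm_pos {x : Fin 4 → EuclideanSpace ℝ (Fin 3)} (hinj : Function.Injective x)
    {c : Fin 3 → ℝ} (hc : c ∈ octant) : 0 < edgeForm x c := by
  have hn : ∀ i j : Fin 4, i ≠ j → 0 < ‖x i - x j‖ := fun i j hij =>
    norm_pos_iff.2 (sub_ne_zero.2 (hinj.ne hij))
  have h1 := hn 1 0 (by decide); have h2 := hn 2 0 (by decide); have h3 := hn 3 0 (by decide)
  have h4 := hn 2 1 (by decide); have h5 := hn 3 1 (by decide); have h6 := hn 3 2 (by decide)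
  have c0 := hc 0; have c1 := hc 1; have c2 := hc 2
  unfold edgeForm
  positivity

theorem toLp_simplexMap_mem {x : Fin 4 → EuclideanSpace ℝ (Fin 3)} (hx : ∀ i, ‖x i‖ = 1)
    (hinj : Function.Injective x) {c : Fin 3 → ℝ} (hc : c ∈ octant) :
    WithLp.toLp 2 (simplexMap x c) ∈ convexHull ℝ (Set.range x) ∩ Metric.ball 0 1 := by
  have hs := one_add_pos_of_mem_octant hc
  constructor
  · rw [mem_convexHull_range_iff]
    refine ⟨![1 / (1 + (c 0 + c 1 + c 2)), c 0 / (1 + (c 0 + c 1 + c 2)),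
      c 1 / (1 + (c 0 + c 1 + c 2)), c 2 / (1 + (c 0 + c 1 + c 2))], ?_, ?_, ?_⟩
    · have c0 := hc 0; have c1 := hc 1; have c2 := hc 2
      intro i
      fin_cases i <;> simp <;> positivity
    · simp only [Fin.sum_univ_four, Matrix.cons_val]
      field_simp
      ring
    · ext k
      simp only [Fin.sum_univ_four, Matrix.cons_val, PiLp.add_apply, PiLp.smul_apply, smul_eq_mul,
        simplexMap_apply x hs.ne']
      field_simp
  · have h1 := one_sub_norm_sq_eq x hx hs.ne'
    have h2 : 0 < edgeForm x c / (1 + (c 0 + c 1 + c 2)) ^ 2 :=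
      div_pos (edgeForm_pos hinj hc) (by positivity)
    rw [← h1] at h2
    rw [mem_ball_zero_iff]
    have h3 := norm_nonneg (WithLp.toLp 2 (simplexMap x c))
    change 0 < 1 - ‖WithLp.toLp 2 (simplexMap x c)‖ ^ 2 at h2
    nlinarith

/-- A point of the hull with all barycentric weights positive is in the image of the octant; a
vanishing weight places the point in the plane of a face. For a nondegenerate simplex these planes
are null sets. -/
theorem convexHull_diff_subset (x : Fin 4 → EuclideanSpace ℝ (Fin 3)) :
    convexHull ℝ (Set.range x) \ (WithLp.toLp 2 '' (simplexMap x '' octant)) ⊆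
      ⋃ i, (affineSpan ℝ (x '' (Set.univ \ {i})) : Set (EuclideanSpace ℝ (Fin 3))) := by
  rintro z ⟨hz, hz'⟩
  obtain ⟨w, hw0, hw1, rfl⟩ := mem_convexHull_range_iff.1 hz
  by_contra hcon
  refine hz' ?_
  have hpos : ∀ i, 0 < w i := by
    intro i
    refine lt_of_le_of_ne (hw0 i) fun h0 => hcon (Set.mem_iUnion.2 ⟨i, ?_⟩)
    have := affineCombination_mem_affineSpan_image (k := ℝ) (s := Finset.univ) hw1
      (s' := Set.univ \ {i}) (fun j _ hj => by
        have : j = i := by simpa using hj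
        rw [this, ← h0]) x
    rwa [Finset.affineCombination_eq_linear_combination _ _ _ hw1] at this
  refine ⟨_, ⟨fun i => w i.succ / w 0, fun i => div_pos (hpos _) (hpos 0), rfl⟩, ?_⟩
  rw [Fin.sum_univ_four] at hw1
  have hne : 1 + (w 1 / w 0 + w 2 / w 0 + w 3 / w 0) = 1 / w 0 := by
    have := (hpos 0).ne'
    field_simp
    linarith
  have h0 := (hpos 0).ne'
  ext k
  change simplexMap x _ k = _
  rw [simplexMap_apply x (by
    change 1 + (w 1 / w 0 + w 2 / w 0 + w 3 / w 0) ≠ 0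
    rw [hne]; exact one_div_ne_zero h0)]
  change (x 0 k + w 1 / w 0 * x 1 k + w 2 / w 0 * x 2 k + w 3 / w 0 * x 3 k) /
    (1 + (w 1 / w 0 + w 2 / w 0 + w 3 / w 0)) = _
  rw [hne]
  simp only [Fin.sum_univ_four, PiLp.add_apply, PiLp.smul_apply, smul_eq_mul]
  field_simp

/-- The Jacobian of the projective parametrization carries the fourth inverse power of `1 + c 0 + c
1 + c 2`. The density `(1 - ‖x‖²)⁻²` carries the fourth power, so only the quadratic form of edge
lengths survives. -/
theorem kleinVolume_convexHull {x : Fin 4 → EuclideanSpace ℝ (Fin 3)} (hx : ∀ i, ‖x i‖ = 1)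
    (hD : (edgeMatrix x).det ≠ 0) :
    kleinVolume (convexHull ℝ (Set.range x)) = ENNReal.ofReal |(edgeMatrix x).det| *
      ∫⁻ c in octant, ENNReal.ofReal ((edgeForm x c ^ 2)⁻¹) := by
  have hai := (affineIndependent_iff_det_edgeMatrix_ne_zero x).2 hD
  have hinj : Function.Injective x := hai.injective
  have hmeas : MeasurableSet (convexHull ℝ (Set.range x)) :=
    ((Set.finite_range x).isCompact_convexHull ℝ).isClosed.measurableSet
  have hae : (convexHull ℝ (Set.range x) ∩ Metric.ball 0 1 : Set (EuclideanSpace ℝ (Fin 3)))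
      =ᵐ[volume] WithLp.toLp 2 '' (simplexMap x '' octant) := by
    refine Filter.EventuallyLE.antisymm ?_ ?_
    · rw [ae_le_set]
      refine measure_mono_null (Set.sdiff_subset_sdiff_left Set.inter_subset_left)
        (measure_mono_null (convexHull_diff_subset x) (measure_iUnion_null fun i => ?_))
      exact Measure.addHaar_affineSubspace volume _ fun htop =>
        hai.notMem_affineSpan_sdiff i Set.univ (htop ▸ AffineSubspace.mem_top ℝ _ _)
    · refine LE.le.eventuallyLE ?_
      rintro _ ⟨_, ⟨c, hc, rfl⟩, rfl⟩
      exact toLp_simplexMap_mem hx hinj hc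
  rw [kleinVolume, withDensity_apply _ hmeas, Measure.restrict_restrict hmeas,
    setLIntegral_congr hae, ← (PiLp.volume_preserving_toLp (Fin 3)).setLIntegral_comp_emb
      (MeasurableEquiv.toLp 2 (Fin 3 → ℝ)).measurableEmbedding,
    lintegral_image_eq_lintegral_abs_det_fderiv_mul volume measurableSet_octant
      (fun c hc => (hasFDerivAt_simplexMap x
        (one_add_pos_of_mem_octant hc).ne').hasFDerivWithinAt) (injOn_simplexMap hD),
    ← lintegral_const_mul' _ _ (by simp)]
  refine setLIntegral_congr_fun measurableSet_octant fun c hc => ?_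
  have hs := one_add_pos_of_mem_octant hc
  have h1 := one_sub_norm_sq_eq x hx hs.ne'
  change 1 - ‖WithLp.toLp 2 (simplexMap x c)‖ ^ 2 = _ at h1
  have hdet : (Matrix.toLin' ((edgeMatrix x).transpose * octantJacobian c)).toContinuousLinearMap.det
      = (edgeMatrix x).det * ((1 + (c 0 + c 1 + c 2)) ^ 4)⁻¹ := by
    rw [ContinuousLinearMap.det, LinearMap.coe_toContinuousLinearMap, LinearMap.det_toLin',
      Matrix.det_mul, Matrix.det_transpose, det_octantJacobian hs.ne']
  rw [h1, hdet, abs_mul, abs_of_pos (a := ((1 + (c 0 + c 1 + c 2)) ^ 4)⁻¹) (by positivity),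
    ENNReal.ofReal_mul (abs_nonneg _), mul_assoc, ← ENNReal.ofReal_mul (by positivity)]
  congr 2
  have := edgeForm_pos hinj hc
  field_simp

theorem lintegral_octant (f : ℝ → ℝ → ℝ → ENNReal)
    (hf : Measurable fun c : ℝ × ℝ × ℝ => f c.2.1 c.2.2 c.1) :
    ∫⁻ c in octant, f (c 0) (c 1) (c 2) =
      ∫⁻ x in Set.Ioi (0 : ℝ), ∫⁻ y in Set.Ioi (0 : ℝ), ∫⁻ z in Set.Ioi (0 : ℝ), f z y x := by
  have hoct : octant = Set.univ.pi fun _ : Fin 3 => Set.Ioi (0 : ℝ) := by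
    ext c
    simp [octant]
  set ν : Measure ℝ := volume.restrict (Set.Ioi 0) with hν
  rw [hoct, volume_pi, Measure.restrict_pi_pi]
  have h1 := measurePreserving_piFinSuccAbove (fun _ : Fin 3 => ν) 2
  have h2 := (measurePreserving_finTwoArrow ν)
  have e1 := h1.lintegral_comp_emb (MeasurableEquiv.measurableEmbedding _)
    (fun p : ℝ × (Fin 2 → ℝ) => f (p.2 0) (p.2 1) p.1)
  have hf' : Measurable fun p : ℝ × (Fin 2 → ℝ) => f (p.2 0) (p.2 1) p.1 :=
    hf.comp (by fun_prop : Measurable fun p : ℝ × (Fin 2 → ℝ) => (p.1, p.2 0, p.2 1))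
  refine Eq.trans (Eq.trans ?_ e1) ?_
  · rfl
  rw [lintegral_prod _ hf'.aemeasurable]
  refine lintegral_congr fun x => ?_
  have hfx : Measurable fun p : ℝ × ℝ => f p.1 p.2 x :=
    hf.comp (by fun_prop : Measurable fun p : ℝ × ℝ => (x, p.1, p.2))
  have e2 := h2.lintegral_comp_emb (MeasurableEquiv.measurableEmbedding _)
    (fun p : ℝ × ℝ => f p.1 p.2 x)
  refine Eq.trans e2 ?_
  rw [lintegral_prod_symm' _ hfx]

end

/-! ### Chord lengths and orientation through determinants in ℂ² -/

/-- The determinant of two vectors of `ℂ²`. -/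
def det₂ (u v : Fin 2 → ℂ) : ℂ := u 0 * v 1 - u 1 * v 0

theorem normSq_add_normSq_pos {v : Fin 2 → ℂ} (hv : v ≠ 0) :
    0 < Complex.normSq (v 0) + Complex.normSq (v 1) := by
  by_contra h
  have h0 := Complex.normSq_nonneg (v 0)
  have h1 := Complex.normSq_nonneg (v 1)
  have e0 : v 0 = 0 := Complex.normSq_eq_zero.1 (by linarith)
  have e1 : v 1 = 0 := Complex.normSq_eq_zero.1 (by linarith)
  refine hv (funext fun i => ?_)
  fin_cases i
  exacts [e0, e1]

theorem spherePoint_zero (v : Fin 2 → ℂ) : spherePoint v 0 =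
    2 * ((v 0).re * (v 1).re + (v 0).im * (v 1).im) /
      (Complex.normSq (v 0) + Complex.normSq (v 1)) := by
  simp [spherePoint]

theorem spherePoint_one (v : Fin 2 → ℂ) : spherePoint v 1 =
    2 * ((v 0).re * (v 1).im - (v 0).im * (v 1).re) /
      (Complex.normSq (v 0) + Complex.normSq (v 1)) := by
  simp [spherePoint]
  ring

theorem spherePoint_two (v : Fin 2 → ℂ) : spherePoint v 2 =
    (Complex.normSq (v 0) - Complex.normSq (v 1)) /
      (Complex.normSq (v 0) + Complex.normSq (v 1)) := by
  simp [spherePoint]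

theorem norm_spherePoint_sub_sq {u v : Fin 2 → ℂ} (hu : u ≠ 0) (hv : v ≠ 0) :
    ‖spherePoint u - spherePoint v‖ ^ 2 = 4 * Complex.normSq (det₂ u v) /
      ((Complex.normSq (u 0) + Complex.normSq (u 1)) *
        (Complex.normSq (v 0) + Complex.normSq (v 1))) := by
  have h1 := (normSq_add_normSq_pos hu).ne'
  have h2 := (normSq_add_normSq_pos hv).ne'
  rw [EuclideanSpace.real_norm_sq_eq, Fin.sum_univ_three]
  simp only [PiLp.sub_apply, spherePoint_zero, spherePoint_one, spherePoint_two]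
  obtain ⟨M, hM⟩ : ∃ M, M = Complex.normSq (u 0) + Complex.normSq (u 1) := ⟨_, rfl⟩
  obtain ⟨N, hN⟩ : ∃ N, N = Complex.normSq (v 0) + Complex.normSq (v 1) := ⟨_, rfl⟩
  rw [← hM] at h1
  rw [← hN] at h2
  rw [← hM, ← hN]
  field_simp
  rw [hM, hN]
  simp only [det₂, Complex.normSq_apply, Complex.sub_re, Complex.sub_im, Complex.mul_re,
    Complex.mul_im]
  ring

theorem norm_spherePoint {v : Fin 2 → ℂ} (hv : v ≠ 0) : ‖spherePoint v‖ = 1 := by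
  have h : ‖spherePoint v‖ ^ 2 = 1 := by
    have h1 := (normSq_add_normSq_pos hv).ne'
    rw [EuclideanSpace.real_norm_sq_eq, Fin.sum_univ_three, spherePoint_zero, spherePoint_one,
      spherePoint_two]
    obtain ⟨M, hM⟩ : ∃ M, M = Complex.normSq (v 0) + Complex.normSq (v 1) := ⟨_, rfl⟩
    rw [← hM] at h1
    rw [← hM]
    field_simp
    rw [hM]
    simp only [Complex.normSq_apply]
    ring
  have := norm_nonneg (spherePoint v)
  nlinarith

theorem det_edgeMatrix_spherePoint {w : Fin 4 → Fin 2 → ℂ} (hw : ∀ i, w i ≠ 0) :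
    (edgeMatrix fun i => spherePoint (w i)).det =
      8 * (det₂ (w 0) (w 1) * det₂ (w 2) (w 3) *
        starRingEnd ℂ (det₂ (w 0) (w 2) * det₂ (w 1) (w 3))).im /
        ∏ i, (Complex.normSq (w i 0) + Complex.normSq (w i 1)) := by
  -- The determinant of differences is a 4×4 determinant of homogeneous coordinates `(N, x, y, z)`
  -- expanded along its first column. Clearing the denominators here leaves a polynomial identity.
  have hom : ∀ {N₀ N₁ N₂ N₃ x₀ x₁ x₂ x₃ y₀ y₁ y₂ y₃ z₀ z₁ z₂ z₃ : ℝ}, N₀ ≠ 0 → N₁ ≠ 0 → N₂ ≠ 0 →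
      N₃ ≠ 0 → (!![x₁ / N₁ - x₀ / N₀, y₁ / N₁ - y₀ / N₀, z₁ / N₁ - z₀ / N₀;
        x₂ / N₂ - x₀ / N₀, y₂ / N₂ - y₀ / N₀, z₂ / N₂ - z₀ / N₀;
        x₃ / N₃ - x₀ / N₀, y₃ / N₃ - y₀ / N₀, z₃ / N₃ - z₀ / N₀] : Matrix (Fin 3) (Fin 3) ℝ).det =
      (N₀ * (x₁ * (y₂ * z₃ - y₃ * z₂) - y₁ * (x₂ * z₃ - x₃ * z₂) + z₁ * (x₂ * y₃ - x₃ * y₂)) -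
       N₁ * (x₀ * (y₂ * z₃ - y₃ * z₂) - y₀ * (x₂ * z₃ - x₃ * z₂) + z₀ * (x₂ * y₃ - x₃ * y₂)) +
       N₂ * (x₀ * (y₁ * z₃ - y₃ * z₁) - y₀ * (x₁ * z₃ - x₃ * z₁) + z₀ * (x₁ * y₃ - x₃ * y₁)) -
       N₃ * (x₀ * (y₁ * z₂ - y₂ * z₁) - y₀ * (x₁ * z₂ - x₂ * z₁) + z₀ * (x₁ * y₂ - x₂ * y₁))) /
      (N₀ * N₁ * N₂ * N₃) := by
    intro N₀ N₁ N₂ N₃ x₀ x₁ x₂ x₃ y₀ y₁ y₂ y₃ z₀ z₁ z₂ z₃ h0 h1 h2 h3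
    rw [Matrix.det_fin_three]
    simp only [Matrix.of_apply, Matrix.cons_val]
    field_simp
    ring
  have hmat : (edgeMatrix fun i => spherePoint (w i)) =
      !![spherePoint (w 1) 0 - spherePoint (w 0) 0, spherePoint (w 1) 1 - spherePoint (w 0) 1,
          spherePoint (w 1) 2 - spherePoint (w 0) 2;
        spherePoint (w 2) 0 - spherePoint (w 0) 0, spherePoint (w 2) 1 - spherePoint (w 0) 1,
          spherePoint (w 2) 2 - spherePoint (w 0) 2;
        spherePoint (w 3) 0 - spherePoint (w 0) 0, spherePoint (w 3) 1 - spherePoint (w 0) 1,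
          spherePoint (w 3) 2 - spherePoint (w 0) 2] := by
    ext i j
    fin_cases i <;> fin_cases j <;> rfl
  rw [hmat]
  simp only [spherePoint_zero, spherePoint_one, spherePoint_two]
  rw [hom (normSq_add_normSq_pos (hw 0)).ne' (normSq_add_normSq_pos (hw 1)).ne'
    (normSq_add_normSq_pos (hw 2)).ne' (normSq_add_normSq_pos (hw 3)).ne', Fin.prod_univ_four]
  congr 1
  simp only [det₂, Complex.normSq_apply, Complex.sub_re, Complex.sub_im, Complex.mul_re,
    Complex.mul_im, map_mul, map_sub, Complex.conj_re, Complex.conj_im]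
  ring

/-! ### Volume of an ideal simplex in terms of cross-ratios -/

section

open MeasureTheory

theorem boundaryPoint_mk {v : Fin 2 → ℂ} (hv : v ≠ 0) :
    boundaryPoint (Projectivization.mk ℂ v hv) = spherePoint v := rfl

/-- The product of two opposite determinants of four vectors of `ℂ²`. -/
def pairing₀₁ (w : Fin 4 → Fin 2 → ℂ) : ℂ := det₂ (w 0) (w 1) * det₂ (w 2) (w 3)

/-- The product of two opposite determinants of four vectors of `ℂ²`. -/
def pairing₀₂ (w : Fin 4 → Fin 2 → ℂ) : ℂ := det₂ (w 0) (w 2) * det₂ (w 1) (w 3)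

/-- The Plücker relation: the three products of opposite determinants are, up to sign, the sides of
a triangle in ℂ. The angles of this triangle are the dihedral angles. -/
theorem pairing_sub (w : Fin 4 → Fin 2 → ℂ) :
    pairing₀₂ w - pairing₀₁ w = det₂ (w 0) (w 3) * det₂ (w 1) (w 2) := by
  simp only [pairing₀₁, pairing₀₂, det₂]
  ring

theorem orientationDet_mk {w : Fin 4 → Fin 2 → ℂ} (hw : ∀ i, w i ≠ 0) :
    orientationDet (fun i => Projectivization.mk ℂ (w i) (hw i)) =
      8 * (pairing₀₁ w * starRingEnd ℂ (pairing₀₂ w)).im /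
        ∏ i, (Complex.normSq (w i 0) + Complex.normSq (w i 1)) :=
  det_edgeMatrix_spherePoint hw

theorem prod_normSq_pos {w : Fin 4 → Fin 2 → ℂ} (hw : ∀ i, w i ≠ 0) :
    0 < ∏ i, (Complex.normSq (w i 0) + Complex.normSq (w i 1)) :=
  Finset.prod_pos fun i _ => normSq_add_normSq_pos (hw i)

theorem simplexVolume_of_im_eq_zero {w : Fin 4 → Fin 2 → ℂ} (hw : ∀ i, w i ≠ 0)
    (h : (pairing₀₁ w * starRingEnd ℂ (pairing₀₂ w)).im = 0) :
    simplexVolume (fun i => Projectivization.mk ℂ (w i) (hw i)) = 0 := by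
  have hd : (edgeMatrix fun i => spherePoint (w i)).det = 0 := by
    rw [det_edgeMatrix_spherePoint hw]
    change 8 * (pairing₀₁ w * starRingEnd ℂ (pairing₀₂ w)).im / _ = 0
    rw [h]; simp
  have := kleinVolume_convexHull_of_det_eq_zero _ hd
  simp only [simplexVolume, boundaryPoint_mk, Measure.real]
  rw [this]
  rfl

/-- Solves a triangle with sides `a` and `b` enclosing γ and with β opposite to `b`. It is applied
with `re` and `im` the parts of `pairing₀₁ w` times the conjugate of `pairing₀₂ w`, so γ is the
angle between the two numbers. -/
theorem exists_triangle_angles {a b re im : ℝ} (ha : 0 < a) (hb : 0 < b) (him : im ≠ 0)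
    (h : re ^ 2 + im ^ 2 = (a * b) ^ 2) : ∃ β γ : ℝ, 0 < β ∧ 0 < γ ∧ β + γ < Real.pi ∧
      a * Real.sin β = b * Real.sin (β + γ) ∧ re = a * b * Real.cos γ ∧
      |im| = a * b * Real.sin γ := by
  obtain ⟨r, γ, hr, hγ0, hγ, hc, hs⟩ := exists_polar (u := re) (abs_pos.2 him)
  have hr' : r = a * b := by
    have : r ^ 2 = (a * b) ^ 2 := by
      rw [← h, ← sq_abs im, ← hc, ← hs]
      linear_combination -r ^ 2 * Real.sin_sq_add_cos_sq γ
    exact (pow_left_inj₀ hr.le (by positivity) two_ne_zero).1 this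
  have hsγ : 0 < Real.sin γ := Real.sin_pos_of_pos_of_lt_pi hγ0 hγ
  -- The third side is `a - b exp(-iγ) = q exp(iβ)`.
  obtain ⟨q, β, hq, hβ0, hβ, hc', hs'⟩ := exists_polar (u := a - b * Real.cos γ)
    (mul_pos hb hsγ)
  have hsβ : 0 < Real.sin β := Real.sin_pos_of_pos_of_lt_pi hβ0 hβ
  have hsin : a * Real.sin β = b * Real.sin (β + γ) := by
    refine mul_left_cancel₀ hq.ne' ?_
    rw [Real.sin_add]
    linear_combination (a - b * Real.cos γ) * hs' - b * Real.sin γ * hc'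
  refine ⟨β, γ, hβ0, hγ0, ?_, hsin, by rw [← hc, hr'], by rw [← hs, hr']⟩
  by_contra hle
  have h1 : 0 < Real.sin (β + γ) := pos_of_mul_pos_right (hsin ▸ mul_pos ha hsβ) hb.le
  have h2 := Real.sin_nonneg_of_nonneg_of_le_pi (x := β + γ - Real.pi) (by linarith) (by linarith)
  rw [Real.sin_sub_pi] at h2
  linarith

/-- By the chord formula the products of opposite squared edges are `16 / M` times the squared
moduli of the three pairings. The edge lengths thus satisfy the triangle relations needed by
`lintegral_inv_sq_bilinear`. -/
theorem simplexVolume_eq_angleVolume {w : Fin 4 → Fin 2 → ℂ} (hw : ∀ i, w i ≠ 0)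
    (him : (pairing₀₁ w * starRingEnd ℂ (pairing₀₂ w)).im ≠ 0) :
    ∃ β γ : ℝ, 0 < β ∧ 0 < γ ∧ β + γ < Real.pi ∧
      ‖pairing₀₁ w‖ * Real.sin β = ‖pairing₀₂ w‖ * Real.sin (β + γ) ∧
      (pairing₀₁ w * starRingEnd ℂ (pairing₀₂ w)).re =
        ‖pairing₀₁ w‖ * ‖pairing₀₂ w‖ * Real.cos γ ∧
      simplexVolume (fun i => Projectivization.mk ℂ (w i) (hw i)) = angleVolume β γ := by
  have hA : pairing₀₁ w ≠ 0 := fun h => him (by simp [h])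
  have hB : pairing₀₂ w ≠ 0 := fun h => him (by simp [h])
  have hsq : (pairing₀₁ w * starRingEnd ℂ (pairing₀₂ w)).re ^ 2 +
      (pairing₀₁ w * starRingEnd ℂ (pairing₀₂ w)).im ^ 2 =
        (‖pairing₀₁ w‖ * ‖pairing₀₂ w‖) ^ 2 := by
    rw [mul_pow, Complex.sq_norm, Complex.sq_norm, ← Complex.normSq_conj (pairing₀₂ w),
      ← Complex.normSq_mul, Complex.normSq_apply]
    ring
  obtain ⟨β, γ, hβ, hγ, hlt, hsin, hcos, habs⟩ :=
    exists_triangle_angles (norm_pos_iff.2 hA) (norm_pos_iff.2 hB) him hsq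
  refine ⟨β, γ, hβ, hγ, hlt, hsin, hcos, ?_⟩
  set x : Fin 4 → EuclideanSpace ℝ (Fin 3) := fun i => spherePoint (w i) with hx
  have hM := prod_normSq_pos hw
  set M := ∏ i, (Complex.normSq (w i 0) + Complex.normSq (w i 1)) with hMdef
  have hdet : (edgeMatrix x).det = 8 * (pairing₀₁ w * starRingEnd ℂ (pairing₀₂ w)).im / M :=
    det_edgeMatrix_spherePoint hw
  have hdet0 : (edgeMatrix x).det ≠ 0 := by
    rw [hdet]; exact div_ne_zero (mul_ne_zero (by norm_num) him) hM.ne'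
  have hinj : Function.Injective x :=
    ((affineIndependent_iff_det_edgeMatrix_ne_zero x).2 hdet0).injective
  have hn : ∀ i j : Fin 4, i ≠ j → 0 < ‖x i - x j‖ ^ 2 := fun i j hij =>
    pow_pos (norm_pos_iff.2 (sub_ne_zero.2 (hinj.ne hij))) 2
  have hnp : ∀ i, 0 < Complex.normSq (w i 0) + Complex.normSq (w i 1) :=
    fun i => normSq_add_normSq_pos (hw i)
  have hsw : ∀ u v, Complex.normSq (det₂ u v) = Complex.normSq (det₂ v u) := fun u v => by
    rw [← Complex.normSq_neg]; congr 1; simp only [det₂]; ring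
  have e1 : ‖x 1 - x 0‖ ^ 2 * ‖x 3 - x 2‖ ^ 2 = 16 * ‖pairing₀₁ w‖ ^ 2 / M := by
    rw [hMdef, Fin.prod_univ_four, Complex.sq_norm, pairing₀₁, Complex.normSq_mul,
      norm_spherePoint_sub_sq (hw _) (hw _), norm_spherePoint_sub_sq (hw _) (hw _), hsw (w 1),
      hsw (w 3)]
    have h0 := (hnp 0).ne'; have h1 := (hnp 1).ne'; have h2 := (hnp 2).ne'; have h3 := (hnp 3).ne'
    generalize Complex.normSq (w 0 0) + Complex.normSq (w 0 1) = N₀ at *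
    generalize Complex.normSq (w 1 0) + Complex.normSq (w 1 1) = N₁ at *
    generalize Complex.normSq (w 2 0) + Complex.normSq (w 2 1) = N₂ at *
    generalize Complex.normSq (w 3 0) + Complex.normSq (w 3 1) = N₃ at *
    field_simp
    ring
  have e2 : ‖x 2 - x 0‖ ^ 2 * ‖x 3 - x 1‖ ^ 2 = 16 * ‖pairing₀₂ w‖ ^ 2 / M := by
    rw [hMdef, Fin.prod_univ_four, Complex.sq_norm, pairing₀₂, Complex.normSq_mul,
      norm_spherePoint_sub_sq (hw _) (hw _), norm_spherePoint_sub_sq (hw _) (hw _), hsw (w 2),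
      hsw (w 3)]
    have h0 := (hnp 0).ne'; have h1 := (hnp 1).ne'; have h2 := (hnp 2).ne'; have h3 := (hnp 3).ne'
    generalize Complex.normSq (w 0 0) + Complex.normSq (w 0 1) = N₀ at *
    generalize Complex.normSq (w 1 0) + Complex.normSq (w 1 1) = N₁ at *
    generalize Complex.normSq (w 2 0) + Complex.normSq (w 2 1) = N₂ at *
    generalize Complex.normSq (w 3 0) + Complex.normSq (w 3 1) = N₃ at *
    field_simp
    ring
  have e3 : ‖x 3 - x 0‖ ^ 2 * ‖x 2 - x 1‖ ^ 2 =
      16 * Complex.normSq (pairing₀₂ w - pairing₀₁ w) / M := by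
    rw [hMdef, Fin.prod_univ_four, pairing_sub, Complex.normSq_mul,
      norm_spherePoint_sub_sq (hw _) (hw _), norm_spherePoint_sub_sq (hw _) (hw _), hsw (w 2),
      hsw (w 3)]
    have h0 := (hnp 0).ne'; have h1 := (hnp 1).ne'; have h2 := (hnp 2).ne'; have h3 := (hnp 3).ne'
    generalize Complex.normSq (w 0 0) + Complex.normSq (w 0 1) = N₀ at *
    generalize Complex.normSq (w 1 0) + Complex.normSq (w 1 1) = N₁ at *
    generalize Complex.normSq (w 2 0) + Complex.normSq (w 2 1) = N₂ at *
    generalize Complex.normSq (w 3 0) + Complex.normSq (w 3 1) = N₃ at *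
    field_simp
    ring
  have hAp := norm_pos_iff.2 hA
  have hBp := norm_pos_iff.2 hB
  have hsγ : 0 < Real.sin γ := Real.sin_pos_of_pos_of_lt_pi hγ (by linarith)
  have h_int := lintegral_inv_sq_bilinear (s := 16 * (‖pairing₀₁ w‖ * ‖pairing₀₂ w‖) / M)
    (hn 1 0 (by decide)) (hn 2 0 (by decide)) (hn 3 0 (by decide)) (hn 2 1 (by decide))
    (hn 3 1 (by decide)) (hn 3 2 (by decide)) (by positivity)
    (by rw [e1, e2]; field_simp) hβ hγ hlt
    (by rw [e2]
        linear_combination (16 * ‖pairing₀₂ w‖ / M) * hsin)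
    (by rw [e1, e2, e3]
        have : Complex.normSq (pairing₀₂ w - pairing₀₁ w) = ‖pairing₀₁ w‖ ^ 2 +
            ‖pairing₀₂ w‖ ^ 2 - 2 * (‖pairing₀₁ w‖ * ‖pairing₀₂ w‖ * Real.cos γ) := by
          rw [← hcos, Complex.sq_norm, Complex.sq_norm]
          simp only [Complex.normSq_apply, Complex.sub_re, Complex.sub_im, Complex.mul_re,
            Complex.conj_re, Complex.conj_im]
          ring
        rw [this]
        ring)
  have hoct := lintegral_octant (fun z y t => ENNReal.ofReal (((‖x 1 - x 0‖ ^ 2 * z +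
    ‖x 2 - x 0‖ ^ 2 * y + ‖x 3 - x 0‖ ^ 2 * t + ‖x 2 - x 1‖ ^ 2 * z * y +
    ‖x 3 - x 1‖ ^ 2 * z * t + ‖x 3 - x 2‖ ^ 2 * y * t) ^ 2)⁻¹)) (by fun_prop)
  have hvol := kleinVolume_convexHull (fun i => norm_spherePoint (hw i)) hdet0
  simp only [edgeForm] at hvol
  rw [hoct, h_int, ← ENNReal.ofReal_mul (abs_nonneg _)] at hvol
  -- The factor 8 of the determinant, the factor 2 of the integral and the factor 16 in `s` cancel,
  -- as do `M`, the norms and `sin γ`.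
  have hval : |(edgeMatrix x).det| * (2 * angleVolume β γ /
      (16 * (‖pairing₀₁ w‖ * ‖pairing₀₂ w‖) / M * Real.sin γ)) = angleVolume β γ := by
    rw [hdet, abs_div, abs_mul, habs, abs_of_pos hM, abs_of_pos (by norm_num : (0 : ℝ) < 8)]
    field_simp
    ring
  rw [hval] at hvol
  simp only [simplexVolume, boundaryPoint_mk, Measure.real]
  rw [hvol, ENNReal.toReal_ofReal (angleVolume_pos hβ hγ hlt).le]

/-! ### The cross-ratio of a simplex of maximal volume -/

/-- The cross ratio `exp (π i / 3)` of a positively oriented regular ideal simplex. -/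
noncomputable def regularRatio : ℂ := ⟨1 / 2, √3 / 2⟩

theorem regularRatio_ne_zero : regularRatio ≠ 0 := fun h => by
  have := congrArg Complex.re h
  simp [regularRatio] at this

theorem conj_regularRatio : starRingEnd ℂ regularRatio = 1 - regularRatio := by
  apply Complex.ext
  · simp [regularRatio]; norm_num
  · simp [regularRatio]

theorem regularRatio_sq : regularRatio * regularRatio = regularRatio - 1 := by
  have h3 : √3 * √3 = 3 := Real.mul_self_sqrt (by norm_num)
  apply Complex.ext <;> simp [regularRatio]
  · linear_combination (-1 / 4) * h3
  · ring

theorem norm_regularRatio : ‖regularRatio‖ = 1 := by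
  have h3 : √3 * √3 = 3 := Real.mul_self_sqrt (by norm_num)
  have : ‖regularRatio‖ ^ 2 = 1 := by
    rw [Complex.sq_norm, Complex.normSq_apply]
    simp only [regularRatio]
    linear_combination (1 / 4) * h3
  have h0 := norm_nonneg regularRatio
  nlinarith

theorem simplexVolume_le_mk {w : Fin 4 → Fin 2 → ℂ} (hw : ∀ i, w i ≠ 0) :
    simplexVolume (fun i => Projectivization.mk ℂ (w i) (hw i)) ≤
      angleVolume (Real.pi / 3) (Real.pi / 3) := by
  by_cases him : (pairing₀₁ w * starRingEnd ℂ (pairing₀₂ w)).im = 0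
  · rw [simplexVolume_of_im_eq_zero hw him]
    exact angleVolume_pi_div_three_pos.le
  · obtain ⟨β, γ, hβ, hγ, h, -, -, hv⟩ := simplexVolume_eq_angleVolume hw him
    rw [hv]
    exact angleVolume_le hβ.le hγ.le h.le

theorem exists_eq_mk (ξ : Fin 4 → CP1) : ∃ (w : Fin 4 → Fin 2 → ℂ) (hw : ∀ i, w i ≠ 0),
    ξ = fun i => Projectivization.mk ℂ (w i) (hw i) :=
  ⟨fun i => (ξ i).rep, fun i => (ξ i).rep_nonzero, funext fun i => ((ξ i).mk_rep).symm⟩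

theorem simplexVolume_le (ξ : Fin 4 → CP1) :
    simplexVolume ξ ≤ angleVolume (Real.pi / 3) (Real.pi / 3) := by
  obtain ⟨w, hw, rfl⟩ := exists_eq_mk ξ
  exact simplexVolume_le_mk hw

/-- `A` times the conjugate of `B` has modulus `‖B‖²` and half of that as real part; the orientation
selects exp(πi/3) over its conjugate. -/
theorem eq_regularRatio_mul_of_norm_eq {A B : ℂ} (hB : B ≠ 0) (hn : ‖A‖ = ‖B‖)
    (hre : (A * starRingEnd ℂ B).re = 1 / 2 * ‖B‖ ^ 2) (him : 0 < (A * starRingEnd ℂ B).im) :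
    A = regularRatio * B := by
  have h3 : √3 * √3 = 3 := Real.mul_self_sqrt (by norm_num)
  have h4 : A * starRingEnd ℂ B = regularRatio * (‖B‖ ^ 2 : ℝ) := by
    apply Complex.ext
    · rw [hre, Complex.re_mul_ofReal]; rfl
    · rw [Complex.im_mul_ofReal]
      have hsq : (A * starRingEnd ℂ B).re ^ 2 + (A * starRingEnd ℂ B).im ^ 2 =
          (‖B‖ ^ 2) ^ 2 := by
        have := Complex.sq_norm (A * starRingEnd ℂ B)
        rw [norm_mul, RCLike.norm_conj, hn, Complex.normSq_apply] at this
        linear_combination -this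
      rw [hre] at hsq
      refine (pow_left_inj₀ him.le (by simp only [regularRatio]; positivity) two_ne_zero).1 ?_
      simp only [regularRatio]
      linear_combination hsq - (‖B‖ ^ 2) ^ 2 / 4 * h3
  have hB' : starRingEnd ℂ B ≠ 0 := by simpa using hB
  refine mul_right_cancel₀ hB' ?_
  rw [h4, mul_assoc, Complex.mul_conj, Complex.sq_norm]

theorem im_regularRatio_mul {B : ℂ} (hB : B ≠ 0) :
    0 < (regularRatio * B * starRingEnd ℂ B).im := by
  rw [mul_assoc, Complex.mul_conj, Complex.im_mul_ofReal]
  have : 0 < Complex.normSq B := Complex.normSq_pos.2 hB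
  simp only [regularRatio]
  positivity

theorem simplexVolume_of_regularRatio {w : Fin 4 → Fin 2 → ℂ} (hw : ∀ i, w i ≠ 0)
    (hB : pairing₀₂ w ≠ 0) (hA : pairing₀₁ w = regularRatio * pairing₀₂ w) :
    simplexVolume (fun i => Projectivization.mk ℂ (w i) (hw i)) =
      angleVolume (Real.pi / 3) (Real.pi / 3) := by
  have him := im_regularRatio_mul hB
  rw [← hA] at him
  obtain ⟨β, γ, hβ, hγ, h, hsin, hcos, hv⟩ := simplexVolume_eq_angleVolume hw him.ne'
  have hn : ‖pairing₀₁ w‖ = ‖pairing₀₂ w‖ := by rw [hA, norm_mul, norm_regularRatio, one_mul]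
  have hBp := norm_pos_iff.2 hB
  have hcγ : Real.cos γ = Real.cos (Real.pi / 3) := by
    rw [Real.cos_pi_div_three]
    have h1 : (pairing₀₁ w * starRingEnd ℂ (pairing₀₂ w)).re = 1 / 2 * ‖pairing₀₂ w‖ ^ 2 := by
      rw [hA, mul_assoc, Complex.mul_conj, Complex.re_mul_ofReal, Complex.sq_norm]
      rfl
    rw [h1, hn] at hcos
    have : ‖pairing₀₂ w‖ ^ 2 ≠ 0 := by positivity
    refine mul_left_cancel₀ this ?_
    linarith
  have hγ' : γ = Real.pi / 3 := Real.injOn_cos ⟨hγ.le, by linarith⟩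
    ⟨by linarith [Real.pi_pos], by linarith [Real.pi_pos]⟩ hcγ
  rw [hn] at hsin
  have hsin' := mul_left_cancel₀ hBp.ne' hsin
  have hc : Real.cos (β + γ / 2) = 0 := by
    have h1 : Real.sin (β + γ) - Real.sin β = 2 * Real.sin (γ / 2) * Real.cos (β + γ / 2) := by
      rw [Real.sin_sub_sin]; congr 2 <;> ring_nf
    have h2 : 0 < Real.sin (γ / 2) := Real.sin_pos_of_pos_of_lt_pi (by linarith) (by linarith)
    rw [← hsin', sub_self] at h1
    rcases mul_eq_zero.1 h1.symm with h | h
    · linarith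
    · exact h
  have hβ' : β + γ / 2 = Real.pi / 2 := Real.injOn_cos ⟨by linarith, by linarith⟩
    ⟨by linarith [Real.pi_pos], by linarith [Real.pi_pos]⟩ (hc.trans Real.cos_pi_div_two.symm)
  rw [hv, hγ', show β = Real.pi / 3 by linarith]

theorem eq_regularRatio_mul_of_simplexVolume {w : Fin 4 → Fin 2 → ℂ} (hw : ∀ i, w i ≠ 0)
    (him : 0 < (pairing₀₁ w * starRingEnd ℂ (pairing₀₂ w)).im)
    (h : simplexVolume (fun i => Projectivization.mk ℂ (w i) (hw i)) =
      angleVolume (Real.pi / 3) (Real.pi / 3)) :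
    pairing₀₁ w = regularRatio * pairing₀₂ w := by
  have hB : pairing₀₂ w ≠ 0 := fun h => by simp [h] at him
  obtain ⟨β, γ, hβ, hγ, hlt, hsin, hcos, hv⟩ := simplexVolume_eq_angleVolume hw him.ne'
  rw [hv, angleVolume_eq_iff hβ.le hγ.le hlt.le] at h
  obtain ⟨rfl, rfl⟩ := h
  have hs : Real.sin (Real.pi / 3 + Real.pi / 3) = Real.sin (Real.pi / 3) := by
    rw [← Real.sin_pi_sub]; congr 1; ring
  have hs0 : Real.sin (Real.pi / 3) ≠ 0 :=
    (Real.sin_pos_of_pos_of_lt_pi hβ (by linarith [Real.pi_pos])).ne'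
  rw [hs] at hsin
  have hn := mul_right_cancel₀ hs0 hsin
  refine eq_regularRatio_mul_of_norm_eq hB hn ?_ him
  rw [hcos, hn, Real.cos_pi_div_three]
  ring

/-- The vertices `∞, 0, 1, exp (π i / 3)` of a regular ideal simplex. -/
noncomputable def regularVec : Fin 4 → Fin 2 → ℂ :=
  ![![1, 0], ![0, 1], ![1, 1], ![regularRatio, 1]]

theorem regularVec_ne_zero (i : Fin 4) : regularVec i ≠ 0 := by
  intro h
  have h0 := congrFun h 0
  have h1 := congrFun h 1
  fin_cases i <;> simp [regularVec] at h0 h1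

theorem pairing₀₂_regularVec : pairing₀₂ regularVec = -regularRatio := by
  simp [pairing₀₂, det₂, regularVec]

theorem pairing₀₁_regularVec : pairing₀₁ regularVec = regularRatio * pairing₀₂ regularVec := by
  rw [pairing₀₂_regularVec]
  simp [pairing₀₁, det₂, regularVec]
  linear_combination regularRatio_sq

/-- The regular ideal simplex with vertices `∞, 0, 1, exp (π i / 3)`. -/
noncomputable def regularSimplex : Fin 4 → CP1 := fun i =>
  Projectivization.mk ℂ (regularVec i) (regularVec_ne_zero i)

theorem maxSimplexVolume_eq : maxSimplexVolume = angleVolume (Real.pi / 3) (Real.pi / 3) := by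
  have hbdd : BddAbove (Set.range simplexVolume) := ⟨_, Set.forall_mem_range.2 simplexVolume_le⟩
  refine le_antisymm (ciSup_le simplexVolume_le) ?_
  refine le_trans (le_of_eq ?_) (le_ciSup hbdd regularSimplex)
  refine (simplexVolume_of_regularRatio regularVec_ne_zero ?_ pairing₀₁_regularVec).symm
  rw [pairing₀₂_regularVec]
  exact neg_ne_zero.2 regularRatio_ne_zero

theorem maxSimplexVolume_pos : 0 < maxSimplexVolume := by
  rw [maxSimplexVolume_eq]
  exact angleVolume_pi_div_three_pos

theorem positivelyOriented_mk_iff {w : Fin 4 → Fin 2 → ℂ} (hw : ∀ i, w i ≠ 0) :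
    PositivelyOriented (fun i => Projectivization.mk ℂ (w i) (hw i)) ↔
      0 < (pairing₀₁ w * starRingEnd ℂ (pairing₀₂ w)).im := by
  rw [PositivelyOriented, orientationDet_mk, div_pos_iff_of_pos_right (prod_normSq_pos hw)]
  exact mul_pos_iff_of_pos_left (by norm_num)

theorem signedVolume_le (ξ : Fin 4 → CP1) : signedVolume ξ ≤ maxSimplexVolume := by
  rw [maxSimplexVolume_eq]
  have h0 : 0 ≤ simplexVolume ξ := ENNReal.toReal_nonneg
  have h1 : Real.sign (orientationDet ξ) ≤ 1 := by
    rcases Real.sign_apply_eq (orientationDet ξ) with h | h | h <;> rw [h] <;> norm_num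
  calc signedVolume ξ ≤ 1 * simplexVolume ξ := mul_le_mul_of_nonneg_right h1 h0
    _ ≤ _ := by rw [one_mul]; exact simplexVolume_le ξ

theorem im_ne_zero_of_signedVolume_ne_zero {w : Fin 4 → Fin 2 → ℂ} (hw : ∀ i, w i ≠ 0)
    (h : signedVolume (fun i => Projectivization.mk ℂ (w i) (hw i)) ≠ 0) :
    (pairing₀₁ w * starRingEnd ℂ (pairing₀₂ w)).im ≠ 0 := fun h0 =>
  h (by rw [signedVolume, simplexVolume_of_im_eq_zero hw h0, mul_zero])

theorem signedVolume_eq_maxSimplexVolume_iff {w : Fin 4 → Fin 2 → ℂ} (hw : ∀ i, w i ≠ 0) :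
    signedVolume (fun i => Projectivization.mk ℂ (w i) (hw i)) = maxSimplexVolume ↔
      pairing₀₂ w ≠ 0 ∧ pairing₀₁ w = regularRatio * pairing₀₂ w := by
  constructor
  · intro h
    have him := im_ne_zero_of_signedVolume_ne_zero hw (h ▸ maxSimplexVolume_pos.ne')
    have h0 : 0 ≤ simplexVolume (fun i => Projectivization.mk ℂ (w i) (hw i)) :=
      ENNReal.toReal_nonneg
    have hpos : 0 < (pairing₀₁ w * starRingEnd ℂ (pairing₀₂ w)).im := by
      rw [← positivelyOriented_mk_iff hw, PositivelyOriented]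
      by_contra hneg
      have hs : Real.sign (orientationDet fun i => Projectivization.mk ℂ (w i) (hw i)) ≤ 0 := by
        rcases (not_lt.1 hneg).lt_or_eq with h | h
        · rw [Real.sign_of_neg h]; norm_num
        · rw [h, Real.sign_zero]
      have := mul_nonpos_of_nonpos_of_nonneg hs h0
      have h2 := maxSimplexVolume_pos
      rw [← h, signedVolume] at h2
      linarith
    refine ⟨fun h => him (by simp [h]), eq_regularRatio_mul_of_simplexVolume hw hpos ?_⟩
    have ho := (positivelyOriented_mk_iff hw).2 hpos
    rw [signedVolume, Real.sign_of_pos ho, one_mul] at h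
    rw [h, maxSimplexVolume_eq]
  · rintro ⟨hB, hA⟩
    have ho := (positivelyOriented_mk_iff hw).2 (hA ▸ im_regularRatio_mul hB)
    rw [signedVolume, Real.sign_of_pos ho, one_mul, simplexVolume_of_regularRatio hw hB hA,
      maxSimplexVolume_eq]

end

/-! ### Regular simplices and their isometries -/

theorem norm_det₂_linear (f : (Fin 2 → ℂ) ≃ₗ[ℂ] (Fin 2 → ℂ)) (u v : Fin 2 → ℂ) :
    ‖det₂ (f u) (f v)‖ = ‖det₂ (f (Pi.single 0 1)) (f (Pi.single 1 1))‖ * ‖det₂ u v‖ := by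
  have h : ∀ u : Fin 2 → ℂ, f u = u 0 • f (Pi.single 0 1) + u 1 • f (Pi.single 1 1) := by
    intro u
    rw [← map_smul, ← map_smul, ← map_add]
    congr 1
    ext i
    fin_cases i <;> simp
  rw [← norm_mul, h u, h v]
  congr 1
  simp only [det₂, Pi.add_apply, Pi.smul_apply, smul_eq_mul]
  ring

theorem norm_det₂_conjLinear (f : (Fin 2 → ℂ) ≃ₛₗ[starRingEnd ℂ] (Fin 2 → ℂ)) (u v : Fin 2 → ℂ) :
    ‖det₂ (f u) (f v)‖ = ‖det₂ (f (Pi.single 0 1)) (f (Pi.single 1 1))‖ * ‖det₂ u v‖ := by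
  have h : ∀ u : Fin 2 → ℂ, f u = starRingEnd ℂ (u 0) • f (Pi.single 0 1) +
      starRingEnd ℂ (u 1) • f (Pi.single 1 1) := by
    intro u
    rw [← LinearEquiv.map_smulₛₗ, ← LinearEquiv.map_smulₛₗ, ← map_add]
    congr 1
    ext i
    fin_cases i <;> simp
  rw [← RCLike.norm_conj (det₂ u v), ← norm_mul, h u, h v]
  congr 1
  simp only [det₂, Pi.add_apply, Pi.smul_apply, smul_eq_mul, map_sub, map_mul]
  ring

/-- Linear and conjugate-linear maps multiply all moduli of determinants by one constant `k`; the
numbers `c i` compensate for the choice of representatives of the vertices. -/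
theorem IsRegularSimplex.exists_norm_det₂ {w : Fin 4 → Fin 2 → ℂ} {hw : ∀ i, w i ≠ 0}
    (h : IsRegularSimplex fun i => Projectivization.mk ℂ (w i) (hw i)) (s : Equiv.Perm (Fin 4)) :
    ∃ (c : Fin 4 → ℝ) (k : ℝ), (∀ i, 0 < c i) ∧ 0 ≤ k ∧
      ∀ i j, c i * c j * ‖det₂ (w (s i)) (w (s j))‖ = k * ‖det₂ (w i) (w j)‖ := by
  have key : ∀ f : (Fin 2 → ℂ) → (Fin 2 → ℂ), (∀ i, ∃ a : ℂˣ, a • w (s i) = f (w i)) →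
      (∀ u v, ‖det₂ (f u) (f v)‖ = ‖det₂ (f (Pi.single 0 1)) (f (Pi.single 1 1))‖ * ‖det₂ u v‖) →
      ∃ (c : Fin 4 → ℝ) (k : ℝ), (∀ i, 0 < c i) ∧ 0 ≤ k ∧
        ∀ i j, c i * c j * ‖det₂ (w (s i)) (w (s j))‖ = k * ‖det₂ (w i) (w j)‖ := by
    intro f hf hd
    choose a ha using hf
    refine ⟨fun i => ‖(a i : ℂ)‖, _, fun i => norm_pos_iff.2 (a i).ne_zero, norm_nonneg _,
      fun i j => (?_ : _ = _).trans (hd (w i) (w j))⟩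
    rw [← ha i, ← ha j, ← norm_mul, ← norm_mul]
    congr 1
    simp only [det₂, Units.smul_def, Pi.smul_apply, smul_eq_mul]
    ring
  rcases h.2 s with ⟨f, hf⟩ | ⟨f, hf⟩
  · refine key f (fun i => ?_) (norm_det₂_linear f)
    have := hf i
    rw [Projectivization.map_mk, Projectivization.mk_eq_mk_iff] at this
    exact this
  · refine key f (fun i => ?_) (norm_det₂_conjLinear f)
    have := hf i
    rw [Projectivization.map_mk, Projectivization.mk_eq_mk_iff] at this
    exact this

theorem norm_det₂_comm (u v : Fin 2 → ℂ) : ‖det₂ u v‖ = ‖det₂ v u‖ := by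
  rw [← norm_neg]; congr 1; simp only [det₂]; ring

theorem eq_of_mul_eq_mul_swap {a b p q : ℝ} (ha : 0 ≤ a) (hb : 0 ≤ b) (hp : 0 < p)
    (h1 : p * b = q * a) (h2 : p * a = q * b) : a = b := by
  have : p * (a ^ 2 - b ^ 2) = 0 := by linear_combination a * h2 - b * h1
  have h3 := (mul_eq_zero.1 this).resolve_left hp.ne'
  exact (pow_left_inj₀ ha hb two_ne_zero).1 (by linarith)

/-- Exchanging vertices 1 and 2 interchanges the moduli of `pairing₀₁` and `pairing₀₂`, and
exchanging 0 and 1 interchanges those of `pairing₀₂` and of the difference, up to a common factor.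
All three sides of the Plücker triangle are therefore equal in length. -/
theorem IsRegularSimplex.pairing_eq {w : Fin 4 → Fin 2 → ℂ} {hw : ∀ i, w i ≠ 0}
    (h : IsRegularSimplex fun i => Projectivization.mk ℂ (w i) (hw i))
    (ho : PositivelyOriented fun i => Projectivization.mk ℂ (w i) (hw i)) :
    pairing₀₂ w ≠ 0 ∧ pairing₀₁ w = regularRatio * pairing₀₂ w := by
  have him := (positivelyOriented_mk_iff hw).1 ho
  have hB : pairing₀₂ w ≠ 0 := fun h => by simp [h] at him
  have h1 : ‖pairing₀₁ w‖ = ‖pairing₀₂ w‖ := by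
    obtain ⟨c, k, hc, hk, hd⟩ := h.exists_norm_det₂ (Equiv.swap 1 2)
    have d01 := hd 0 1; have d23 := hd 2 3; have d02 := hd 0 2; have d13 := hd 1 3
    rw [Equiv.swap_apply_left] at d01 d13
    rw [Equiv.swap_apply_right] at d02 d23
    rw [Equiv.swap_apply_of_ne_of_ne (by decide) (by decide)] at d01 d23 d02 d13
    refine eq_of_mul_eq_mul_swap (p := c 0 * c 1 * c 2 * c 3) (q := k ^ 2) (norm_nonneg _)
      (norm_nonneg _) (mul_pos (mul_pos (mul_pos (hc 0) (hc 1)) (hc 2)) (hc 3)) ?_ ?_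
    · rw [pairing₀₁, pairing₀₂, norm_mul, norm_mul]
      linear_combination (c 2 * c 3 * ‖det₂ (w 1) (w 3)‖) * d01 + k * ‖det₂ (w 0) (w 1)‖ * d23
    · rw [pairing₀₁, pairing₀₂, norm_mul, norm_mul]
      linear_combination (c 1 * c 3 * ‖det₂ (w 2) (w 3)‖) * d02 + k * ‖det₂ (w 0) (w 2)‖ * d13
  have h2 : ‖pairing₀₂ w‖ = ‖pairing₀₂ w - pairing₀₁ w‖ := by
    rw [pairing_sub]
    obtain ⟨c, k, hc, hk, hd⟩ := h.exists_norm_det₂ (Equiv.swap 0 1)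
    have d03 := hd 0 3; have d12 := hd 1 2; have d02 := hd 0 2; have d13 := hd 1 3
    rw [Equiv.swap_apply_left] at d03 d02
    rw [Equiv.swap_apply_right] at d12 d13
    rw [Equiv.swap_apply_of_ne_of_ne (by decide) (by decide)] at d03 d12 d02 d13
    refine eq_of_mul_eq_mul_swap (p := c 0 * c 1 * c 2 * c 3) (q := k ^ 2) (norm_nonneg _)
      (norm_nonneg _) (mul_pos (mul_pos (mul_pos (hc 0) (hc 1)) (hc 2)) (hc 3)) ?_ ?_
    · rw [pairing₀₂, norm_mul, norm_mul]
      linear_combination (c 1 * c 3 * ‖det₂ (w 0) (w 3)‖) * d02 + k * ‖det₂ (w 0) (w 2)‖ * d13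
    · rw [pairing₀₂, norm_mul, norm_mul]
      linear_combination (c 1 * c 2 * ‖det₂ (w 0) (w 2)‖) * d03 + k * ‖det₂ (w 0) (w 3)‖ * d12
  refine ⟨hB, eq_regularRatio_mul_of_norm_eq hB h1 ?_ him⟩
  have h3 : ‖pairing₀₂ w - pairing₀₁ w‖ ^ 2 = ‖pairing₀₁ w‖ ^ 2 + ‖pairing₀₂ w‖ ^ 2 -
      2 * (pairing₀₁ w * starRingEnd ℂ (pairing₀₂ w)).re := by
    simp only [Complex.sq_norm, Complex.normSq_apply, Complex.sub_re, Complex.sub_im,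
      Complex.mul_re, Complex.conj_re, Complex.conj_im]
    ring
  rw [← h2, h1] at h3
  linarith

/-- The permutations of the vertices that are induced by isometries form a submonoid. -/
def vertexSymmetries (ξ : Fin 4 → CP1) : Submonoid (Equiv.Perm (Fin 4)) where
  carrier := {s | (∃ f : (Fin 2 → ℂ) ≃ₗ[ℂ] (Fin 2 → ℂ),
      ∀ i, Projectivization.map f.toLinearMap f.injective (ξ i) = ξ (s i)) ∨
    (∃ f : (Fin 2 → ℂ) ≃ₛₗ[starRingEnd ℂ] (Fin 2 → ℂ),
      ∀ i, Projectivization.map f.toLinearMap f.injective (ξ i) = ξ (s i))}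
  one_mem' := Or.inl ⟨LinearEquiv.refl ℂ _, fun i => by
    rw [Equiv.Perm.one_apply]
    generalize ξ i = x
    induction x using Projectivization.ind with | h v hv => rfl⟩
  mul_mem' := by
    rintro s t (⟨f, hf⟩ | ⟨f, hf⟩) (⟨g, hg⟩ | ⟨g, hg⟩)
    · refine Or.inl ⟨g.trans f, fun i => ?_⟩
      rw [Equiv.Perm.mul_apply, ← hf, ← hg]
      generalize ξ i = x
      induction x using Projectivization.ind with | h v hv => rfl
    · refine Or.inr ⟨g.trans f, fun i => ?_⟩
      rw [Equiv.Perm.mul_apply, ← hf, ← hg]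
      generalize ξ i = x
      induction x using Projectivization.ind with | h v hv => rfl
    · refine Or.inr ⟨g.trans f, fun i => ?_⟩
      rw [Equiv.Perm.mul_apply, ← hf, ← hg]
      generalize ξ i = x
      induction x using Projectivization.ind with | h v hv => rfl
    · refine Or.inl ⟨g.trans f, fun i => ?_⟩
      rw [Equiv.Perm.mul_apply, ← hf, ← hg]
      generalize ξ i = x
      induction x using Projectivization.ind with | h v hv => rfl

/-- An involution of the form `(x, y) ↦ (a x̄ + b ȳ, c x̄ + d ȳ)` as a conjugate-linear
automorphism. -/
noncomputable def conjInvolution (a b c d : ℂ)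
    (h1 : a * starRingEnd ℂ a + b * starRingEnd ℂ c = 1)
    (h2 : a * starRingEnd ℂ b + b * starRingEnd ℂ d = 0)
    (h3 : c * starRingEnd ℂ a + d * starRingEnd ℂ c = 0)
    (h4 : c * starRingEnd ℂ b + d * starRingEnd ℂ d = 1) :
    (Fin 2 → ℂ) ≃ₛₗ[starRingEnd ℂ] (Fin 2 → ℂ) :=
  let f : (Fin 2 → ℂ) →ₛₗ[starRingEnd ℂ] (Fin 2 → ℂ) :=
    { toFun := fun v => ![a * starRingEnd ℂ (v 0) + b * starRingEnd ℂ (v 1),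
        c * starRingEnd ℂ (v 0) + d * starRingEnd ℂ (v 1)]
      map_add' := fun u v => by
        ext i
        fin_cases i <;> simp <;> ring
      map_smul' := fun t v => by
        ext i
        fin_cases i <;> simp <;> ring }
  have hf : ∀ v, f (f v) = v := fun v => by
    ext i
    fin_cases i
    · simp [f]
      linear_combination v 0 * h1 + v 1 * h2
    · simp [f]
      linear_combination v 0 * h3 + v 1 * h4
  LinearEquiv.ofInvolutive f hf

theorem conjInvolution_apply (a b c d : ℂ) (h1 h2 h3 h4) (v : Fin 2 → ℂ) :
    conjInvolution a b c d h1 h2 h3 h4 v = ![a * starRingEnd ℂ (v 0) + b * starRingEnd ℂ (v 1),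
      c * starRingEnd ℂ (v 0) + d * starRingEnd ℂ (v 1)] := rfl

/-- Each adjacent transposition of ∞, 0, 1, ω is induced by a reflection: `z ↦ 1 / z̄`, `z ↦ 1 - z̄`
and `z ↦ ω z̄` respectively, where ω = exp(πi/3). Adjacent transpositions generate all permutations.
-/
theorem swap_mem_vertexSymmetries (i : Fin 3) :
    Equiv.swap i.castSucc i.succ ∈ vertexSymmetries regularSimplex := by
  have hω := regularRatio_sq
  have hc := conj_regularRatio
  fin_cases i
  · refine Or.inr ⟨conjInvolution 0 1 1 0 (by simp) (by simp) (by simp) (by simp), fun i => ?_⟩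
    fin_cases i
    · refine (Projectivization.mk_eq_mk_iff' ℂ _ _ _ _).2 ⟨1, ?_⟩
      ext k
      fin_cases k <;> simp [conjInvolution_apply, regularVec]
    · refine (Projectivization.mk_eq_mk_iff' ℂ _ _ _ _).2 ⟨1, ?_⟩
      ext k
      fin_cases k <;> simp [conjInvolution_apply, regularVec]
    · refine (Projectivization.mk_eq_mk_iff' ℂ _ _ _ _).2 ⟨1, ?_⟩
      ext k
      fin_cases k <;> simp [conjInvolution_apply, regularVec, Equiv.swap_apply_def]
    · refine (Projectivization.mk_eq_mk_iff' ℂ _ _ _ _).2 ⟨1 - regularRatio, ?_⟩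
      ext k
      fin_cases k
      · simp [conjInvolution_apply, regularVec, Equiv.swap_apply_def]
        linear_combination -hω
      · simp [conjInvolution_apply, regularVec, Equiv.swap_apply_def, hc]
  · refine Or.inr ⟨conjInvolution (-1) 1 0 1 (by simp) (by simp) (by simp) (by simp), fun i => ?_⟩
    fin_cases i
    · refine (Projectivization.mk_eq_mk_iff' ℂ _ _ _ _).2 ⟨-1, ?_⟩
      ext k
      fin_cases k <;> simp [conjInvolution_apply, regularVec, Equiv.swap_apply_def]
    · refine (Projectivization.mk_eq_mk_iff' ℂ _ _ _ _).2 ⟨1, ?_⟩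
      ext k
      fin_cases k <;> simp [conjInvolution_apply, regularVec]
    · refine (Projectivization.mk_eq_mk_iff' ℂ _ _ _ _).2 ⟨1, ?_⟩
      ext k
      fin_cases k <;> simp [conjInvolution_apply, regularVec]
    · refine (Projectivization.mk_eq_mk_iff' ℂ _ _ _ _).2 ⟨1, ?_⟩
      ext k
      fin_cases k <;> simp [conjInvolution_apply, regularVec, Equiv.swap_apply_def, hc]
  · refine Or.inr ⟨conjInvolution regularRatio 0 0 1 (by rw [hc]; linear_combination -hω)
      (by simp) (by simp) (by simp), fun i => ?_⟩
    fin_cases i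
    · refine (Projectivization.mk_eq_mk_iff' ℂ _ _ _ _).2 ⟨regularRatio, ?_⟩
      ext k
      fin_cases k <;> simp [conjInvolution_apply, regularVec, Equiv.swap_apply_def]
    · refine (Projectivization.mk_eq_mk_iff' ℂ _ _ _ _).2 ⟨1, ?_⟩
      ext k
      fin_cases k <;> simp [conjInvolution_apply, regularVec, Equiv.swap_apply_def]
    · refine (Projectivization.mk_eq_mk_iff' ℂ _ _ _ _).2 ⟨1, ?_⟩
      ext k
      fin_cases k <;> simp [conjInvolution_apply, regularVec]
    · refine (Projectivization.mk_eq_mk_iff' ℂ _ _ _ _).2 ⟨1, ?_⟩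
      ext k
      fin_cases k
      · simp [conjInvolution_apply, regularVec, hc]
        linear_combination hω
      · simp [conjInvolution_apply, regularVec]

theorem det₂_ne_zero_of_im_ne_zero {w : Fin 4 → Fin 2 → ℂ}
    (him : (pairing₀₁ w * starRingEnd ℂ (pairing₀₂ w)).im ≠ 0) {i j : Fin 4} (hij : i ≠ j) :
    det₂ (w i) (w j) ≠ 0 := by
  have hA : pairing₀₁ w ≠ 0 := fun h => him (by simp [h])
  have hB : pairing₀₂ w ≠ 0 := fun h => him (by simp [h])
  have hC : det₂ (w 0) (w 3) * det₂ (w 1) (w 2) ≠ 0 := by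
    rw [← pairing_sub, sub_ne_zero]
    intro h
    rw [h, Complex.mul_conj] at him
    simp at him
  have hsym : ∀ u v, det₂ u v ≠ 0 → det₂ v u ≠ 0 := fun u v h h' => h (by
    rw [← norm_eq_zero, norm_det₂_comm, h', norm_zero])
  have h01 := left_ne_zero_of_mul hA; have h23 := right_ne_zero_of_mul hA
  have h02 := left_ne_zero_of_mul hB; have h13 := right_ne_zero_of_mul hB
  have h03 := left_ne_zero_of_mul hC; have h12 := right_ne_zero_of_mul hC
  fin_cases i <;> fin_cases j <;> first | exact absurd rfl hij | assumption |
    (apply hsym; assumption)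

theorem positivelyOriented_regularSimplex : PositivelyOriented regularSimplex := by
  refine (positivelyOriented_mk_iff regularVec_ne_zero).2 ?_
  rw [pairing₀₁_regularVec]
  refine im_regularRatio_mul ?_
  rw [pairing₀₂_regularVec]
  exact neg_ne_zero.2 regularRatio_ne_zero

theorem isRegularSimplex_regularSimplex : IsRegularSimplex regularSimplex := by
  constructor
  · intro i j hij
    by_contra hne
    have him := ((positivelyOriented_mk_iff regularVec_ne_zero).1
      positivelyOriented_regularSimplex).ne'
    refine det₂_ne_zero_of_im_ne_zero him hne ?_
    obtain ⟨a, ha⟩ := (Projectivization.mk_eq_mk_iff' ℂ _ _ _ _).1 hij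
    rw [← ha]
    simp only [det₂, Pi.smul_apply, smul_eq_mul]
    ring
  · intro s
    have : vertexSymmetries regularSimplex = ⊤ := by
      rw [eq_top_iff, ← Equiv.Perm.mclosure_swap_castSucc_succ 3, Submonoid.closure_le]
      rintro _ ⟨i, rfl⟩
      exact swap_mem_vertexSymmetries i
    exact (this ▸ Submonoid.mem_top s : s ∈ vertexSymmetries regularSimplex)

/-! ### Spans of members of four flags -/

/-- The space of dimension `min j n` of a complete flag. -/
def CompleteFlag.sp {n : ℕ} (F : CompleteFlag n) (j : ℕ) : Submodule ℂ (Fin n → ℂ) :=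
  F.space ⟨min j n, by lia⟩

theorem CompleteFlag.sp_mono {n : ℕ} (F : CompleteFlag n) : Monotone F.sp := fun i j h =>
  F.mono (by simpa using by lia)

theorem CompleteFlag.finrank_sp {n : ℕ} (F : CompleteFlag n) {j : ℕ} (h : j ≤ n) :
    Module.finrank ℂ (F.sp j) = j := by
  rw [CompleteFlag.sp, F.finrank_space]
  simpa using h

theorem CompleteFlag.sp_val {n : ℕ} (F : CompleteFlag n) (j : Fin (n + 1)) :
    F.sp j = F.space j := by
  rw [CompleteFlag.sp]
  congr 1
  ext
  simpa using by lia

theorem CompleteFlag.sp_zero {n : ℕ} (F : CompleteFlag n) : F.sp 0 = ⊥ :=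
  Submodule.finrank_eq_zero.1 (F.finrank_sp (Nat.zero_le n))

theorem CompleteFlag.sp_of_le {n : ℕ} (F : CompleteFlag n) {j : ℕ} (h : n ≤ j) : F.sp j = ⊤ := by
  refine Submodule.eq_top_of_finrank_eq ?_
  rw [CompleteFlag.sp, F.finrank_space]
  simpa using h

theorem CompleteFlag.ext_sp {n : ℕ} {F G : CompleteFlag n} (h : ∀ j, F.sp j = G.sp j) : F = G := by
  ext1
  funext j
  rw [← F.sp_val, ← G.sp_val, h]

theorem CompleteFlag.exists_sp_succ {n : ℕ} (F : CompleteFlag n) (j : ℕ) :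
    ∃ v, F.sp (j + 1) = Submodule.span ℂ {v} ⊔ F.sp j := by
  rcases lt_or_ge j n with h | h
  · obtain ⟨A, rfl⟩ := F.exists_affineFlag
    exact ⟨A.vec ⟨j, h⟩, by simpa [← CompleteFlag.sp_val] using A.space_succ ⟨j, h⟩⟩
  · exact ⟨0, by rw [F.sp_of_le (by lia), F.sp_of_le h]; simp⟩

/-- The span of the spaces of dimensions `J 0, …, J 3` of four flags. -/
def flagSpan {n : ℕ} (F : Fin 4 → CompleteFlag n) (J : Fin 4 → ℕ) : Submodule ℂ (Fin n → ℂ) :=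
  ⨆ i, (F i).sp (J i)

section flagSpan

variable {n : ℕ} {F : Fin 4 → CompleteFlag n} {J J' : Fin 4 → ℕ}

theorem flagSpan_mono (h : J ≤ J') : flagSpan F J ≤ flagSpan F J' :=
  iSup_mono fun i => (F i).sp_mono (h i)

theorem sp_le_flagSpan {i : Fin 4} {k : ℕ} (h : k ≤ J i) : (F i).sp k ≤ flagSpan F J :=
  ((F i).sp_mono h).trans (le_iSup (fun i => (F i).sp (J i)) i)

theorem flagSpan_le {W : Submodule ℂ (Fin n → ℂ)} (h : ∀ i, (F i).sp (J i) ≤ W) :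
    flagSpan F J ≤ W := iSup_le h

theorem flagSpan_comp (σ : Equiv.Perm (Fin 4)) :
    flagSpan (fun i => F (σ i)) (fun i => J (σ i)) = flagSpan F J :=
  σ.iSup_comp (g := fun i => (F i).sp (J i))

theorem flagSpan_add_single (i : Fin 4) :
    flagSpan F (J + Pi.single i 1) = flagSpan F J ⊔ (F i).sp (J i + 1) := by
  apply le_antisymm
  · refine flagSpan_le fun k => ?_
    by_cases hk : k = i
    · subst hk
      simp
    · simp only [Pi.add_apply, Pi.single_eq_of_ne hk, add_zero]
      exact (sp_le_flagSpan le_rfl).trans le_sup_left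
  · exact sup_le (flagSpan_mono (by simp)) (sp_le_flagSpan (by simp))

theorem exists_flagSpan_add_single (i : Fin 4) :
    ∃ v ∈ (F i).sp (J i + 1), flagSpan F (J + Pi.single i 1) = Submodule.span ℂ {v} ⊔ flagSpan F J := by
  obtain ⟨v, hv⟩ := (F i).exists_sp_succ (J i)
  refine ⟨v, hv ▸ Submodule.mem_sup_left (Submodule.mem_span_singleton_self v), ?_⟩
  rw [flagSpan_add_single, hv, sup_comm, sup_assoc, sup_eq_right.2 (sp_le_flagSpan le_rfl)]

theorem finrank_flagSpan_add_single_le (i : Fin 4) :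
    Module.finrank ℂ (flagSpan F (J + Pi.single i 1)) ≤ Module.finrank ℂ (flagSpan F J) + 1 := by
  obtain ⟨v, -, hv⟩ := exists_flagSpan_add_single (F := F) (J := J) i
  rw [hv, add_comm]
  refine (Submodule.finrank_add_le_finrank_add_finrank _ _).trans ?_
  gcongr
  exact (finrank_span_le_card ({v} : Set (Fin n → ℂ))).trans (by simp)

/-- Raising one index by one adds at most one vector to the span. -/
theorem finrank_flagSpan_le_add {m : ℕ} (h : J ≤ J') (hm : ∑ i, J' i = ∑ i, J i + m) :
    Module.finrank ℂ (flagSpan F J') ≤ Module.finrank ℂ (flagSpan F J) + m := by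
  induction m generalizing J' with
  | zero =>
    have : J = J' := by
      funext i
      exact (Finset.sum_eq_sum_iff_of_le fun i _ => h i).1 (by simpa using hm.symm) i
        (Finset.mem_univ i)
    rw [this]; simp
  | succ m ih =>
    obtain ⟨i, -, hi⟩ := Finset.exists_lt_of_sum_lt (s := Finset.univ) (f := J) (g := J') (by lia)
    obtain ⟨J'', rfl⟩ : ∃ J'', J' = J'' + Pi.single i 1 :=
      ⟨J' - Pi.single i 1, funext fun k => by
        by_cases hk : k = i
        · subst hk; simp; lia
        · simp [Pi.single_eq_of_ne hk]⟩
    have h1 : J ≤ J'' := fun k => by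
      by_cases hk : k = i
      · subst hk; simp at hi; lia
      · simpa [Pi.single_eq_of_ne hk] using h k
    have h2 : ∑ k, J'' k = ∑ k, J k + m := by
      simp only [Pi.add_apply, Finset.sum_add_distrib, Finset.sum_pi_single', Finset.mem_univ,
        if_true] at hm
      lia
    have := finrank_flagSpan_add_single_le (F := F) (J := J'') i
    have := ih h1 h2
    lia

theorem flagSpan_zero : flagSpan F 0 = ⊥ := by
  rw [eq_bot_iff]
  exact flagSpan_le fun i => ((F i).sp_zero).le

theorem finrank_flagSpan_le : Module.finrank ℂ (flagSpan F J) ≤ ∑ i, J i := by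
  have := finrank_flagSpan_le_add (F := F) (J := 0) (J' := J) (m := ∑ i, J i) (fun _ => by simp)
    (by simp)
  rw [flagSpan_zero] at this
  simpa using this

theorem finrank_flagSpan_le_card : Module.finrank ℂ (flagSpan F J) ≤ n := by
  simpa using Submodule.finrank_le (flagSpan F J)

theorem flagSpan_eq_top_iff : flagSpan F J = ⊤ ↔ Module.finrank ℂ (flagSpan F J) = n := by
  constructor
  · intro h
    rw [h]; simp
  · intro h
    exact Submodule.eq_top_of_finrank_eq (by simpa using h)

/-- The quotient of consecutive spans at `J` is a plane in which the four flags define four distinct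
lines. -/
def IsGood (F : Fin 4 → CompleteFlag n) (J : Fin 4 → ℕ) : Prop :=
  Module.finrank ℂ (flagSpan F (J + 1)) = Module.finrank ℂ (flagSpan F J) + 2 ∧
    ∀ i k, i ≠ k → flagSpan F (J + Pi.single i 1 + Pi.single k 1) = flagSpan F (J + 1)

theorem IsGood.comp (h : IsGood F J) (σ : Equiv.Perm (Fin 4)) :
    IsGood (fun i => F (σ i)) (fun i => J (σ i)) := by
  have h1 : flagSpan (fun i => F (σ i)) ((fun i => J (σ i)) + 1) = flagSpan F (J + 1) :=
    flagSpan_comp (F := F) (J := J + 1) σ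
  refine ⟨?_, fun i k hik => ?_⟩
  · rw [flagSpan_comp (F := F) (J := J) σ, h1, h.1]
  · have h2 : (fun i => J (σ i)) + Pi.single i 1 + Pi.single k 1 =
        fun m => (J + Pi.single (σ i) 1 + Pi.single (σ k) 1 : Fin 4 → ℕ) (σ m) := by
      funext m
      simp [Pi.single_apply]
    rw [h1, h2, flagSpan_comp (F := F) σ, h.2 _ _ (σ.injective.ne hik)]

theorem IsGood.finrank_add_single (h : IsGood F J) (i : Fin 4) :
    Module.finrank ℂ (flagSpan F (J + Pi.single i 1)) = Module.finrank ℂ (flagSpan F J) + 1 := by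
  obtain ⟨k, hk⟩ : ∃ k : Fin 4, i ≠ k := ⟨i + 1, by fin_cases i <;> decide⟩
  have h1 := finrank_flagSpan_add_single_le (F := F) (J := J) i
  have h2 := finrank_flagSpan_add_single_le (F := F) (J := J + Pi.single i 1) k
  rw [h.2 i k hk, h.1] at h2
  lia

/-- The lines of flags i and k in the quotient plane are distinct, so adding flag k alone cannot
absorb the next space of flag i. This lemma and the opposite inclusion `IsGood.sp_le` yield the
contradictions in the counting. -/
theorem IsGood.not_sp_le (h : IsGood F J) {i k : Fin 4} (hik : i ≠ k) {K : Fin 4 → ℕ}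
    (hK : K ≤ J + Pi.single k 1) : ¬ (F i).sp (J i + 1) ≤ flagSpan F K := by
  intro hle
  have h1 := flagSpan_add_single (F := F) (J := J + Pi.single k 1) i
  rw [h.2 k i hik.symm] at h1
  simp only [Pi.add_apply, Pi.single_eq_of_ne hik, add_zero] at h1
  rw [sup_eq_left.2 (hle.trans (flagSpan_mono hK))] at h1
  have h2 := h.1
  rw [h1, h.finrank_add_single k] at h2
  lia

theorem IsGood.sp_le (h : IsGood F J) (i : Fin 4) {k l : Fin 4} (hkl : k ≠ l) {K : Fin 4 → ℕ}
    (hK : J + Pi.single k 1 + Pi.single l 1 ≤ K) : (F i).sp (J i + 1) ≤ flagSpan F K := by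
  refine le_trans ?_ (flagSpan_mono hK)
  rw [h.2 k l hkl]
  exact sp_le_flagSpan (by simp)

end flagSpan

/-! ### Counting the good quadruples -/

/-- The triples `a ≤ b < c < n`, listed as `(c, b, a)`. -/
def dimTriples (n : ℕ) : Finset ((_ : ℕ) × (_ : ℕ) × ℕ) :=
  (Finset.range n).sigma fun c => (Finset.range c).sigma fun b => Finset.range (b + 1)

theorem mem_dimTriples {n a b c : ℕ} : ⟨c, b, a⟩ ∈ dimTriples n ↔ a ≤ b ∧ b < c ∧ c < n := by
  simp [dimTriples]
  lia

theorem card_dimTriples (n : ℕ) :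
    ((dimTriples n).card : ℝ) = (n : ℝ) * ((n : ℝ) ^ 2 - 1) / 6 := by
  simp only [dimTriples, Finset.card_sigma, Finset.card_range]
  have h : ∀ c : ℕ, ((∑ b ∈ Finset.range c, (b + 1) : ℕ) : ℝ) = c * (c + 1) / 2 := by
    intro c
    induction c with
    | zero => simp
    | succ c ih => rw [Finset.sum_range_succ, Nat.cast_add, ih]; push_cast; ring
  induction n with
  | zero => simp
  | succ n ih => rw [Finset.sum_range_succ, Nat.cast_add, ih, h]; push_cast; ring

section counting

variable {n : ℕ} {F : Fin 4 → CompleteFlag n}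

/-- The dimensions `dim F₀^{j₀} ≤ dim (F₀^{j₀} + F₁^{j₁}) < dim (F₀^{j₀} + F₁^{j₁+1} + F₂^{j₂})`, in
reverse order. -/
noncomputable def dimTriple (F : Fin 4 → CompleteFlag n) (J : Fin 4 → ℕ) :
    (_ : ℕ) × (_ : ℕ) × ℕ :=
  ⟨Module.finrank ℂ (flagSpan F ![J 0, J 1 + 1, J 2, 0]),
    Module.finrank ℂ (flagSpan F ![J 0, J 1, 0, 0]), J 0⟩

theorem vec_le_iff {a b c d : ℕ} {J : Fin 4 → ℕ} :
    ![a, b, c, d] ≤ J ↔ a ≤ J 0 ∧ b ≤ J 1 ∧ c ≤ J 2 ∧ d ≤ J 3 := by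
  simp [Pi.le_def, Fin.forall_fin_succ]

/-- If `J 3 < J' 3`, the directions 1 and 3 at `J` already span the plane there, so raising only
index 1 at `J'` absorbs the next space of F₀, which goodness at `J'` forbids. -/
theorem IsGood.eq_three {J J' : Fin 4 → ℕ} (h : IsGood F J) (h' : IsGood F J') (h0 : J 0 = J' 0)
    (h1 : J 1 = J' 1) (h2 : J 2 = J' 2) : J = J' := by
  have key : ∀ {J J' : Fin 4 → ℕ}, IsGood F J → IsGood F J' → J 0 = J' 0 → J 1 = J' 1 →
      J 2 = J' 2 → ¬ J 3 < J' 3 := by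
    intro J J' h h' h0 h1 h2 hlt
    refine h'.not_sp_le (i := 0) (k := 1) (by decide) le_rfl ?_
    rw [← h0]
    refine h.sp_le 0 (k := 1) (l := 3) (by decide) fun i => ?_
    fin_cases i <;> simp <;> lia
  have h3 : J 3 = J' 3 :=
    le_antisymm (not_lt.1 (key h' h h0.symm h1.symm h2.symm)) (not_lt.1 (key h h' h0 h1 h2))
  funext i
  fin_cases i <;> assumption

/-- If one index were larger while the dimension is unchanged, the two nested spans would coincide,
and the smaller one would contain the next space of the flag concerned. This recovers `J 1`, then `J
2`, and `IsGood.eq_three` recovers `J 3`. -/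
theorem IsGood.eq_of_dimTriple_eq {J J' : Fin 4 → ℕ} (h : IsGood F J) (h' : IsGood F J')
    (he : dimTriple F J = dimTriple F J') : J = J' := by
  simp only [dimTriple, Sigma.mk.injEq, heq_eq_eq] at he
  obtain ⟨hc, hb, h0⟩ := he
  have key1 : ∀ {J J' : Fin 4 → ℕ}, IsGood F J → IsGood F J' → J 0 = J' 0 →
      Module.finrank ℂ (flagSpan F ![J 0, J 1, 0, 0]) =
        Module.finrank ℂ (flagSpan F ![J' 0, J' 1, 0, 0]) → ¬ J 1 < J' 1 := by
    intro J J' h h' h0 hb hlt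
    have heq : flagSpan F ![J 0, J 1, 0, 0] = flagSpan F ![J' 0, J' 1, 0, 0] :=
      Submodule.eq_of_le_of_finrank_eq (flagSpan_mono (by simp [vec_le_iff]; lia)) hb
    refine h.not_sp_le (i := 1) (k := 0) (by decide) (K := ![J 0, J 1, 0, 0])
      (by simp [vec_le_iff]) ?_
    rw [heq]
    exact sp_le_flagSpan (by simpa using hlt)
  have h1 : J 1 = J' 1 := le_antisymm (not_lt.1 (key1 h' h h0.symm hb.symm))
    (not_lt.1 (key1 h h' h0 hb))
  have key2 : ∀ {J J' : Fin 4 → ℕ}, IsGood F J → IsGood F J' → J 0 = J' 0 → J 1 = J' 1 →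
      Module.finrank ℂ (flagSpan F ![J 0, J 1 + 1, J 2, 0]) =
        Module.finrank ℂ (flagSpan F ![J' 0, J' 1 + 1, J' 2, 0]) → ¬ J 2 < J' 2 := by
    intro J J' h h' h0 h1 hb hlt
    have heq : flagSpan F ![J 0, J 1 + 1, J 2, 0] = flagSpan F ![J' 0, J' 1 + 1, J' 2, 0] :=
      Submodule.eq_of_le_of_finrank_eq (flagSpan_mono (by simp [vec_le_iff]; lia)) hb
    refine h.not_sp_le (i := 2) (k := 1) (by decide) (K := ![J 0, J 1 + 1, J 2, 0])
      (by simp [vec_le_iff]) ?_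
    rw [heq]
    exact sp_le_flagSpan (by simpa using hlt)
  have h2 : J 2 = J' 2 := le_antisymm (not_lt.1 (key2 h' h h0.symm h1.symm hc.symm))
    (not_lt.1 (key2 h h' h0 h1 hc))
  exact h.eq_three h' h0 h1 h2

theorem flagSpan_pair_lt {J : Fin 4 → ℕ} (h : IsGood F J) :
    flagSpan F ![J 0, J 1, 0, 0] < flagSpan F ![J 0, J 1 + 1, J 2, 0] := by
  refine lt_of_le_of_ne (flagSpan_mono (by simp [vec_le_iff])) fun he => ?_
  refine h.not_sp_le (i := 1) (k := 0) (by decide) (K := ![J 0, J 1, 0, 0])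
    (by simp [vec_le_iff]) ?_
  rw [he]
  exact sp_le_flagSpan (by simp)

theorem flagSpan_ne_top_of_isGood {J K : Fin 4 → ℕ} (h : IsGood F J) (k : Fin 4)
    (hK : K ≤ J + Pi.single k 1) : flagSpan F K ≠ ⊤ := by
  obtain ⟨i, hi⟩ : ∃ i : Fin 4, i ≠ k := ⟨k + 1, by fin_cases k <;> decide⟩
  intro he
  exact h.not_sp_le hi hK (he ▸ le_top)

theorem dimTriple_mem {J : Fin 4 → ℕ} (hJ : J 0 ≤ n) (h : IsGood F J) :
    dimTriple F J ∈ dimTriples n := by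
  rw [dimTriple, mem_dimTriples]
  refine ⟨?_, Submodule.finrank_lt_finrank_of_lt (flagSpan_pair_lt h), ?_⟩
  · conv_lhs => rw [← (F 0).finrank_sp hJ]
    exact Submodule.finrank_mono (sp_le_flagSpan (by simp))
  · refine lt_of_le_of_ne finrank_flagSpan_le_card fun he => ?_
    exact flagSpan_ne_top_of_isGood h 1 (by simp [vec_le_iff]) (flagSpan_eq_top_iff.2 he)

open Classical in
/-- The good quadruples of indices. -/
noncomputable def goodSet (F : Fin 4 → CompleteFlag n) : Finset (Fin 4 → Fin n) :=
  {J | IsGood F fun i => J i}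

theorem mem_goodSet {J : Fin 4 → Fin n} : J ∈ goodSet F ↔ IsGood F fun i => J i := by
  simp [goodSet]

theorem natVal_injective {n : ℕ} {J J' : Fin 4 → Fin n}
    (h : (fun i => (J i : ℕ)) = fun i => (J' i : ℕ)) : J = J' :=
  funext fun i => Fin.ext (congrFun h i)

theorem injOn_dimTriple : Set.InjOn (fun J : Fin 4 → Fin n => dimTriple F fun i => J i)
    (goodSet F) := fun _ hJ _ hJ' he =>
  natVal_injective ((mem_goodSet.1 hJ).eq_of_dimTriple_eq (mem_goodSet.1 hJ') he)

theorem mapsTo_dimTriple : Set.MapsTo (fun J : Fin 4 → Fin n => dimTriple F fun i => J i)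
    (goodSet F) (dimTriples n) := fun J hJ => dimTriple_mem (J 0).2.le (mem_goodSet.1 hJ)

theorem card_goodSet_le : (goodSet F).card ≤ (dimTriples n).card :=
  Finset.card_le_card_of_injOn _ mapsTo_dimTriple injOn_dimTriple

theorem sum_goodSet_comp {M : Type*} [AddCommMonoid M] (σ : Equiv.Perm (Fin 4))
    (f : (Fin 4 → Fin n) → M) :
    ∑ J ∈ goodSet F, f (fun i => J (σ i)) = ∑ J ∈ goodSet fun i => F (σ i), f J := by
  refine Finset.sum_bij' (fun J _ => fun i => J (σ i)) (fun J _ => fun i => J (σ.symm i)) ?_ ?_ ?_ ?_ ?_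
  · intro J hJ
    exact mem_goodSet.2 ((mem_goodSet.1 hJ).comp σ)
  · intro J hJ
    have := (mem_goodSet.1 hJ).comp σ.symm
    simp only [Equiv.apply_symm_apply] at this
    exact mem_goodSet.2 this
  · intros; funext i; simp
  · intros; funext i; simp
  · intros; rfl

theorem card_goodSet_comp (σ : Equiv.Perm (Fin 4)) :
    (goodSet fun i => F (σ i)).card = (goodSet F).card := by
  simpa using (sum_goodSet_comp (F := F) σ fun _ => (1 : ℕ)).symm

/-- An injection between finite sets of equal cardinality is onto. -/
theorem exists_isGood_of_card (hF : (goodSet F).card = (dimTriples n).card) {a b c : ℕ}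
    (hab : a ≤ b) (hbc : b < c) (hc : c < n) : ∃ J : Fin 4 → ℕ, (∀ i, J i < n) ∧ IsGood F J ∧
      J 0 = a ∧ Module.finrank ℂ (flagSpan F ![a, J 1, 0, 0]) = b ∧
      Module.finrank ℂ (flagSpan F ![a, J 1 + 1, J 2, 0]) = c := by
  have hsurj := Finset.surjOn_of_injOn_of_card_le _ (mapsTo_dimTriple (F := F)) injOn_dimTriple
    hF.ge
  obtain ⟨J, hJ, he⟩ := hsurj (mem_dimTriples.2 ⟨hab, hbc, hc⟩ : (⟨c, b, a⟩ : (_ : ℕ) × (_ : ℕ) × ℕ) ∈ _)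
  simp only [dimTriple, Sigma.mk.injEq, heq_eq_eq] at he
  obtain ⟨h1, h2, h3⟩ := he
  refine ⟨fun i => J i, fun i => (J i).2, mem_goodSet.1 hJ, h3, ?_, ?_⟩
  · rw [← h3]; exact h2
  · rw [← h3]; exact h1

/-- Induction on `a`: a suitable realised triple shows that one dimension of F₁ may be traded for
one of F₀ without losing the whole space. -/
theorem flagSpan_pair_eq_top (hF : (goodSet F).card = (dimTriples n).card) {a : ℕ} (ha : a ≤ n) :
    flagSpan F ![a, n - a, 0, 0] = ⊤ := by
  induction a with
  | zero =>
    rw [eq_top_iff, ← (F 1).sp_of_le le_rfl]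
    exact sp_le_flagSpan (by simp)
  | succ a ih =>
    rcases Nat.lt_or_ge (a + 1) n with hlt | hge
    -- With `b = n - 2` there is room only for the quotient plane, so F₂ and F₃ contribute nothing
    -- to the span at `J`, and the directions 0 and 1 complete it to the whole space.
    · obtain ⟨J, -, hJ, h0, h1, h2⟩ := exists_isGood_of_card hF (a := a) (b := n - 2) (c := n - 1)
        (by lia) (by lia) (by lia)
      have hD : flagSpan F J = flagSpan F ![a, J 1, 0, 0] := by
        refine (Submodule.eq_of_le_of_finrank_le (flagSpan_mono ?_) ?_).symm
        · simp [vec_le_iff, h0]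
        · have h3 := hJ.1
          have h4 := finrank_flagSpan_le_card (F := F) (J := J + 1)
          lia
      have hU : flagSpan F ![a + 1, J 1 + 1, 0, 0] = ⊤ := by
        have h3 := hJ.1
        have h4 := hJ.2 0 1 (by decide)
        have h5 : flagSpan F (J + 1) = ⊤ := by
          rw [flagSpan_eq_top_iff, h3, hD, h1]; lia
        rw [h5] at h4
        rw [eq_top_iff, ← h4, add_assoc]
        refine flagSpan_le fun i => ?_
        fin_cases i
        · exact sp_le_flagSpan (by simp [h0])
        · exact sp_le_flagSpan (by simp)
        · refine le_trans (le_trans ?_ hD.le) (flagSpan_mono (by simp [vec_le_iff]))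
          exact sp_le_flagSpan (by simp)
        · refine le_trans (le_trans ?_ hD.le) (flagSpan_mono (by simp [vec_le_iff]))
          exact sp_le_flagSpan (by simp)
      -- Otherwise the induction hypothesis would make a span whole that must stay proper at a good
      -- index.
      have hlt' : J 1 + 1 < n - a := by
        by_contra hge
        refine flagSpan_ne_top_of_isGood hJ 1 (K := ![a, J 1 + 1, J 2, 0]) ?_ ?_
        · simp [vec_le_iff, h0]
        · rw [eq_top_iff, ← ih (by lia)]
          exact flagSpan_mono (by simp [vec_le_iff]; lia)
      rw [eq_top_iff, ← hU]
      exact flagSpan_mono (by simp [vec_le_iff]; lia)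
    · rw [eq_top_iff, ← (F 0).sp_of_le hge]
      exact sp_le_flagSpan (by simp)

theorem flagSpan_swap {a b c d : ℕ} :
    flagSpan (fun i => F (Equiv.swap 1 2 i)) ![a, b, c, d] = flagSpan F ![a, c, b, d] := by
  rw [← flagSpan_comp (F := F) (Equiv.swap 1 2)]
  congr 1
  funext i
  fin_cases i <;> rfl

/-- Each unit step raises the dimension by at most one, so reaching dimension n in n steps leaves no
step without effect. -/
theorem finrank_flagSpan_of_flagSpan_eq_top {J J' : Fin 4 → ℕ} (h : J ≤ J')
    (hJ' : flagSpan F J' = ⊤) (hn : ∑ i, J' i = n) :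
    Module.finrank ℂ (flagSpan F J) = ∑ i, J i := by
  have h1 := finrank_flagSpan_le (F := F) (J := J)
  have h3 : ∑ i, J i ≤ ∑ i, J' i := Finset.sum_le_sum fun i _ => h i
  have h2 := finrank_flagSpan_le_add (F := F) h (m := ∑ i, J' i - ∑ i, J i) (by lia)
  rw [flagSpan_eq_top_iff.1 hJ'] at h2
  lia

/-- The same exchange as for pairs, now trading one dimension of F₂ for one of F₁; the triple `(a, a
+ b, n - 1)` provides the good index. -/
theorem flagSpan_triple_eq_top (hF : (goodSet F).card = (dimTriples n).card) {a b c : ℕ}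
    (h : a + b + c = n) : flagSpan F ![a, b, c, 0] = ⊤ := by
  induction b generalizing c with
  | zero =>
    have := flagSpan_pair_eq_top (F := fun i => F (Equiv.swap 1 2 i))
      ((card_goodSet_comp _).trans hF) (a := a) (by lia)
    rw [flagSpan_swap, show n - a = c by lia] at this
    exact this
  | succ b ih =>
    rcases Nat.eq_zero_or_pos c with rfl | hc
    · rw [← flagSpan_pair_eq_top hF (a := a) (by lia), show n - a = b + 1 by lia]
    · obtain ⟨J, -, hJ, h0, h1, h2⟩ := exists_isGood_of_card hF (a := a) (b := a + b)
        (c := n - 1) (by lia) (by lia) (by lia)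
      have hp := flagSpan_pair_eq_top hF (a := a) (by lia)
      have hdim : ∀ k, a + k ≤ n → Module.finrank ℂ (flagSpan F ![a, k, 0, 0]) = a + k := by
        intro k hk
        rw [finrank_flagSpan_of_flagSpan_eq_top (J' := ![a, n - a, 0, 0]) _ hp]
        · simp [Fin.sum_univ_four]
        · simp [Fin.sum_univ_four]; lia
        · simp [vec_le_iff]; lia
      -- General position of F₀ and F₁ turns the prescribed dimension `a + b` into the index itself.
      have hJ1 : J 1 = b := by
        rcases Nat.lt_or_ge n (a + J 1) with hlt | hge
        · exfalso
          have : flagSpan F ![a, J 1, 0, 0] = ⊤ := by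
            rw [eq_top_iff, ← hp]
            exact flagSpan_mono (by simp [vec_le_iff]; lia)
          rw [flagSpan_eq_top_iff, h1] at this
          lia
        · rw [hdim _ hge] at h1
          lia
      rw [hJ1] at h2
      have hlt : J 2 + 1 < n - a - b := by
        by_contra hge
        refine flagSpan_ne_top_of_isGood hJ 2 (K := ![a, b, J 2 + 1, 0]) ?_ ?_
        · simp [vec_le_iff, h0, hJ1]
        · rw [eq_top_iff, ← ih (c := n - a - b) (by lia)]
          exact flagSpan_mono (by simp [vec_le_iff]; lia)
      have hU : flagSpan F ![a, b + 1, J 2 + 1, 0] = ⊤ := by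
        rw [flagSpan_eq_top_iff]
        refine le_antisymm finrank_flagSpan_le_card ?_
        have hlt : flagSpan F ![a, b + 1, J 2, 0] < flagSpan F ![a, b + 1, J 2 + 1, 0] := by
          refine lt_of_le_of_ne (flagSpan_mono (by simp [vec_le_iff])) fun he => ?_
          refine hJ.not_sp_le (i := 2) (k := 1) (by decide) (K := ![a, b + 1, J 2, 0])
            (by simp [vec_le_iff, h0, hJ1]) ?_
          rw [he]
          exact sp_le_flagSpan (by simp)
        have := Submodule.finrank_lt_finrank_of_lt hlt
        lia
      rw [eq_top_iff, ← hU]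
      exact flagSpan_mono (by simp [vec_le_iff]; lia)

end counting

/-! ### Good sets of maximal size are balanced -/

section moments

variable {n : ℕ} {F : Fin 4 → CompleteFlag n}

/-- The quadruples of indices with sum `n - 2`. -/
def balancedSet (n : ℕ) : Finset (Fin 4 → Fin n) := {J | ∑ i, (J i : ℕ) + 2 = n}

theorem mem_balancedSet {J : Fin 4 → Fin n} : J ∈ balancedSet n ↔ ∑ i, (J i : ℕ) + 2 = n := by
  simp [balancedSet]

theorem finrank_flagSpan_triple (hF : (goodSet F).card = (dimTriples n).card) (a b c : ℕ) :
    Module.finrank ℂ (flagSpan F ![a, b, c, 0]) = min (a + b + c) n := by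
  rcases le_total (a + b + c) n with h | h
  · rw [min_eq_left h, finrank_flagSpan_of_flagSpan_eq_top (J' := ![a, b, n - a - b, 0]) _
      (flagSpan_triple_eq_top hF (by lia))]
    · simp [Fin.sum_univ_four]
    · simp [Fin.sum_univ_four]; lia
    · simp [vec_le_iff]; lia
  · rw [min_eq_right h, ← flagSpan_eq_top_iff, eq_top_iff,
      ← flagSpan_triple_eq_top hF (a := min a n) (b := min b (n - min a n))
        (c := n - min a n - min b (n - min a n)) (by lia)]
    exact flagSpan_mono (by simp [vec_le_iff]; lia)

theorem sum_le_of_mem_goodSet (hF : (goodSet F).card = (dimTriples n).card) {J : Fin 4 → Fin n}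
    (hJ : J ∈ goodSet F) : (J 0 : ℕ) + J 1 + J 2 + 2 ≤ n := by
  have h1 := flagSpan_ne_top_of_isGood (mem_goodSet.1 hJ) 1 (K := ![J 0, J 1 + 1, J 2, 0])
    (by simp [vec_le_iff])
  rw [ne_eq, flagSpan_eq_top_iff, finrank_flagSpan_triple hF] at h1
  lia

theorem exists_mem_goodSet (hF : (goodSet F).card = (dimTriples n).card) {a b c : ℕ}
    (h : a + b + c + 2 ≤ n) :
    ∃ J ∈ goodSet F, (J 0 : ℕ) = a ∧ (J 1 : ℕ) = b ∧ (J 2 : ℕ) = c := by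
  obtain ⟨J, hlt, hJ, h0, h1, h2⟩ := exists_isGood_of_card hF (a := a) (b := a + b)
    (c := a + b + 1 + c) (by lia) (by lia) (by lia)
  rw [finrank_flagSpan_triple hF] at h1 h2
  exact ⟨fun i => ⟨J i, hlt i⟩, mem_goodSet.2 hJ, h0, by simp only; lia, by simp only; lia⟩

/-- Both sets project bijectively onto the triples `(J 0, J 1, J 2)` of sum at most `n - 2`,
although nothing is yet known about the last index of a good quadruple. -/
theorem sum_goodSet_eq_sum_balancedSet (hF : (goodSet F).card = (dimTriples n).card)
    (f : ℕ → ℕ → ℝ) :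
    ∑ J ∈ goodSet F, f (J 0) (J 1) = ∑ J ∈ balancedSet n, f (J 0) (J 1) := by
  refine Finset.sum_bij (fun J hJ => ![J 0, J 1, J 2, ⟨n - 2 - J 0 - J 1 - J 2, by
    have := (J 0).2; lia⟩]) ?_ ?_ ?_ ?_
  · intro J hJ
    have := sum_le_of_mem_goodSet hF hJ
    rw [mem_balancedSet, Fin.sum_univ_four]
    simp
    lia
  · intro J hJ J' hJ' he
    have h0 := congrFun he 0
    have h1 := congrFun he 1
    have h2 := congrFun he 2
    simp at h0 h1 h2
    exact natVal_injective ((mem_goodSet.1 hJ).eq_three (mem_goodSet.1 hJ') (by rw [h0])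
      (by rw [h1]) (by rw [h2]))
  · intro J hJ
    rw [mem_balancedSet, Fin.sum_univ_four] at hJ
    obtain ⟨J', hJ', h0, h1, h2⟩ := exists_mem_goodSet hF (a := J 0) (b := J 1) (c := J 2) (by lia)
    refine ⟨J', hJ', ?_⟩
    funext i
    fin_cases i
    · exact Fin.ext h0
    · exact Fin.ext h1
    · exact Fin.ext h2
    · refine Fin.ext ?_
      simp
      lia
  · intro J hJ
    rfl

theorem sum_balancedSet_comp {M : Type*} [AddCommMonoid M] (σ : Equiv.Perm (Fin 4))
    (f : (Fin 4 → Fin n) → M) :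
    ∑ J ∈ balancedSet n, f (fun i => J (σ i)) = ∑ J ∈ balancedSet n, f J := by
  refine Finset.sum_bij' (fun J _ => fun i => J (σ i)) (fun J _ => fun i => J (σ.symm i)) ?_ ?_ ?_ ?_ ?_
  · intro J hJ
    rw [mem_balancedSet] at hJ ⊢
    rw [Equiv.sum_comp σ fun i => (J i : ℕ)]
    exact hJ
  · intro J hJ
    rw [mem_balancedSet] at hJ ⊢
    rw [Equiv.sum_comp σ.symm fun i => (J i : ℕ)]
    exact hJ
  · intros; funext i; simp
  · intros; funext i; simp
  · intros; rfl

/-- The cardinality hypothesis is invariant under relabelling the flags, so any pair of indices can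
play the role of the first two. -/
theorem sum_goodSet_pair (hF : (goodSet F).card = (dimTriples n).card) (f : ℕ → ℕ → ℝ)
    (i k : Fin 4) : ∑ J ∈ goodSet F, f (J i) (J k) = ∑ J ∈ balancedSet n, f (J i) (J k) := by
  have key : ∀ (σ : Equiv.Perm (Fin 4)) (g : ℕ → ℕ → ℝ), ∑ J ∈ goodSet F, g (J (σ 0)) (J (σ 1)) =
      ∑ J ∈ balancedSet n, g (J (σ 0)) (J (σ 1)) := by
    intro σ g
    rw [sum_goodSet_comp σ fun J => g (J 0) (J 1), sum_balancedSet_comp σ fun J => g (J 0) (J 1)]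
    exact sum_goodSet_eq_sum_balancedSet ((card_goodSet_comp σ).trans hF) g
  by_cases hik : i = k
  · subst hik
    have := key (Equiv.swap 0 i) fun x _ => f x x
    simpa using this
  · obtain ⟨σ, h0, h1⟩ : ∃ σ : Equiv.Perm (Fin 4), σ 0 = i ∧ σ 1 = k := by
      refine ⟨(Equiv.swap 1 (Equiv.swap 0 i k)).trans (Equiv.swap 0 i), ?_, ?_⟩
      · have h : Equiv.swap 1 (Equiv.swap 0 i k) 0 = 0 := by
          refine Equiv.swap_apply_of_ne_of_ne (by decide) fun h => ?_
          have := congrArg (Equiv.swap 0 i) h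
          simp at this
          exact hik this
        rw [Equiv.trans_apply, h, Equiv.swap_apply_left]
      · simp
    have := key σ f
    rwa [h0, h1] at this

/-- The square of `∑ J i + 2 - n` involves at most two indices in each term, so its sum over the
good set equals its sum over the balanced set, which is 0. Hence every good quadruple is balanced.
-/
theorem goodSet_eq_balancedSet (hF : (goodSet F).card = (dimTriples n).card) :
    goodSet F = balancedSet n := by
  -- The constant is shared equally by the four indices, which makes the square a double sum over
  -- pairs.
  set c : ℝ := ((n : ℝ) - 2) / 4 with hc
  have hexp : ∀ J : Fin 4 → Fin n, (∑ i, ((J i : ℕ) : ℝ) + 2 - n) ^ 2 =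
      ∑ i, ∑ k, (((J i : ℕ) : ℝ) - c) * (((J k : ℕ) : ℝ) - c) := by
    intro J
    rw [← Finset.sum_mul_sum, ← sq]
    congr 1
    rw [Finset.sum_sub_distrib]
    simp [hc]
    ring
  have hsum : ∑ J ∈ goodSet F, (∑ i, ((J i : ℕ) : ℝ) + 2 - n) ^ 2 = 0 := by
    have h1 : ∑ J ∈ goodSet F, (∑ i, ((J i : ℕ) : ℝ) + 2 - n) ^ 2 =
        ∑ J ∈ balancedSet n, (∑ i, ((J i : ℕ) : ℝ) + 2 - n) ^ 2 := by
      simp only [hexp]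
      rw [Finset.sum_comm, Finset.sum_comm (s := balancedSet n)]
      refine Finset.sum_congr rfl fun i _ => ?_
      rw [Finset.sum_comm, Finset.sum_comm (s := balancedSet n)]
      refine Finset.sum_congr rfl fun k _ => ?_
      exact sum_goodSet_pair hF (fun x y => ((x : ℝ) - c) * ((y : ℝ) - c)) i k
    rw [h1]
    refine Finset.sum_eq_zero fun J hJ => ?_
    have : ∑ i, ((J i : ℕ) : ℝ) + 2 = n := by exact_mod_cast mem_balancedSet.1 hJ
    rw [this]
    simp
  have hsub : goodSet F ⊆ balancedSet n := by
    intro J hJ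
    have := (Finset.sum_eq_zero_iff_of_nonneg fun J _ => sq_nonneg _).1 hsum J hJ
    have h2 : ∑ i, ((J i : ℕ) : ℝ) + 2 = n := by
      have := pow_eq_zero_iff two_ne_zero |>.1 this
      linarith
    exact mem_balancedSet.2 (by exact_mod_cast h2)
  refine Finset.eq_of_subset_of_card_le hsub ?_
  have := sum_goodSet_eq_sum_balancedSet hF fun _ _ => 1
  simp only [Finset.sum_const, nsmul_eq_mul, mul_one] at this
  exact_mod_cast this.ge

theorem card_balancedSet (n : ℕ) : (balancedSet n).card = (dimTriples n).card := by
  -- These are the values of `dimTriple` for flags in general position.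
  refine Finset.card_bij (fun J _ => ⟨J 0 + J 1 + J 2 + 1, J 0 + J 1, J 0⟩) ?_ ?_ ?_
  · intro J hJ
    rw [mem_balancedSet, Fin.sum_univ_four] at hJ
    rw [mem_dimTriples]
    lia
  · intro J hJ J' hJ' he
    rw [mem_balancedSet, Fin.sum_univ_four] at hJ hJ'
    simp only [Sigma.mk.injEq, heq_eq_eq] at he
    refine natVal_injective (funext fun i => ?_)
    fin_cases i <;> simp <;> lia
  · rintro ⟨c, b, a⟩ h
    rw [mem_dimTriples] at h
    refine ⟨![⟨a, by lia⟩, ⟨b - a, by lia⟩, ⟨c - b - 1, by lia⟩, ⟨n - 1 - c, by lia⟩], ?_, ?_⟩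
    · rw [mem_balancedSet, Fin.sum_univ_four]
      simp
      lia
    · simp only [Matrix.cons_val, Sigma.mk.injEq, heq_eq_eq]
      lia

end moments

/-! ### The terms of `B_n` -/

theorem det₂_add_smul (a b : ℂ) (u v w : Fin 2 → ℂ) :
    det₂ (a • u + b • v) w = a * det₂ u w + b * det₂ v w := by
  simp only [det₂, Pi.add_apply, Pi.smul_apply, smul_eq_mul]
  ring

theorem det₂_ne_zero_iff {u v : Fin 2 → ℂ} :
    det₂ u v ≠ 0 ↔ ∀ a b : ℂ, a • u + b • v = 0 → a = 0 ∧ b = 0 := by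
  constructor
  · intro h a b hab
    have h1 := det₂_add_smul a b u v v
    have h2 := det₂_add_smul a b u v u
    rw [hab] at h1 h2
    simp only [det₂, Pi.zero_apply] at h1 h2 h
    constructor
    · refine (mul_eq_zero.1 ?_).resolve_right h
      linear_combination -h1
    · refine (mul_eq_zero.1 ?_).resolve_right h
      linear_combination h2
  · intro h h0
    have h1 := h (v 1) (-u 1) (by
      ext i
      fin_cases i
      · simp only [det₂] at h0
        simp
        linear_combination h0
      · simp
        ring)
    have h2 := h (v 0) (-u 0) (by
      ext i
      fin_cases i
      · simp
        ring
      · simp only [det₂] at h0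
        simp
        linear_combination -h0)
    have hv : v = 0 := by
      ext i
      fin_cases i
      exacts [h2.1, h1.1]
    exact one_ne_zero (h 0 1 (by simp [hv])).2

/-- Cramer's rule in the basis `w 1`, `w 2`. The cross-ratio becomes a linear relation, which can be
read modulo a subspace without choosing coordinates on the quotient. -/
theorem relation_of_pairing_eq {w : Fin 4 → Fin 2 → ℂ} (h12 : det₂ (w 1) (w 2) ≠ 0)
    (h13 : det₂ (w 1) (w 3) ≠ 0) {r : ℂ} (h : pairing₀₁ w = r * pairing₀₂ w) :
    w 0 = (det₂ (w 0) (w 2) / det₂ (w 1) (w 2)) • w 1 +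
        (-det₂ (w 0) (w 1) / det₂ (w 1) (w 2)) • w 2 ∧
      (-det₂ (w 0) (w 1) / det₂ (w 1) (w 3)) • w 3 =
        r • (det₂ (w 0) (w 2) / det₂ (w 1) (w 2)) • w 1 +
          (-det₂ (w 0) (w 1) / det₂ (w 1) (w 2)) • w 2 := by
  simp only [pairing₀₁, pairing₀₂] at h
  have cramer : ∀ j i, det₂ (w 1) (w 2) * w j i =
      det₂ (w 1) (w j) * w 2 i - det₂ (w 2) (w j) * w 1 i := by
    intro j i
    simp only [det₂]
    fin_cases i <;> simp <;> ring
  have anti : ∀ i j, det₂ (w i) (w j) = -det₂ (w j) (w i) := fun i j => by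
    simp only [det₂]
    ring
  constructor
  · ext i
    simp only [Pi.add_apply, Pi.smul_apply, smul_eq_mul]
    rw [anti 0 2, anti 0 1]
    field_simp
    linear_combination cramer 0 i
  · ext i
    simp only [Pi.add_apply, Pi.smul_apply, smul_eq_mul]
    field_simp
    linear_combination (-det₂ (w 0) (w 1)) * cramer 3 i + w 1 i * h

theorem pairing_eq_of_relation {w : Fin 4 → Fin 2 → ℂ} {a b c r : ℂ} (hc : c ≠ 0)
    (h0 : w 0 = a • w 1 + b • w 2) (h3 : c • w 3 = r • a • w 1 + b • w 2) :
    pairing₀₁ w = r * pairing₀₂ w := by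
  refine mul_left_cancel₀ hc ?_
  have e0 : ∀ i, w 0 i = a * w 1 i + b * w 2 i := fun i => by rw [h0]; simp
  have e3 : ∀ i, c * w 3 i = r * (a * w 1 i) + b * w 2 i := fun i => by simpa using congrFun h3 i
  have f0 := e3 0
  have f1 := e3 1
  simp only [pairing₀₁, pairing₀₂, det₂, e0]
  linear_combination ((a * w 1 0 + b * w 2 0) * w 1 1 -
      (a * w 1 1 + b * w 2 1) * w 1 0) * (w 2 0 * f1 - w 2 1 * f0) -
    r * ((a * w 1 0 + b * w 2 0) * w 2 1 -
      (a * w 1 1 + b * w 2 1) * w 2 0) * (w 1 0 * f1 - w 1 1 * f0)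

section configVolume

variable {V : Type} [AddCommGroup V] [Module ℂ V] [Module.Finite ℂ V] {v : Fin 4 → V}

theorem configVolume_le : configVolume V v ≤ maxSimplexVolume := by
  unfold configVolume
  split_ifs with h
  · exact signedVolume_le _
  · exact maxSimplexVolume_pos.le

theorem independent_of_configVolume_ne_zero (h : configVolume V v ≠ 0) :
    Module.finrank ℂ V = 2 ∧
      ∀ i k, i ≠ k → ∀ a b : ℂ, a • v i + b • v k = 0 → a = 0 ∧ b = 0 := by
  unfold configVolume at h
  split_ifs at h with hd
  · refine ⟨hd.1, fun i k hik a b hab => ?_⟩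
    have him := im_ne_zero_of_signedVolume_ne_zero _ h
    refine det₂_ne_zero_iff.1 (det₂_ne_zero_of_im_ne_zero him hik) a b ?_
    simp only [← map_smul, ← map_add, hab, map_zero]
  · exact absurd rfl h

theorem relation_of_configVolume_eq_max (h : configVolume V v = maxSimplexVolume) :
    ∃ a b c : ℂ, v 0 = a • v 1 + b • v 2 ∧ c • v 3 = regularRatio • a • v 1 + b • v 2 := by
  have h0 : configVolume V v ≠ 0 := h ▸ maxSimplexVolume_pos.ne'
  unfold configVolume at h h0
  split_ifs at h h0 with hd
  · obtain ⟨φ, hφ⟩ : ∃ φ, φ = (Module.finBasisOfFinrankEq ℂ V hd.1).equivFun := ⟨_, rfl⟩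
    simp only [← hφ] at h h0
    obtain ⟨-, hA⟩ := (signedVolume_eq_maxSimplexVolume_iff _).1 h
    have him := im_ne_zero_of_signedVolume_ne_zero _ h0
    have h12 : det₂ (φ (v 1)) (φ (v 2)) ≠ 0 := det₂_ne_zero_of_im_ne_zero him (by decide)
    have h13 : det₂ (φ (v 1)) (φ (v 3)) ≠ 0 := det₂_ne_zero_of_im_ne_zero him (by decide)
    obtain ⟨e1, e2⟩ := relation_of_pairing_eq (w := fun i => φ (v i)) h12 h13 hA
    refine ⟨det₂ (φ (v 0)) (φ (v 2)) / det₂ (φ (v 1)) (φ (v 2)),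
      -det₂ (φ (v 0)) (φ (v 1)) / det₂ (φ (v 1)) (φ (v 2)),
      -det₂ (φ (v 0)) (φ (v 1)) / det₂ (φ (v 1)) (φ (v 3)), φ.injective ?_, φ.injective ?_⟩
    · rw [map_add, map_smul, map_smul]
      exact e1
    · rw [map_add, map_smul, map_smul, map_smul, map_smul]
      exact e2
  · exact absurd rfl h0

theorem configVolume_eq_max {a b c : ℂ} (hd : Module.finrank ℂ V = 2)
    (hi : ∀ i k, i ≠ k → ∀ a b : ℂ, a • v i + b • v k = 0 → a = 0 ∧ b = 0)
    (h0 : v 0 = a • v 1 + b • v 2) (h3 : c • v 3 = regularRatio • a • v 1 + b • v 2) :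
    configVolume V v = maxSimplexVolume := by
  have hne : ∀ i, v i ≠ 0 := fun i h => by
    obtain ⟨k, hk⟩ : ∃ k : Fin 4, i ≠ k := ⟨i + 1, by fin_cases i <;> decide⟩
    exact one_ne_zero (hi i k hk 1 0 (by simp [h])).1
  have hc : c ≠ 0 := by
    rintro rfl
    rw [zero_smul, smul_smul] at h3
    have hb := (hi 1 2 (by decide) _ _ h3.symm).2
    rw [hb, zero_smul, add_zero] at h0
    exact one_ne_zero (hi 0 1 (by decide) 1 (-a) (by rw [h0]; simp)).1
  unfold configVolume
  rw [dif_pos ⟨hd, hne⟩]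
  obtain ⟨φ, hφ⟩ : ∃ φ, φ = (Module.finBasisOfFinrankEq ℂ V hd).equivFun := ⟨_, rfl⟩
  simp only [← hφ]
  have hdet : ∀ i k, i ≠ k → det₂ (φ (v i)) (φ (v k)) ≠ 0 := fun i k hik =>
    det₂_ne_zero_iff.2 fun a b hab => hi i k hik a b (φ.injective (by simpa using hab))
  rw [signedVolume_eq_maxSimplexVolume_iff]
  refine ⟨mul_ne_zero (hdet _ _ (by decide)) (hdet _ _ (by decide)),
    pairing_eq_of_relation (a := a) (b := b) hc ?_ ?_⟩
  · rw [h0, map_add, map_smul, map_smul]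
  · rw [← map_smul, h3, map_add, map_smul, map_smul, map_smul]

end configVolume

/-! ### Configurations in a quotient of nested subspaces -/

section subquotient

variable {M : Type} [AddCommGroup M] [Module ℂ M] {D U : Submodule ℂ M} {x : Fin 4 → M}
  {hx : ∀ i, x i ∈ U}

theorem finrank_subquotient [Module.Finite ℂ M] (hDU : D ≤ U) :
    Module.finrank ℂ (↥U ⧸ D.submoduleOf U) + Module.finrank ℂ D = Module.finrank ℂ U := by
  rw [← (Submodule.submoduleOfEquivOfLe hDU).finrank_eq]
  exact Submodule.finrank_quotient_add_finrank _

theorem mk_eq_zero_subquotient {y : M} {hy : y ∈ U} :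
    (Submodule.Quotient.mk ⟨y, hy⟩ : ↥U ⧸ D.submoduleOf U) = 0 ↔ y ∈ D := by
  rw [Submodule.Quotient.mk_eq_zero]
  rfl

theorem smul_add_smul_eq_zero_subquotient {i k : Fin 4} {a b : ℂ} :
    a • (Submodule.Quotient.mk ⟨x i, hx i⟩ : ↥U ⧸ D.submoduleOf U) +
      b • Submodule.Quotient.mk ⟨x k, hx k⟩ = 0 ↔ a • x i + b • x k ∈ D :=
  mk_eq_zero_subquotient (hy := add_mem (U.smul_mem a (hx i)) (U.smul_mem b (hx k)))

variable [Module.Finite ℂ M]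

theorem independent_of_subquotient_configVolume_ne_zero (hDU : D ≤ U)
    (h : configVolume (↥U ⧸ D.submoduleOf U) (fun i => Submodule.Quotient.mk ⟨x i, hx i⟩) ≠ 0) :
    Module.finrank ℂ U = Module.finrank ℂ D + 2 ∧
      ∀ i k, i ≠ k → ∀ a b : ℂ, a • x i + b • x k ∈ D → a = 0 ∧ b = 0 := by
  obtain ⟨h1, h2⟩ := independent_of_configVolume_ne_zero h
  have := finrank_subquotient hDU
  exact ⟨by lia, fun i k hik a b hab =>
    h2 i k hik a b (smul_add_smul_eq_zero_subquotient.2 hab)⟩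

theorem relation_of_subquotient_configVolume_eq_max
    (h : configVolume (↥U ⧸ D.submoduleOf U) (fun i => Submodule.Quotient.mk ⟨x i, hx i⟩) =
      maxSimplexVolume) :
    ∃ a b c : ℂ, x 0 - (a • x 1 + b • x 2) ∈ D ∧
      c • x 3 - (regularRatio • a • x 1 + b • x 2) ∈ D := by
  obtain ⟨a, b, c, h0, h3⟩ := relation_of_configVolume_eq_max h
  exact ⟨a, b, c, (Submodule.Quotient.eq (D.submoduleOf U)).1 h0,
    (Submodule.Quotient.eq (D.submoduleOf U)).1 h3⟩

theorem subquotient_configVolume_eq_max {a b c : ℂ} (hDU : D ≤ U)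
    (hd : Module.finrank ℂ U = Module.finrank ℂ D + 2)
    (hi : ∀ i k, i ≠ k → ∀ a b : ℂ, a • x i + b • x k ∈ D → a = 0 ∧ b = 0)
    (h0 : x 0 - (a • x 1 + b • x 2) ∈ D)
    (h3 : c • x 3 - (regularRatio • a • x 1 + b • x 2) ∈ D) :
    configVolume (↥U ⧸ D.submoduleOf U) (fun i => Submodule.Quotient.mk ⟨x i, hx i⟩) =
      maxSimplexVolume := by
  refine configVolume_eq_max (a := a) (b := b) (c := c) ?_ ?_ ?_ ?_
  · have := finrank_subquotient hDU
    lia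
  · exact fun i k hik a b hab => hi i k hik a b (smul_add_smul_eq_zero_subquotient.1 hab)
  · exact (Submodule.Quotient.eq (D.submoduleOf U)).2 h0
  · exact (Submodule.Quotient.eq (D.submoduleOf U)).2 h3

end subquotient

section flagTerm

variable {n : ℕ}

/-- There are vectors of the four flags at `J` whose classes modulo the span at `J` satisfy the
relations of four points with cross-ratio `r`. -/
def HasRatioAt (F : Fin 4 → CompleteFlag n) (r : ℂ) (J : Fin 4 → ℕ) : Prop :=
  ∃ u : Fin 4 → Fin n → ℂ, (∀ i, u i ∈ (F i).sp (J i + 1)) ∧ u 0 ∉ flagSpan F J ∧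
    u 3 ∉ flagSpan F J ∧ u 0 - (u 1 + u 2) ∈ flagSpan F J ∧
    u 3 - (r • u 1 + u 2) ∈ flagSpan F J

theorem IsGood.independent {F : Fin 4 → CompleteFlag n} {J : Fin 4 → ℕ} (h : IsGood F J)
    {x : Fin 4 → Fin n → ℂ}
    (hx : ∀ i, (F i).sp (J i + 1) = Submodule.span ℂ {x i} ⊔ (F i).sp (J i)) {i k : Fin 4}
    (hik : i ≠ k) {a b : ℂ} (hab : a • x i + b • x k ∈ flagSpan F J) : a = 0 ∧ b = 0 := by
  have key : ∀ i k, i ≠ k → ∀ a b : ℂ, a • x i + b • x k ∈ flagSpan F J → b = 0 := by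
    intro i k hik a b hab
    by_contra hb
    refine h.not_sp_le (i := k) (k := i) hik.symm le_rfl ?_
    have hxi : x i ∈ flagSpan F (J + Pi.single i 1) :=
      sp_le_flagSpan (J := J + Pi.single i 1) (i := i) (k := J i + 1) (by simp) (hx i ▸
        Submodule.mem_sup_left (Submodule.mem_span_singleton_self _))
    have hle : flagSpan F J ≤ flagSpan F (J + Pi.single i 1) := flagSpan_mono (by simp)
    rw [hx k]
    refine sup_le ((Submodule.span_singleton_le_iff_mem _ _).2 ?_)
      ((sp_le_flagSpan le_rfl).trans hle)
    have h1 : x k = b⁻¹ • ((a • x i + b • x k) - a • x i) := by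
      rw [add_sub_cancel_left, inv_smul_smul₀ hb]
    rw [h1]
    exact Submodule.smul_mem _ _ (sub_mem (hle hab) (Submodule.smul_mem _ _ hxi))
  exact ⟨key k i hik.symm b a (by rwa [add_comm]), key i k hik a b hab⟩

theorem isGood_of_independent {F : Fin 4 → CompleteFlag n} {J : Fin 4 → ℕ}
    {x : Fin 4 → Fin n → ℂ}
    (hx : ∀ i, (F i).sp (J i + 1) = Submodule.span ℂ {x i} ⊔ (F i).sp (J i))
    (hd : Module.finrank ℂ (flagSpan F (J + 1)) = Module.finrank ℂ (flagSpan F J) + 2)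
    (hi : ∀ i k, i ≠ k → ∀ a b : ℂ, a • x i + b • x k ∈ flagSpan F J → a = 0 ∧ b = 0) :
    IsGood F J := by
  refine ⟨hd, fun i k hik => Submodule.eq_of_le_of_finrank_le (flagSpan_mono fun m => ?_) ?_⟩
  · by_cases hm : m = i
    · subst hm
      simp [Pi.single_eq_of_ne hik]
    · by_cases hm' : m = k
      · subst hm'
        simp [Pi.single_eq_of_ne hm]
      · simp [Pi.single_eq_of_ne hm, Pi.single_eq_of_ne hm']
  · have hxm : ∀ i, x i ∈ (F i).sp (J i + 1) := fun i =>
      hx i ▸ Submodule.mem_sup_left (Submodule.mem_span_singleton_self _)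
    have hspan : flagSpan F (J + Pi.single i 1) = flagSpan F J ⊔ Submodule.span ℂ {x i} := by
      rw [flagSpan_add_single, hx, sup_comm (Submodule.span ℂ _), ← sup_assoc,
        sup_eq_left.2 (sp_le_flagSpan le_rfl)]
    have h1 : flagSpan F J < flagSpan F (J + Pi.single i 1) := by
      refine lt_of_le_of_ne (flagSpan_mono (by simp)) fun he => ?_
      have : x i ∈ flagSpan F J := by
        rw [he]
        exact sp_le_flagSpan (by simp) (hxm i)
      exact one_ne_zero (hi i k hik 1 0 (by simpa using this)).1
    have h2 : flagSpan F (J + Pi.single i 1) < flagSpan F (J + Pi.single i 1 + Pi.single k 1) := by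
      refine lt_of_le_of_ne (flagSpan_mono (by simp)) fun he => ?_
      have : x k ∈ flagSpan F (J + Pi.single i 1) := by
        rw [he]
        exact sp_le_flagSpan (by simp) (hxm k)
      rw [hspan] at this
      obtain ⟨d, hd, y, hy, e⟩ := Submodule.mem_sup.1 this
      obtain ⟨c, rfl⟩ := Submodule.mem_span_singleton.1 hy
      refine one_ne_zero (hi i k hik (-c) 1 ?_).2
      rw [← e]
      simpa using hd
    have h3 := Submodule.finrank_lt_finrank_of_lt h1
    have h4 := Submodule.finrank_lt_finrank_of_lt h2
    lia

/-- The term of `B_n` at `J`. -/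
noncomputable def flagTerm (A : Fin 4 → AffineFlag n) (J : Fin 4 → Fin n) : ℝ :=
  configVolume (FlagQuotient (fun i => (A i).flag) J) fun i =>
    Submodule.Quotient.mk
      ⟨(A i).vec (J i), Submodule.mem_iSup_of_mem i ((A i).vec_mem (J i))⟩

variable {A : Fin 4 → AffineFlag n} {J : Fin 4 → Fin n}

theorem flagTerm_le : flagTerm A J ≤ maxSimplexVolume := configVolume_le

theorem iSup_space_castSucc :
    ⨆ i, (A i).flag.space (J i).castSucc = flagSpan (fun i => (A i).flag) fun i => J i := by
  simp only [flagSpan, ← CompleteFlag.sp_val, Fin.val_castSucc]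

theorem iSup_space_succ :
    ⨆ i, (A i).flag.space (J i).succ = flagSpan (fun i => (A i).flag) ((fun i => (J i : ℕ)) + 1) := by
  simp only [flagSpan, ← CompleteFlag.sp_val, Fin.val_succ, Pi.add_apply, Pi.one_apply]

theorem AffineFlag.sp_succ (B : AffineFlag n) (j : Fin n) :
    B.flag.sp (j + 1) = Submodule.span ℂ {B.vec j} ⊔ B.flag.sp j := by
  simpa [← CompleteFlag.sp_val] using B.space_succ j

theorem iSup_space_le :
    ⨆ i, (A i).flag.space (J i).castSucc ≤ ⨆ i, (A i).flag.space (J i).succ :=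
  iSup_mono fun i => (A i).flag.mono (J i).castSucc_lt_succ.le

theorem isGood_of_flagTerm_ne_zero (h : flagTerm A J ≠ 0) :
    IsGood (fun i => (A i).flag) fun i => J i := by
  obtain ⟨h1, h2⟩ := independent_of_subquotient_configVolume_ne_zero iSup_space_le h
  rw [iSup_space_castSucc, iSup_space_succ] at h1
  rw [iSup_space_castSucc] at h2
  exact isGood_of_independent (x := fun i => (A i).vec (J i)) (fun i => (A i).sp_succ (J i)) h1 h2

theorem hasRatioAt_of_flagTerm_eq (h : flagTerm A J = maxSimplexVolume) :
    HasRatioAt (fun i => (A i).flag) regularRatio fun i => J i := by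
  obtain ⟨-, hi⟩ := independent_of_subquotient_configVolume_ne_zero iSup_space_le
    (h ▸ maxSimplexVolume_pos.ne' : flagTerm A J ≠ 0)
  obtain ⟨a, b, c, h0, h3⟩ := relation_of_subquotient_configVolume_eq_max h
  rw [iSup_space_castSucc] at hi h0 h3
  have hm : ∀ i, (A i).vec (J i) ∈ (A i).flag.sp (J i + 1) := fun i =>
    (A i).sp_succ (J i) ▸ Submodule.mem_sup_left (Submodule.mem_span_singleton_self _)
  have hn : ∀ i, (A i).vec (J i) ∉ flagSpan (fun i => (A i).flag) fun i => J i := fun i hi' => by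
    obtain ⟨k, hk⟩ : ∃ k : Fin 4, i ≠ k := ⟨i + 1, by fin_cases i <;> decide⟩
    exact one_ne_zero (hi i k hk 1 0 (by simpa using hi')).1
  -- The coefficients are absorbed into the vectors, so that only the ratio remains in the
  -- relations.
  refine ⟨![(A 0).vec (J 0), a • (A 1).vec (J 1), b • (A 2).vec (J 2), c • (A 3).vec (J 3)],
    ?_, hn 0, ?_, h0, h3⟩
  · intro i
    fin_cases i
    exacts [hm 0, Submodule.smul_mem _ _ (hm 1), Submodule.smul_mem _ _ (hm 2),
      Submodule.smul_mem _ _ (hm 3)]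
  · intro hc
    have h4 : (regularRatio * a) • (A 1).vec (J 1) + b • (A 2).vec (J 2) ∈
        flagSpan (fun i => (A i).flag) fun i => J i := by
      rw [mul_smul]
      simpa using sub_mem hc h3
    obtain ⟨ha, hb⟩ := hi 1 2 (by decide) _ _ h4
    have ha' := (mul_eq_zero.1 ha).resolve_left regularRatio_ne_zero
    subst ha' hb
    exact hn 0 (by simpa using h0)

theorem flagTerm_eq (hg : IsGood (fun i => (A i).flag) fun i => J i)
    (h : HasRatioAt (fun i => (A i).flag) regularRatio fun i => J i) :
    flagTerm A J = maxSimplexVolume := by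
  obtain ⟨u, hu, hu0, -, h1, h2⟩ := h
  have key : ∀ i, ∃ c : ℂ, u i - c • (A i).vec (J i) ∈
      flagSpan (fun i => (A i).flag) fun i => J i := fun i => by
    have := hu i
    rw [(A i).sp_succ] at this
    obtain ⟨y, hy, d, hd, e⟩ := Submodule.mem_sup.1 this
    obtain ⟨c, rfl⟩ := Submodule.mem_span_singleton.1 hy
    refine ⟨c, ?_⟩
    rw [← e, add_sub_cancel_left]
    exact sp_le_flagSpan (F := fun i => (A i).flag) (J := fun i => J i) le_rfl hd
  choose c hc using key
  have hc0 : c 0 ≠ 0 := by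
    intro h0
    have := hc 0
    rw [h0] at this
    exact hu0 (by simpa using this)
  have e0 : (A 0).vec (J 0) - ((c 1 / c 0) • (A 1).vec (J 1) + (c 2 / c 0) • (A 2).vec (J 2)) ∈
      flagSpan (fun i => (A i).flag) fun i => J i := by
    have : (A 0).vec (J 0) - ((c 1 / c 0) • (A 1).vec (J 1) + (c 2 / c 0) • (A 2).vec (J 2)) =
        (c 0)⁻¹ • ((u 0 - (u 1 + u 2)) - (u 0 - c 0 • (A 0).vec (J 0)) +
          (u 1 - c 1 • (A 1).vec (J 1)) + (u 2 - c 2 • (A 2).vec (J 2))) := by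
      ext m
      simp
      field_simp
      ring
    rw [this]
    exact Submodule.smul_mem _ _ (add_mem (add_mem (sub_mem h1 (hc 0)) (hc 1)) (hc 2))
  have e3 : (c 3 / c 0) • (A 3).vec (J 3) -
      (regularRatio • (c 1 / c 0) • (A 1).vec (J 1) + (c 2 / c 0) • (A 2).vec (J 2)) ∈
      flagSpan (fun i => (A i).flag) fun i => J i := by
    have : (c 3 / c 0) • (A 3).vec (J 3) -
        (regularRatio • (c 1 / c 0) • (A 1).vec (J 1) + (c 2 / c 0) • (A 2).vec (J 2)) =
        (c 0)⁻¹ • ((u 3 - (regularRatio • u 1 + u 2)) - (u 3 - c 3 • (A 3).vec (J 3)) +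
          regularRatio • (u 1 - c 1 • (A 1).vec (J 1)) + (u 2 - c 2 • (A 2).vec (J 2))) := by
      ext m
      simp
      field_simp
      ring
    rw [this]
    exact Submodule.smul_mem _ _ (add_mem (add_mem (sub_mem h2 (hc 3))
      (Submodule.smul_mem _ _ (hc 1))) (hc 2))
  refine subquotient_configVolume_eq_max (x := fun i => (A i).vec (J i)) iSup_space_le ?_ ?_
    (a := c 1 / c 0) (b := c 2 / c 0) (c := c 3 / c 0) ?_ ?_
  · rw [iSup_space_castSucc, iSup_space_succ, hg.1]
  · rw [iSup_space_castSucc]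
    exact fun i k hik a b hab => hg.independent (x := fun i => (A i).vec (J i))
      (fun i => (A i).sp_succ (J i)) hik hab
  · rw [iSup_space_castSucc]
    exact e0
  · rw [iSup_space_castSucc]
    exact e3

theorem exists_flagB_eq_sum (F : Fin 4 → CompleteFlag n) :
    ∃ A : Fin 4 → AffineFlag n, (fun i => (A i).flag) = F ∧ flagB n F = ∑ J, flagTerm A J := by
  choose A hA using fun i => (F i).exists_affineFlag
  obtain rfl : (fun i => (A i).flag) = F := funext hA
  exact ⟨A, rfl, flagB_flag n A⟩

theorem flagB_eq_of_isGood {F : Fin 4 → CompleteFlag n} (hF : goodSet F = balancedSet n)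
    (h : ∀ J ∈ balancedSet n, HasRatioAt F regularRatio fun i => J i) :
    flagB n F = (n : ℝ) * ((n : ℝ) ^ 2 - 1) / 6 * maxSimplexVolume := by
  obtain ⟨A, rfl, hA⟩ := exists_flagB_eq_sum F
  rw [hA, ← Finset.sum_subset (Finset.subset_univ (balancedSet n)), Finset.sum_congr rfl
    fun J hJ => flagTerm_eq (mem_goodSet.1 (hF ▸ hJ)) (h J hJ), Finset.sum_const, nsmul_eq_mul,
    card_balancedSet, card_dimTriples]
  intro J _ hJ
  by_contra hne
  exact hJ (hF ▸ mem_goodSet.2 (isGood_of_flagTerm_ne_zero hne))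

/-- Only good terms can be nonzero, each is at most v₃, and there are at most n(n²-1)/6 of them.
Equality for the sum forces equality in the count and in every term. -/
theorem card_goodSet_of_flagB_eq {F : Fin 4 → CompleteFlag n}
    (h : flagB n F = (n : ℝ) * ((n : ℝ) ^ 2 - 1) / 6 * maxSimplexVolume) :
    (goodSet F).card = (dimTriples n).card ∧
      ∀ J ∈ balancedSet n, HasRatioAt F regularRatio fun i => J i := by
  obtain ⟨A, rfl, hA⟩ := exists_flagB_eq_sum F
  have hv := maxSimplexVolume_pos
  rw [hA, ← card_dimTriples, ← Finset.sum_subset (Finset.subset_univ (goodSet _))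
    (fun J _ hJ => by
      by_contra hne
      exact hJ (mem_goodSet.2 (isGood_of_flagTerm_ne_zero hne)))] at h
  have h1 : (goodSet fun i => (A i).flag).card = (dimTriples n).card := by
    refine le_antisymm card_goodSet_le ?_
    have h2 := Finset.sum_le_card_nsmul (goodSet fun i => (A i).flag) (flagTerm A) _
      fun J _ => flagTerm_le
    rw [h, nsmul_eq_mul] at h2
    exact_mod_cast le_of_mul_le_mul_right h2 hv
  refine ⟨h1, fun J hJ => hasRatioAt_of_flagTerm_eq ?_⟩
  rw [← goodSet_eq_balancedSet h1] at hJ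
  refine (Finset.sum_eq_sum_iff_of_le (f := flagTerm A) (g := fun _ => maxSimplexVolume)
    fun J _ => flagTerm_le).1 ?_ J hJ
  rw [h, Finset.sum_const, nsmul_eq_mul, h1]

end flagTerm

/-! ### Rigidity of extremal quadruples -/

section extremal

variable {n : ℕ}

/-- At all balanced indices the four flags define four lines with cross-ratio `r` in a plane. -/
structure IsExtremal (F : Fin 4 → CompleteFlag n) (r : ℂ) : Prop where
  isGood : ∀ J : Fin 4 → ℕ, ∑ i, J i + 2 = n → IsGood F J
  hasRatioAt : ∀ J : Fin 4 → ℕ, ∑ i, J i + 2 = n → HasRatioAt F r J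

theorem exists_fin_of_sum_add_two_eq {J : Fin 4 → ℕ} (h : ∑ i, J i + 2 = n) :
    ∃ J' ∈ balancedSet n, J = fun i => (J' i : ℕ) := by
  have hlt : ∀ i, J i < n := fun i => by
    have := Finset.single_le_sum (f := J) (fun _ _ => Nat.zero_le _) (Finset.mem_univ i)
    lia
  exact ⟨fun i => ⟨J i, hlt i⟩, mem_balancedSet.2 h, rfl⟩

theorem flagB_eq_iff_isExtremal {F : Fin 4 → CompleteFlag n} :
    flagB n F = (n : ℝ) * ((n : ℝ) ^ 2 - 1) / 6 * maxSimplexVolume ↔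
      IsExtremal F regularRatio := by
  constructor
  · intro h
    obtain ⟨h1, h2⟩ := card_goodSet_of_flagB_eq h
    constructor
    · intro J hJ
      obtain ⟨J', hJ', rfl⟩ := exists_fin_of_sum_add_two_eq hJ
      rw [← goodSet_eq_balancedSet h1] at hJ'
      exact mem_goodSet.1 hJ'
    · intro J hJ
      obtain ⟨J', hJ', rfl⟩ := exists_fin_of_sum_add_two_eq hJ
      exact h2 J' hJ'
  · intro h
    refine flagB_eq_of_isGood (Finset.eq_of_subset_of_card_le (fun J hJ => ?_) ?_).symm ?_
    · exact mem_goodSet.2 (h.isGood _ (mem_balancedSet.1 hJ))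
    · rw [card_balancedSet]
      exact card_goodSet_le
    · exact fun J hJ => h.hasRatioAt _ (mem_balancedSet.1 hJ)

variable {F F' : Fin 4 → CompleteFlag n} {r : ℂ}

theorem IsExtremal.card_goodSet (h : IsExtremal F r) : (goodSet F).card = (dimTriples n).card := by
  refine le_antisymm card_goodSet_le ?_
  rw [← card_balancedSet]
  exact Finset.card_le_card fun J hJ => mem_goodSet.2 (h.isGood _ (mem_balancedSet.1 hJ))

/-- Any three of the flags are in general position: relabelling moves the omitted one to the last
place. -/
theorem IsExtremal.finrank_flagSpan (h : IsExtremal F r) {J : Fin 4 → ℕ} {i : Fin 4}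
    (hi : J i = 0) : Module.finrank ℂ (flagSpan F J) = min (∑ i, J i) n := by
  have h1 : (fun k => J (Equiv.swap i 3 k)) =
      ![J (Equiv.swap i 3 0), J (Equiv.swap i 3 1), J (Equiv.swap i 3 2), 0] := by
    funext k
    fin_cases k <;> simp [hi]
  have h2 := finrank_flagSpan_triple (F := fun k => F (Equiv.swap i 3 k))
    (by rw [card_goodSet_comp, h.card_goodSet]) (J (Equiv.swap i 3 0)) (J (Equiv.swap i 3 1))
    (J (Equiv.swap i 3 2))
  rw [← h1, flagSpan_comp] at h2
  rw [h2, ← Equiv.sum_comp (Equiv.swap i 3) J, Fin.sum_univ_four]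
  simp [hi]

theorem IsExtremal.swap (h : IsExtremal F r) (hr : r ≠ 0) :
    IsExtremal (fun i => F (Equiv.swap 0 3 i)) r⁻¹ := by
  have key : ∀ J : Fin 4 → ℕ, ∑ i, J i + 2 = n → ∃ J' : Fin 4 → ℕ, ∑ i, J' i + 2 = n ∧
      J = fun i => J' (Equiv.swap 0 3 i) := fun J hJ =>
    ⟨fun i => J (Equiv.swap 0 3 i), by rwa [Equiv.sum_comp], by funext i; simp⟩
  constructor
  · intro J hJ
    obtain ⟨J, hJ', rfl⟩ := key J hJ
    exact (h.isGood J hJ').comp _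
  · intro J hJ
    obtain ⟨J, hJ', rfl⟩ := key J hJ
    obtain ⟨u, hu, h0, h3, e0, e3⟩ := h.hasRatioAt J hJ'
    rw [HasRatioAt, flagSpan_comp (F := F) (J := J)]
    -- With these vectors the two relations are exchanged and `r` becomes its inverse.
    refine ⟨![u 3, r • u 1, u 2, u 0], ?_, h3, h0, e3, ?_⟩
    · intro i
      fin_cases i
      exacts [hu 3, Submodule.smul_mem _ _ (hu 1), hu 2, hu 0]
    · simpa [inv_smul_smul₀ hr] using e0

/-- Consecutive spaces differ by a line, so one new vector decides the inclusion. -/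
theorem CompleteFlag.sp_succ_le {G : CompleteFlag n} {j : ℕ} {W : Submodule ℂ (Fin n → ℂ)}
    {y : Fin n → ℂ} (hW : G.sp j ≤ W) (hy : y ∈ G.sp (j + 1)) (hy' : y ∉ G.sp j) (hyW : y ∈ W) :
    G.sp (j + 1) ≤ W := by
  obtain ⟨x, hx⟩ := G.exists_sp_succ j
  rw [hx] at hy ⊢
  obtain ⟨z, hz, d, hd, rfl⟩ := Submodule.mem_sup.1 hy
  obtain ⟨c, rfl⟩ := Submodule.mem_span_singleton.1 hz
  have hc : c ≠ 0 := by
    rintro rfl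
    exact hy' (by simpa using hd)
  refine sup_le ((Submodule.span_singleton_le_iff_mem _ _).2 ?_) hW
  have := W.smul_mem c⁻¹ (sub_mem hyW (hW hd))
  rwa [add_sub_cancel_right, inv_smul_smul₀ hc] at this

theorem IsGood.mem_of_add_mem {J : Fin 4 → ℕ} (h : IsGood F J) {i k : Fin 4} (hik : i ≠ k)
    {y z : Fin n → ℂ} (hy : y ∈ (F i).sp (J i + 1)) (hz : z ∈ (F k).sp (J k + 1))
    (hyz : y + z ∈ flagSpan F J) : y ∈ flagSpan F J := by
  by_contra hy'
  refine h.not_sp_le hik le_rfl (CompleteFlag.sp_succ_le ?_ hy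
    (fun h' => hy' (sp_le_flagSpan le_rfl h')) ?_)
  · exact (sp_le_flagSpan le_rfl).trans (flagSpan_mono (by simp))
  · rw [← add_sub_cancel_right y z]
    exact sub_mem (flagSpan_mono (by simp) hyz) (sp_le_flagSpan (by simp) hz)

/-- The N + 1 hyperplanes `F₁^m + F₂^{N-m} + F₃^{k+1}` intersect in `F₃^{k+1}` only. Descending in
m, each of them lowers the F₁-part of `x` by one dimension, because a hyperplane containing
`F₁^{m+1}` as well would have dimension n by general position. -/
theorem IsExtremal.iInf_flagSpan_le (h : IsExtremal F r) {k N : ℕ} (hN : N + k + 2 = n)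
    {x : Fin n → ℂ} (hx : ∀ m ≤ N, x ∈ flagSpan F ![0, m, N - m, k + 1]) :
    x ∈ (F 3).sp (k + 1) := by
  have key : ∀ d ≤ N, x ∈ (F 1).sp (N - d) ⊔ (F 3).sp (k + 1) := by
    intro d
    induction d with
    | zero =>
      intro _
      have := hx N le_rfl
      refine (flagSpan_le fun i => ?_ : flagSpan F ![0, N, N - N, k + 1] ≤ _) this
      fin_cases i
      · simp [CompleteFlag.sp_zero]
      · exact le_sup_left
      · simp [CompleteFlag.sp_zero]
      · exact le_sup_right
    | succ d ih =>
      intro hd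
      obtain ⟨m, hm⟩ : ∃ m, m + (d + 1) = N := ⟨N - (d + 1), by lia⟩
      have h1 := ih (by lia)
      rw [show N - d = m + 1 by lia] at h1
      rw [show N - (d + 1) = m by lia]
      have h2 := hx m (by lia)
      obtain ⟨a, ha, c, hc, rfl⟩ := Submodule.mem_sup.1 h1
      refine add_mem (Submodule.mem_sup_left ?_) (Submodule.mem_sup_right hc)
      by_contra ha'
      have h3 : (F 1).sp (m + 1) ≤ flagSpan F ![0, m, N - m, k + 1] := by
        refine CompleteFlag.sp_succ_le (sp_le_flagSpan (i := 1) le_rfl) ha ha' ?_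
        rw [← add_sub_cancel_right a c]
        exact sub_mem h2 (sp_le_flagSpan (i := 3) le_rfl hc)
      have h4 : flagSpan F ![0, m + 1, N - m, k + 1] ≤ flagSpan F ![0, m, N - m, k + 1] :=
        flagSpan_le fun i => by
          fin_cases i
          · exact sp_le_flagSpan (i := 0) le_rfl
          · exact h3
          · exact sp_le_flagSpan (i := 2) le_rfl
          · exact sp_le_flagSpan (i := 3) le_rfl
      have h5 := Submodule.finrank_mono h4
      rw [h.finrank_flagSpan (i := 0) rfl, h.finrank_flagSpan (i := 0) rfl] at h5
      simp [Fin.sum_univ_four] at h5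
      lia
  simpa [CompleteFlag.sp_zero] using key N le_rfl

theorem CompleteFlag.exists_smul_eq {G : CompleteFlag n} {x y : Fin n → ℂ} (hx : x ∈ G.sp 1)
    (hy : y ∈ G.sp 1) (hx0 : x ≠ 0) : ∃ t : ℂ, y = t • x := by
  have hle := G.sp_succ_le (j := 0) (W := Submodule.span ℂ {x}) (by simp [G.sp_zero]) hx
    (by simpa [G.sp_zero] using hx0) (Submodule.mem_span_singleton_self x)
  obtain ⟨t, ht⟩ := Submodule.mem_span_singleton.1 (hle hy)
  exact ⟨t, ht.symm⟩

/-- At the index `(0, m, l, k)` both quadruples have the same quotient plane and the same lines of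
F₀, F₁, F₂. The cross-ratio then fixes the fourth line, hence the next space of F₃ modulo the span.
-/
theorem IsExtremal.sp_three_succ_le (h : IsExtremal F r) (h' : IsExtremal F' r) (h1 : F 1 = F' 1)
    (h2 : F 2 = F' 2) (h0 : (F 0).sp 1 = (F' 0).sp 1) {k m l : ℕ} (hN : m + l + k + 2 = n)
    (hk : (F 3).sp k = (F' 3).sp k) : (F' 3).sp (k + 1) ≤ flagSpan F ![0, m, l, k + 1] := by
  have hsum : ∑ i, ![0, m, l, k] i + 2 = n := by
    simp [Fin.sum_univ_four]
    lia
  have hD : flagSpan F' ![0, m, l, k] = flagSpan F ![0, m, l, k] := by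
    refine iSup_congr fun i => ?_
    fin_cases i
    · simp [CompleteFlag.sp_zero]
    · simp [h1]
    · simp [h2]
    · exact hk.symm
  have hg := h.isGood _ hsum
  obtain ⟨u, hu, hu0, hu3, e0, e3⟩ := h.hasRatioAt _ hsum
  obtain ⟨u', hu', hu0', hu3', e0', e3'⟩ := h'.hasRatioAt _ hsum
  rw [hD] at hu0' hu3' e0' e3'
  have hle : flagSpan F ![0, m, l, k] ≤ flagSpan F ![0, m, l, k + 1] :=
    flagSpan_mono (by simp [vec_le_iff])
  -- Because F₀ enters with dimension 0, its next space is the common line, and the two choices of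
  -- `u 0` are proportional.
  obtain ⟨t, ht⟩ := CompleteFlag.exists_smul_eq (G := F 0) (x := u 0) (y := u' 0) (hu 0)
    (h0 ▸ hu' 0) (fun h => hu0 (h ▸ zero_mem _))
  have a1 : t • u 1 - u' 1 ∈ (F 1).sp (m + 1) :=
    sub_mem (Submodule.smul_mem _ _ (hu 1)) (h1 ▸ hu' 1)
  have a2 : t • u 2 - u' 2 ∈ (F 2).sp (l + 1) :=
    sub_mem (Submodule.smul_mem _ _ (hu 2)) (h2 ▸ hu' 2)
  have a3 : (t • u 1 - u' 1) + (t • u 2 - u' 2) ∈ flagSpan F ![0, m, l, k] := by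
    have := sub_mem e0' (Submodule.smul_mem _ t e0)
    rw [ht] at this
    convert this using 1
    module
  -- The lines of F₁ and F₂ are independent in the plane, so `u' 0 = t • u 0` forces the same
  -- proportionality on both components.
  have b1 := hg.mem_of_add_mem (i := 1) (k := 2) (by decide) a1 a2 a3
  have b2 := hg.mem_of_add_mem (i := 2) (k := 1) (by decide) a2 a1 (by rwa [add_comm])
  have b3 : u' 3 ∈ flagSpan F ![0, m, l, k + 1] := by
    have c1 : t • u 3 ∈ flagSpan F ![0, m, l, k + 1] :=
      Submodule.smul_mem _ _ (sp_le_flagSpan (i := 3) le_rfl (hu 3))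
    have c2 := add_mem (sub_mem e3' (Submodule.smul_mem _ t e3))
      (neg_mem (add_mem (Submodule.smul_mem _ r b1) b2))
    have := add_mem (hle c2) c1
    convert this using 1
    module
  refine CompleteFlag.sp_succ_le ?_ (hu' 3) (fun hn => ?_) b3
  · rw [← hk]
    exact sp_le_flagSpan (i := 3) (by simp)
  · rw [← hk] at hn
    exact hu3' (sp_le_flagSpan (i := 3) le_rfl hn)

/-- Induction on the dimension: once `F₃^k` is common, the next space of `F' 3` lies in all the
hyperplanes above, whose intersection is the next space of `F 3`. -/
theorem IsExtremal.flag_three_eq (h : IsExtremal F r) (h' : IsExtremal F' r) (h1 : F 1 = F' 1)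
    (h2 : F 2 = F' 2) (h0 : (F 0).sp 1 = (F' 0).sp 1) : F 3 = F' 3 := by
  refine CompleteFlag.ext_sp fun k => ?_
  induction k with
  | zero => rw [CompleteFlag.sp_zero, CompleteFlag.sp_zero]
  | succ k ih =>
    rcases le_or_gt n (k + 1) with hk | hk
    · rw [CompleteFlag.sp_of_le _ hk, CompleteFlag.sp_of_le _ hk]
    · refine (Submodule.eq_of_le_of_finrank_eq (fun x hx => ?_) ?_).symm
      · exact h.iInf_flagSpan_le (N := n - 2 - k) (by lia) fun m hm =>
          h.sp_three_succ_le h' h1 h2 h0 (by lia) ih hx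
      · rw [CompleteFlag.finrank_sp _ hk.le, CompleteFlag.finrank_sp _ hk.le]

/-- Once F₃ is known, in particular its line, exchanging F₀ and F₃ lets the same argument determine
F₀. -/
theorem IsExtremal.ext (h : IsExtremal F r) (h' : IsExtremal F' r) (hr : r ≠ 0) (h1 : F 1 = F' 1)
    (h2 : F 2 = F' 2) (h0 : (F 0).sp 1 = (F' 0).sp 1) : F = F' := by
  have h3 := h.flag_three_eq h' h1 h2 h0
  have h4 := (h.swap hr).flag_three_eq (h'.swap hr) h1 h2 (by simp [h3])
  funext i
  fin_cases i
  exacts [h4, h1, h2, h3]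

end extremal

/-! ### Congruence under the general linear group -/

section action

variable {n : ℕ}

theorem CompleteFlag.sp_smul (g : GL (Fin n) ℂ) (G : CompleteFlag n) (j : ℕ) :
    (g • G).sp j = (G.sp j).map (Matrix.GeneralLinearGroup.toLin g).toLinearEquiv.toLinearMap :=
  rfl

variable {F : Fin 4 → CompleteFlag n} {r : ℂ}

theorem flagSpan_smul (g : GL (Fin n) ℂ) (J : Fin 4 → ℕ) :
    flagSpan (fun i => g • F i) J =
      (flagSpan F J).map (Matrix.GeneralLinearGroup.toLin g).toLinearEquiv.toLinearMap := by
  simp only [flagSpan, CompleteFlag.sp_smul, Submodule.map_iSup]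

theorem IsExtremal.smul (h : IsExtremal F r) (g : GL (Fin n) ℂ) :
    IsExtremal (fun i => g • F i) r := by
  constructor
  · intro J hJ
    obtain ⟨h1, h2⟩ := h.isGood J hJ
    refine ⟨?_, fun i k hik => ?_⟩
    · rw [flagSpan_smul, flagSpan_smul, LinearEquiv.finrank_map_eq, LinearEquiv.finrank_map_eq, h1]
    · rw [flagSpan_smul, flagSpan_smul, h2 i k hik]
  · intro J hJ
    obtain ⟨u, hu, h0, h3, e0, e3⟩ := h.hasRatioAt J hJ
    have hmem : ∀ (y : Fin n → ℂ) (W : Submodule ℂ (Fin n → ℂ)),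
        (Matrix.GeneralLinearGroup.toLin g).toLinearEquiv y ∈
          W.map (Matrix.GeneralLinearGroup.toLin g).toLinearEquiv.toLinearMap ↔ y ∈ W :=
      fun y W => (LinearEquiv.injective _).mem_set_image (s := (W : Set (Fin n → ℂ)))
    refine ⟨fun i => (Matrix.GeneralLinearGroup.toLin g).toLinearEquiv (u i), ?_, ?_, ?_, ?_, ?_⟩
    · exact fun i => (hmem _ _).2 (hu i)
    · rwa [flagSpan_smul, hmem]
    · rwa [flagSpan_smul, hmem]
    · rwa [flagSpan_smul, ← map_add, ← map_sub, hmem]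
    · rwa [flagSpan_smul, ← map_smul, ← map_add, ← map_sub, hmem]

/-- A basis adapted to the flags `F 1`, `F 2` and the line of `F 0`. -/
structure IsAdapted (F : Fin 4 → CompleteFlag n) (b : Module.Basis (Fin n) ℂ (Fin n → ℂ)) :
    Prop where
  mem_one : ∀ j : Fin n, b j ∈ (F 1).sp (j + 1)
  mem_two : ∀ j : Fin n, b j ∈ (F 2).sp (n - j)
  sum_mem : ∑ j, b j ∈ (F 0).sp 1

variable {b : Module.Basis (Fin n) ℂ (Fin n → ℂ)}

theorem Module.Basis.span_image_eq {W : Submodule ℂ (Fin n → ℂ)} {s : Finset (Fin n)}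
    (hs : ∀ j ∈ s, b j ∈ W) (hW : Module.finrank ℂ W = s.card) :
    Submodule.span ℂ (b '' s) = W := by
  classical
  refine Submodule.eq_of_le_of_finrank_eq (Submodule.span_le.2 ?_) ?_
  · rintro _ ⟨j, hj, rfl⟩
    exact hs j hj
  · rw [hW, ← Finset.coe_image, finrank_span_finset_eq_card, Finset.card_image_of_injective _
      b.injective]
    rw [Finset.coe_image]
    exact (b.linearIndependent.linearIndepOn_id).mono (Set.image_subset_range _ _)

theorem IsAdapted.sp_one (h : IsAdapted F b) {j : ℕ} (hj : j ≤ n) :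
    Submodule.span ℂ (b '' (Finset.univ.filter fun m : Fin n => (m : ℕ) < j)) = (F 1).sp j := by
  refine b.span_image_eq (fun m hm => (F 1).sp_mono ?_ (h.mem_one m)) ?_
  · simpa using hm
  · rw [CompleteFlag.finrank_sp _ hj, Fin.card_filter_val_lt]
    simpa using hj

theorem IsAdapted.sp_two (h : IsAdapted F b) {j : ℕ} (hj : j ≤ n) :
    Submodule.span ℂ (b '' (Finset.univ.filter fun m : Fin n => n ≤ m + j)) = (F 2).sp j := by
  refine b.span_image_eq (fun m hm => (F 2).sp_mono ?_ (h.mem_two m)) ?_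
  · simp at hm
    lia
  · rw [CompleteFlag.finrank_sp _ hj]
    have h1 : (Finset.univ.filter fun m : Fin n => n ≤ m + j) =
        (Finset.univ.filter fun m : Fin n => (m : ℕ) < n - j)ᶜ := by
      ext m
      simp
    rw [h1, Finset.card_compl, Fin.card_filter_val_lt, Fintype.card_fin]
    lia

theorem IsAdapted.sp_zero (h : IsAdapted F b) :
    Submodule.span ℂ {∑ j, b j} = (F 0).sp 1 := by
  rcases Nat.eq_zero_or_pos n with rfl | hn
  · exact Subsingleton.elim _ _
  · refine Submodule.eq_of_le_of_finrank_eq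
      ((Submodule.span_singleton_le_iff_mem _ _).2 h.sum_mem) ?_
    rw [CompleteFlag.finrank_sp _ hn, finrank_span_singleton]
    intro h0
    have := congrArg (fun v => b.repr v ⟨0, hn⟩) h0
    simp [Finsupp.single_apply] at this

/-- An adapted basis determines F₁, F₂ and the line of F₀, so the linear map between two adapted
bases matches these data. -/
theorem IsAdapted.exists_smul {F' : Fin 4 → CompleteFlag n}
    {b' : Module.Basis (Fin n) ℂ (Fin n → ℂ)} (h : IsAdapted F b) (h' : IsAdapted F' b') :
    ∃ g : GL (Fin n) ℂ, F 1 = g • F' 1 ∧ F 2 = g • F' 2 ∧ (F 0).sp 1 = (g • F' 0).sp 1 := by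
  let L := b'.equiv b (Equiv.refl _)
  obtain ⟨g, hg⟩ : ∃ g : GL (Fin n) ℂ,
      (Matrix.GeneralLinearGroup.toLin g).toLinearEquiv.toLinearMap = L.toLinearMap :=
    ⟨Matrix.GeneralLinearGroup.toLin.symm (LinearMap.GeneralLinearGroup.ofLinearEquiv L), by
      rw [MulEquiv.apply_symm_apply]
      rfl⟩
  have hL : ∀ j, L (b' j) = b j := fun j => by simp [L]
  have himg : ∀ s : Set (Fin n), L.toLinearMap '' (b' '' s) = b '' s := fun s => by
    rw [Set.image_image]
    exact Set.image_congr fun j _ => hL j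
  have hext : ∀ {G G' : CompleteFlag n}, (∀ j ≤ n, G.sp j = G'.sp j) → G = G' := fun hG =>
    CompleteFlag.ext_sp fun j => by
      rcases le_total j n with hj | hj
      · exact hG j hj
      · rw [CompleteFlag.sp_of_le _ hj, CompleteFlag.sp_of_le _ hj]
  refine ⟨g, hext fun j hj => ?_, hext fun j hj => ?_, ?_⟩
  · rw [CompleteFlag.sp_smul, hg, ← h.sp_one hj, ← h'.sp_one hj, Submodule.map_span, himg]
  · rw [CompleteFlag.sp_smul, hg, ← h.sp_two hj, ← h'.sp_two hj, Submodule.map_span, himg]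
  · rw [CompleteFlag.sp_smul, hg, ← h.sp_zero, ← h'.sp_zero, Submodule.map_span,
      Set.image_singleton]
    simp [hL]

theorem IsExtremal.inf_eq_bot (h : IsExtremal F r) {j k : ℕ} (hjk : j + k = n) :
    (F 1).sp j ⊓ (F 2).sp k = ⊥ := by
  have h1 := Submodule.finrank_sup_add_finrank_inf_eq ((F 1).sp j) ((F 2).sp k)
  have h2 := h.finrank_flagSpan (J := ![0, j, k, 0]) (i := 0) rfl
  have h3 : flagSpan F ![0, j, k, 0] ≤ (F 1).sp j ⊔ (F 2).sp k := flagSpan_le fun i => by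
    fin_cases i
    · simp [CompleteFlag.sp_zero]
    · exact le_sup_left
    · exact le_sup_right
    · simp [CompleteFlag.sp_zero]
  have h4 := Submodule.finrank_mono h3
  rw [CompleteFlag.finrank_sp _ (by lia), CompleteFlag.finrank_sp _ (by lia)] at h1
  simp [Fin.sum_univ_four] at h2
  exact Submodule.finrank_eq_zero.1 (by lia)

theorem CompleteFlag.exists_mem_inf (G H : CompleteFlag n) (j : Fin n) :
    ∃ e ∈ G.sp (j + 1) ⊓ H.sp (n - j), e ≠ 0 := by
  refine Submodule.exists_mem_ne_zero_of_ne_bot fun hb => ?_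
  have h1 := Submodule.finrank_sup_add_finrank_inf_eq (G.sp (j + 1)) (H.sp (n - j))
  rw [hb, CompleteFlag.finrank_sp _ (by lia), CompleteFlag.finrank_sp _ (by lia)] at h1
  have h2 := Submodule.finrank_le (G.sp (j + 1) ⊔ H.sp (n - j))
  simp at h1 h2
  lia

/-- The opposite flags F₁ and F₂ determine a frame of lines `F₁^{j+1} ∩ F₂^{n-j}`, and a vector of
the line of F₀ fixes the scale on each of them. -/
theorem IsExtremal.exists_isAdapted (h : IsExtremal F r) : ∃ b, IsAdapted F b := by
  rcases Nat.eq_zero_or_pos n with rfl | hn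
  · exact ⟨Pi.basisFun ℂ (Fin 0), fun j => j.elim0, fun j => j.elim0, by
      rw [CompleteFlag.sp_of_le _ (Nat.zero_le 1)]
      trivial⟩
  -- The two dimensions add up to n + 1, so the intersections are nonzero.
  choose e he he0 using (F 1).exists_mem_inf (F 2)
  have hspan : ∀ j ≤ n, (F 1).sp j ≤ Submodule.span ℂ (Set.range e) := by
    intro j
    induction j with
    | zero => simp [CompleteFlag.sp_zero]
    | succ j ih =>
      intro hj
      refine CompleteFlag.sp_succ_le (ih (by lia)) (he ⟨j, hj⟩).1 (fun hm => he0 ⟨j, hj⟩ ?_)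
        (Submodule.subset_span ⟨_, rfl⟩)
      rw [← Submodule.mem_bot ℂ, ← h.inf_eq_bot (show j + (n - j) = n by lia)]
      exact ⟨hm, (he ⟨j, hj⟩).2⟩
  have htop : ⊤ ≤ Submodule.span ℂ (Set.range e) :=
    (CompleteFlag.sp_of_le _ le_rfl).symm.le.trans (hspan n le_rfl)
  let b := basisOfTopLeSpanOfCardEqFinrank e htop (by simp)
  have hb : ∀ j, b j = e j := fun j => by simp [b]
  obtain ⟨v, hv, hv0⟩ : ∃ v ∈ (F 0).sp 1, v ≠ 0 := by
    refine Submodule.exists_mem_ne_zero_of_ne_bot fun hb => ?_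
    have := CompleteFlag.finrank_sp (F 0) hn
    rw [hb] at this
    simp at this
  -- A vanishing coefficient would put the line of F₀ into `F₁^j + F₂^{n-1-j}`, against the general
  -- position of the three flags.
  have hc : ∀ j, b.repr v j ≠ 0 := by
    intro j hj
    have hvm : v ∈ flagSpan F ![0, j, n - 1 - j, 0] := by
      rw [← b.sum_repr v]
      refine Submodule.sum_mem _ fun m _ => ?_
      rcases lt_trichotomy m j with hm | rfl | hm
      · rw [hb]
        exact Submodule.smul_mem _ _
          (sp_le_flagSpan (i := 1) (by simpa using hm) (he m).1)
      · rw [hj, zero_smul]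
        exact zero_mem _
      · rw [hb]
        exact Submodule.smul_mem _ _
          (sp_le_flagSpan (i := 2) (by simp; lia) (he m).2)
    have hle : flagSpan F ![1, j, n - 1 - j, 0] ≤ flagSpan F ![0, j, n - 1 - j, 0] :=
      flagSpan_le fun i => by
        fin_cases i
        · exact CompleteFlag.sp_succ_le (j := 0) (by simp [CompleteFlag.sp_zero]) hv
            (by simpa [CompleteFlag.sp_zero] using hv0) hvm
        · exact sp_le_flagSpan (i := 1) le_rfl
        · exact sp_le_flagSpan (i := 2) le_rfl
        · exact sp_le_flagSpan (i := 3) le_rfl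
    have h1 := Submodule.finrank_mono hle
    rw [h.finrank_flagSpan (i := 3) rfl, h.finrank_flagSpan (i := 3) rfl] at h1
    simp [Fin.sum_univ_four] at h1
    lia
  refine ⟨b.isUnitSMul (w := fun j => b.repr v j) fun j => (hc j).isUnit, fun j => ?_, fun j => ?_,
    ?_⟩
  · rw [Module.Basis.isUnitSMul_apply, hb]
    exact Submodule.smul_mem _ _ (he j).1
  · rw [Module.Basis.isUnitSMul_apply, hb]
    exact Submodule.smul_mem _ _ (he j).2
  · simp only [Module.Basis.isUnitSMul_apply]
    rw [b.sum_repr]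
    exact hv

/-- Two quadruples of flags with the same cross-ratio at all balanced indices are congruent. -/
theorem IsExtremal.exists_smul_eq {F' : Fin 4 → CompleteFlag n} (h : IsExtremal F r)
    (h' : IsExtremal F' r) (hr : r ≠ 0) : ∃ g : GL (Fin n) ℂ, ∀ i, F i = g • F' i := by
  obtain ⟨b, hb⟩ := h.exists_isAdapted
  obtain ⟨b', hb'⟩ := h'.exists_isAdapted
  obtain ⟨g, h1, h2, h0⟩ := hb.exists_smul hb'
  exact ⟨g, congrFun (h.ext (h'.smul g) hr h1 h2 h0)⟩

end action

/-! ### Veronese flags and binary forms -/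

section binaryForms

open MvPolynomial

/-- The linear form with coefficient vector `v`. -/
noncomputable def linForm (v : Fin 2 → ℂ) : MvPolynomial (Fin 2) ℂ := C (v 0) * X 0 + C (v 1) * X 1

/-- The derivation of binary forms along the kernel of `linForm v`. -/
noncomputable def polarDeriv (v : Fin 2 → ℂ) :
    Derivation ℂ (MvPolynomial (Fin 2) ℂ) (MvPolynomial (Fin 2) ℂ) :=
  v 1 • pderiv 0 - v 0 • pderiv 1

theorem polarDeriv_X_zero (v : Fin 2 → ℂ) : polarDeriv v (X 0) = C (v 1) := by
  simp [polarDeriv, pderiv_X, smul_eq_C_mul]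

theorem polarDeriv_X_one (v : Fin 2 → ℂ) : polarDeriv v (X 1) = C (-v 0) := by
  simp [polarDeriv, pderiv_X, smul_eq_C_mul]

theorem polarDeriv_linForm (v u : Fin 2 → ℂ) : polarDeriv v (linForm u) = C (det₂ u v) := by
  rw [linForm, ← smul_eq_C_mul, ← smul_eq_C_mul, map_add, Derivation.map_smul, Derivation.map_smul,
    polarDeriv_X_zero, polarDeriv_X_one, smul_eq_C_mul, smul_eq_C_mul, ← C_mul, ← C_mul, ← C_add, det₂, mul_neg,
    ← sub_eq_add_neg]

theorem commute_polarDeriv (v u : Fin 2 → ℂ) :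
    Commute (polarDeriv v).toLinearMap (polarDeriv u).toLinearMap := by
  have h : ⁅polarDeriv v, polarDeriv u⁆ = 0 := by
    refine derivation_ext fun i => ?_
    rw [Derivation.commutator_apply]
    fin_cases i
    · simp [polarDeriv_X_zero, ← algebraMap_eq]
    · simp [polarDeriv_X_one, ← algebraMap_eq]
  refine LinearMap.ext fun p => ?_
  have := congrArg (fun D => D p) h
  rw [Derivation.commutator_apply] at this
  exact sub_eq_zero.1 this

theorem isHomogeneous_polarDeriv {p : MvPolynomial (Fin 2) ℂ} {N : ℕ} (hp : p.IsHomogeneous N)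
    (v : Fin 2 → ℂ) : (polarDeriv v p).IsHomogeneous (N - 1) := by
  have h : polarDeriv v p = C (v 1) * pderiv 0 p - C (v 0) * pderiv 1 p := by
    simp [polarDeriv, smul_eq_C_mul]
  rw [h]
  exact (hp.pderiv.C_mul _).sub (hp.pderiv.C_mul _)

theorem polarDeriv_pow_eq_zero {p : MvPolynomial (Fin 2) ℂ} {N : ℕ} (hp : p.IsHomogeneous N)
    (v : Fin 2 → ℂ) : ((polarDeriv v).toLinearMap ^ (N + 1)) p = 0 := by
  induction N generalizing p with
  | zero =>
    rw [← totalDegree_zero_iff_isHomogeneous, totalDegree_eq_zero_iff_eq_C] at hp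
    rw [hp]
    simp [← algebraMap_eq]
  | succ N ih =>
    rw [pow_succ, Module.End.mul_apply]
    exact ih (isHomogeneous_polarDeriv hp v)

theorem polarDeriv_pow_pow {p : MvPolynomial (Fin 2) ℂ} {v : Fin 2 → ℂ} {c : ℂ}
    (h : polarDeriv v p = C c) (N j : ℕ) :
    ((polarDeriv v).toLinearMap ^ j) (p ^ N) =
      ((N.descFactorial j : ℂ) * c ^ j) • p ^ (N - j) := by
  induction j with
  | zero => simp
  | succ j ih =>
    rw [pow_succ', Module.End.mul_apply, ih, map_smul]
    change _ • polarDeriv v _ = _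
    rw [Derivation.leibniz_pow, h, Nat.descFactorial_succ, Nat.cast_mul, ← Nat.cast_smul_eq_nsmul ℂ,
      smul_eq_mul, mul_comm (p ^ _), ← smul_eq_C_mul, smul_smul, smul_smul, Nat.sub_sub]
    congr 1
    ring

/-- `linForm v` is a constant for the derivation `polarDeriv v`. -/
theorem polarDeriv_linForm_pow_mul (v : Fin 2 → ℂ) (N j : ℕ) (p : MvPolynomial (Fin 2) ℂ) :
    ((polarDeriv v).toLinearMap ^ j) (linForm v ^ N * p) =
      linForm v ^ N * ((polarDeriv v).toLinearMap ^ j) p := by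
  have h0 : polarDeriv v (linForm v ^ N) = 0 := by
    rw [Derivation.leibniz_pow, polarDeriv_linForm]
    simp [det₂, mul_comm]
  induction j with
  | zero => simp
  | succ j ih =>
    rw [pow_succ', Module.End.mul_apply, Module.End.mul_apply, ih]
    change polarDeriv v _ = _ * polarDeriv v _
    rw [Derivation.leibniz, h0, smul_zero, add_zero, smul_eq_mul]

/-- The composition of the operators `(polarDeriv (w i)) ^ K i`, for `i` in `s`. -/
noncomputable def polarOp (w : Fin 4 → Fin 2 → ℂ) (K : Fin 4 → ℕ) (s : Finset (Fin 4)) :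
    Module.End ℂ (MvPolynomial (Fin 2) ℂ) :=
  s.noncommProd (fun i => (polarDeriv (w i)).toLinearMap ^ K i)
    fun _ _ _ _ _ => (commute_polarDeriv _ _).pow_pow _ _

theorem polarOp_empty (w : Fin 4 → Fin 2 → ℂ) (K : Fin 4 → ℕ) : polarOp w K ∅ = 1 := rfl

theorem polarOp_insert (w : Fin 4 → Fin 2 → ℂ) (K : Fin 4 → ℕ) {s : Finset (Fin 4)} {k : Fin 4}
    (hk : k ∉ s) :
    polarOp w K (insert k s) = (polarDeriv (w k)).toLinearMap ^ K k * polarOp w K s :=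
  Finset.noncommProd_insert_of_notMem _ _ _ _ hk

theorem polarOp_erase_mul (w : Fin 4 → Fin 2 → ℂ) (K : Fin 4 → ℕ) (i : Fin 4) :
    polarOp w K (Finset.univ.erase i) * (polarDeriv (w i)).toLinearMap ^ K i =
      polarOp w K Finset.univ :=
  Finset.noncommProd_erase_mul _ (Finset.mem_univ i) _ _

variable {w : Fin 4 → Fin 2 → ℂ}

/-- Each derivation lowers the exponent by one and produces a determinant and an exponent as
factors; none of these vanishes for distinct points in characteristic 0. -/
theorem polarOp_linForm_pow (hw : ∀ i k, i ≠ k → det₂ (w i) (w k) ≠ 0) (K : Fin 4 → ℕ)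
    {s : Finset (Fin 4)} {i : Fin 4} (hi : i ∉ s) {N : ℕ} (hN : ∑ k ∈ s, K k ≤ N) :
    ∃ c : ℂ, c ≠ 0 ∧ polarOp w K s (linForm (w i) ^ N) =
      c • linForm (w i) ^ (N - ∑ k ∈ s, K k) := by
  induction s using Finset.induction_on with
  | empty => exact ⟨1, one_ne_zero, by simp [polarOp_empty]⟩
  | insert k s hk ih =>
    rw [Finset.sum_insert hk] at hN ⊢
    rw [Finset.mem_insert, not_or] at hi
    obtain ⟨c, hc, e⟩ := ih hi.2 (by lia)
    refine ⟨c * (((N - ∑ k ∈ s, K k).descFactorial (K k) : ℂ) * det₂ (w i) (w k) ^ K k), ?_, ?_⟩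
    · refine mul_ne_zero hc (mul_ne_zero ?_ (pow_ne_zero _ (hw _ _ hi.1)))
      rw [Nat.cast_ne_zero, ne_eq, Nat.descFactorial_eq_zero_iff_lt]
      lia
    · rw [polarOp_insert w K hk, Module.End.mul_apply, e, map_smul, polarDeriv_pow_pow (polarDeriv_linForm _ _), smul_smul,
        Nat.sub_sub, add_comm (K k)]

/-- The binary form of degree `n - 1` with the given coefficients. -/
noncomputable def binaryForm (n : ℕ) : (Fin n → ℂ) →ₗ[ℂ] MvPolynomial (Fin 2) ℂ :=
  Fintype.linearCombination ℂ fun m : Fin n => X 0 ^ (n - 1 - m) * X 1 ^ (m : ℕ)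

/-- Identifies the Veronese space of dimension d with the forms of degree n - 1 divisible by the
power n - d of the linear form. -/
theorem binaryForm_veroneseVec {n d k : ℕ} (hk : k < d) (hd : d ≤ n) (v : Fin 2 → ℂ) :
    binaryForm n (veroneseVec n (n - d) k v) =
      linForm v ^ (n - d) * (X 0 ^ (d - 1 - k) * X 1 ^ k) := by
  rw [binaryForm, Fintype.linearCombination_apply, linForm, add_comm, add_pow, Finset.sum_mul]
  rw [Finset.sum_fin_eq_sum_range]
  symm
  refine Finset.sum_of_injOn (fun l => k + l) (fun _ _ _ _ h => by simpa using h) ?_ ?_ ?_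
  · intro l hl
    simp at hl ⊢
    lia
  · intro m hm hm'
    rw [Finset.mem_range] at hm
    rw [dif_pos hm, veroneseVec]
    split_ifs with h
    · rw [Nat.choose_eq_zero_of_lt]
      · simp
      · by_contra hlt
        exact hm' ⟨m - k, by simp at hlt ⊢; lia, by simp at h ⊢; lia⟩
    · simp
  · intro l hl
    rw [Finset.mem_range] at hl
    rw [dif_pos (by lia), veroneseVec, if_pos (by simp)]
    simp only [add_tsub_cancel_left, smul_eq_C_mul, map_mul, map_pow, map_natCast]
    rw [show n - 1 - (k + l) = (n - d - l) + (d - 1 - k) by lia]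
    ring

end binaryForms

section veroneseFlags

open MvPolynomial

variable {n : ℕ}

theorem linForm_add_smul (a b : ℂ) (u v : Fin 2 → ℂ) :
    linForm (a • u + b • v) = a • linForm u + b • linForm v := by
  simp only [linForm, Pi.add_apply, Pi.smul_apply, smul_eq_mul, smul_eq_C_mul, map_add, map_mul]
  ring

theorem linForm_injective : Function.Injective linForm := by
  intro u v h
  have h0 := congrArg (eval ![1, 0]) h
  have h1 := congrArg (eval ![0, 1]) h
  simp [linForm] at h0 h1
  funext i
  fin_cases i
  exacts [h0, h1]

theorem linForm_ne_zero {v : Fin 2 → ℂ} (hv : v ≠ 0) : linForm v ≠ 0 := fun h =>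
  hv (linForm_injective (by rw [h]; simp [linForm]))

/-- The cofactor of the power of `linForm v` has degree `j - 1`, so j derivatives annihilate it. -/
theorem polarDeriv_pow_binaryForm {v : Fin 2 → ℂ} {j : ℕ} (hj : j ≤ n) {x : Fin n → ℂ}
    (hx : x ∈ veroneseSpace n j v) :
    ((polarDeriv v).toLinearMap ^ j) (binaryForm n x) = 0 := by
  suffices h : veroneseSpace n j v ≤
      LinearMap.ker (((polarDeriv v).toLinearMap ^ j) ∘ₗ binaryForm n) from h hx
  refine Submodule.span_le.2 ?_
  rintro _ ⟨k, rfl⟩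
  have hk := k.2
  change ((polarDeriv v).toLinearMap ^ j) (binaryForm n (veroneseVec n (n - j) k v)) = 0
  rw [binaryForm_veroneseVec hk hj, polarDeriv_linForm_pow_mul]
  obtain ⟨d, rfl⟩ : ∃ d, j = d + 1 := ⟨j - 1, by lia⟩
  rw [polarDeriv_pow_eq_zero, mul_zero]
  have := ((isHomogeneous_X ℂ (0 : Fin 2)).pow (d + 1 - 1 - k)).mul
    ((isHomogeneous_X ℂ (1 : Fin 2)).pow k)
  convert this using 1
  lia

theorem exists_polarDeriv_pow_binaryForm {v : Fin 2 → ℂ} (hv : v ≠ 0) {k : ℕ} (hk : k + 1 ≤ n) :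
    ∃ x ∈ veroneseSpace n (k + 1) v, ∃ c : ℂ, c ≠ 0 ∧
      ((polarDeriv v).toLinearMap ^ k) (binaryForm n x) = c • linForm v ^ (n - (k + 1)) := by
  have key : ∀ {p : MvPolynomial (Fin 2) ℂ} {a : ℂ}, a ≠ 0 → polarDeriv v p = C a → ∀ l < k + 1,
      (X 0 ^ (k + 1 - 1 - l) * X 1 ^ l : MvPolynomial (Fin 2) ℂ) = p ^ k →
      ∃ x ∈ veroneseSpace n (k + 1) v, ∃ c : ℂ, c ≠ 0 ∧
        ((polarDeriv v).toLinearMap ^ k) (binaryForm n x) = c • linForm v ^ (n - (k + 1)) := by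
    intro p a ha hp l hl he
    refine ⟨veroneseVec n (n - (k + 1)) l v, Submodule.subset_span ⟨⟨l, hl⟩, rfl⟩,
      (k.descFactorial k : ℂ) * a ^ k, mul_ne_zero ?_ (pow_ne_zero _ ha), ?_⟩
    · simp [Nat.descFactorial_self, Nat.factorial_ne_zero]
    · rw [binaryForm_veroneseVec hl hk, polarDeriv_linForm_pow_mul, he, polarDeriv_pow_pow hp,
        Nat.sub_self, pow_zero, mul_smul_comm, mul_one]
  -- The cofactor is taken as the k-th power of a variable on which `polarDeriv v` does not vanish.
  by_cases h1 : v 1 = 0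
  · refine key (p := X 1) (a := -v 0) (neg_ne_zero.2 fun h0 => hv ?_) (polarDeriv_X_one v) k
      (Nat.lt_succ_self k) (by simp)
    funext i
    fin_cases i
    exacts [h0, h1]
  · exact key (p := X 0) h1 (polarDeriv_X_zero v) 0 (Nat.succ_pos k) (by simp)

variable {w : Fin 4 → Fin 2 → ℂ} {hw : ∀ i, w i ≠ 0}

theorem veronese_mk_sp {v : Fin 2 → ℂ} {hv : v ≠ 0} {j : ℕ} :
    (veronese n (Projectivization.mk ℂ v hv)).sp j = veroneseSpace n (min j n) v := rfl

/-- The derivations commute, so on the space of flag i the factor with index i can be applied first,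
and it already gives zero. -/
theorem polarOp_binaryForm {K : Fin 4 → ℕ} (hK : ∀ i, K i ≤ n) {x : Fin n → ℂ}
    (hx : x ∈ flagSpan (fun i => veronese n (Projectivization.mk ℂ (w i) (hw i))) K) :
    polarOp w K Finset.univ (binaryForm n x) = 0 := by
  suffices h : flagSpan (fun i => veronese n (Projectivization.mk ℂ (w i) (hw i))) K ≤
      LinearMap.ker (polarOp w K Finset.univ ∘ₗ binaryForm n) from h hx
  refine flagSpan_le fun i y hy => ?_
  rw [veronese_mk_sp, min_eq_left (hK i)] at hy
  change polarOp w K Finset.univ (binaryForm n y) = 0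
  rw [← polarOp_erase_mul w K i, Module.End.mul_apply, polarDeriv_pow_binaryForm (hK i) hy,
    map_zero]

/-- The operator that annihilates the span at `K` sends a vector of the next space of flag i to a
power of `linForm (w i)`. When the indices sum to n - 2 this power is the linear form itself, so the
quotient plane is ℂ² with the four original points. -/
theorem exists_polarOp_binaryForm (hdet : ∀ i k, i ≠ k → det₂ (w i) (w k) ≠ 0) {K : Fin 4 → ℕ}
    (hK : ∑ i, K i + 1 ≤ n) (i : Fin 4) :
    ∃ x ∈ (veronese n (Projectivization.mk ℂ (w i) (hw i))).sp (K i + 1),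
      polarOp w K Finset.univ (binaryForm n x) = linForm (w i) ^ (n - 1 - ∑ i, K i) := by
  have hsum := Finset.add_sum_erase Finset.univ K (Finset.mem_univ i)
  have hi : K i + 1 ≤ n := by lia
  obtain ⟨x, hx, c, hc, e⟩ := exists_polarDeriv_pow_binaryForm (hw i) hi
  obtain ⟨c', hc', e'⟩ := polarOp_linForm_pow hdet K (Finset.notMem_erase i Finset.univ)
    (N := n - (K i + 1)) (by lia)
  refine ⟨(c' * c)⁻¹ • x, Submodule.smul_mem _ _ ?_, ?_⟩
  · rwa [veronese_mk_sp, min_eq_left hi]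
  · rw [← polarOp_erase_mul w K i, Module.End.mul_apply, map_smul, map_smul, map_smul, e, map_smul,
      e', smul_smul, smul_smul, mul_assoc, mul_comm c c', inv_mul_cancel₀ (mul_ne_zero hc' hc),
      one_smul]
    congr 1
    lia

theorem sum_add_single_one (J : Fin 4 → ℕ) (i : Fin 4) :
    ∑ k, (J + Pi.single i 1 : Fin 4 → ℕ) k = ∑ k, J k + 1 := by
  simp only [Pi.add_apply, Finset.sum_add_distrib, Finset.sum_pi_single', Finset.mem_univ, if_true]

/-- At each unit step the operator annihilates the old span but not the new vector, so the dimension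
grows. -/
theorem finrank_flagSpan_veronese (hdet : ∀ i k, i ≠ k → det₂ (w i) (w k) ≠ 0) {K : Fin 4 → ℕ}
    (hK : ∑ i, K i ≤ n) :
    Module.finrank ℂ (flagSpan (fun i => veronese n (Projectivization.mk ℂ (w i) (hw i))) K) =
      ∑ i, K i := by
  refine le_antisymm finrank_flagSpan_le ?_
  obtain ⟨m, hm⟩ : ∃ m, m = ∑ i, K i := ⟨_, rfl⟩
  rw [← hm]
  induction m generalizing K with
  | zero => exact Nat.zero_le _
  | succ m ih =>
    obtain ⟨i, -, hi⟩ := Finset.exists_ne_zero_of_sum_ne_zero (s := Finset.univ) (f := K) (by lia)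
    obtain ⟨K', rfl⟩ : ∃ K', K = K' + Pi.single i 1 :=
      ⟨K - Pi.single i 1, funext fun k => by
        by_cases hk : k = i
        · subst hk; simp; lia
        · simp [Pi.single_eq_of_ne hk]⟩
    rw [sum_add_single_one] at hm hK
    have h1 := ih (K := K') (by lia) (by lia)
    obtain ⟨x, hx, e⟩ := exists_polarOp_binaryForm (hw := hw) hdet hK i
    refine Nat.succ_le_of_lt (lt_of_le_of_lt h1 (Submodule.finrank_lt_finrank_of_lt
      (lt_of_le_of_ne (flagSpan_mono (by simp)) fun he => ?_)))
    have hx' : x ∈ flagSpan (fun i => veronese n (Projectivization.mk ℂ (w i) (hw i))) K' := by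
      rw [he]
      exact sp_le_flagSpan (i := i) (by simp) hx
    rw [polarOp_binaryForm (fun k => ?_) hx'] at e
    · exact pow_ne_zero _ (linForm_ne_zero (hw i)) e.symm
    · have := Finset.single_le_sum (f := K') (fun _ _ => Nat.zero_le _) (Finset.mem_univ k)
      lia

theorem flagSpan_veronese_eq_top (hdet : ∀ i k, i ≠ k → det₂ (w i) (w k) ≠ 0) {J : Fin 4 → ℕ}
    (hJ : ∑ i, J i + 2 = n) (i k : Fin 4) :
    flagSpan (fun i => veronese n (Projectivization.mk ℂ (w i) (hw i)))
      (J + Pi.single i 1 + Pi.single k 1) = ⊤ := by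
  have h : ∑ m, (J + Pi.single i 1 + Pi.single k 1 : Fin 4 → ℕ) m = n := by
    rw [sum_add_single_one, sum_add_single_one]
    lia
  rw [flagSpan_eq_top_iff, finrank_flagSpan_veronese hdet h.le, h]

/-- The span and two of the new vectors fill ℂⁿ, and the images of these two are independent linear
forms, so the kernel of the operator is no larger than the span. -/
theorem mem_flagSpan_veronese (hdet : ∀ i k, i ≠ k → det₂ (w i) (w k) ≠ 0) {J : Fin 4 → ℕ}
    (hJ : ∑ i, J i + 2 = n) {y : Fin n → ℂ} (hy : polarOp w J Finset.univ (binaryForm n y) = 0) :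
    y ∈ flagSpan (fun i => veronese n (Projectivization.mk ℂ (w i) (hw i))) J := by
  have hJn : ∀ i, J i ≤ n := fun i => by
    have := Finset.single_le_sum (f := J) (fun _ _ => Nat.zero_le _) (Finset.mem_univ i)
    lia
  have hx := exists_polarOp_binaryForm (hw := hw) hdet (show ∑ i, J i + 1 ≤ n by lia)
  rw [show n - 1 - ∑ i, J i = 1 by lia] at hx
  simp only [pow_one] at hx
  choose x hx e using hx
  obtain ⟨D, hD⟩ : ∃ D, D = flagSpan (fun i => veronese n (Projectivization.mk ℂ (w i) (hw i))) J :=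
    ⟨_, rfl⟩
  have hsp : ∀ i, (veronese n (Projectivization.mk ℂ (w i) (hw i))).sp (J i + 1) ≤
      D ⊔ Submodule.span ℂ {x i} := fun i => by
    have hle : (veronese n (Projectivization.mk ℂ (w i) (hw i))).sp (J i) ≤ D := hD ▸
      sp_le_flagSpan (F := fun i => veronese n (Projectivization.mk ℂ (w i) (hw i))) le_rfl
    refine CompleteFlag.sp_succ_le (hle.trans le_sup_left) (hx i) (fun hn => ?_)
      (Submodule.mem_sup_right (Submodule.mem_span_singleton_self _))
    have := e i
    rw [polarOp_binaryForm hJn (hD ▸ hle hn)] at this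
    exact linForm_ne_zero (hw i) this.symm
  have htop : y ∈ (D ⊔ Submodule.span ℂ {x 0}) ⊔ (D ⊔ Submodule.span ℂ {x 1}) := by
    have h1 := flagSpan_veronese_eq_top (hw := hw) hdet hJ 0 1
    rw [flagSpan_add_single, flagSpan_add_single, ← hD] at h1
    refine (eq_top_iff.2 (h1.symm.le.trans (sup_le (sup_le (le_sup_left.trans le_sup_left) ?_)
      ?_))).symm ▸ Submodule.mem_top
    · exact (hsp 0).trans le_sup_left
    · simpa using (hsp 1).trans le_sup_right
  obtain ⟨y₀, hy₀, y₁, hy₁, rfl⟩ := Submodule.mem_sup.1 htop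
  obtain ⟨d₀, hd₀, z₀, hz₀, rfl⟩ := Submodule.mem_sup.1 hy₀
  obtain ⟨d₁, hd₁, z₁, hz₁, rfl⟩ := Submodule.mem_sup.1 hy₁
  obtain ⟨a, rfl⟩ := Submodule.mem_span_singleton.1 hz₀
  obtain ⟨b, rfl⟩ := Submodule.mem_span_singleton.1 hz₁
  rw [hD] at hd₀ hd₁
  simp only [map_add, map_smul, polarOp_binaryForm hJn hd₀, polarOp_binaryForm hJn hd₁, e,
    zero_add] at hy
  rw [← linForm_add_smul] at hy
  obtain ⟨rfl, rfl⟩ := det₂_ne_zero_iff.1 (hdet 0 1 (by decide)) a b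
    (linForm_injective (by rw [hy]; simp [linForm]))
  simpa using add_mem hd₀ hd₁

/-- Veronese flags of four distinct points with cross-ratio `r` are extremal. -/
theorem isExtremal_veronese (hdet : ∀ i k, i ≠ k → det₂ (w i) (w k) ≠ 0) {r : ℂ}
    (h : pairing₀₁ w = r * pairing₀₂ w) :
    IsExtremal (fun i => veronese n (Projectivization.mk ℂ (w i) (hw i))) r := by
  constructor
  · intro J hJ
    have htop : flagSpan (fun i => veronese n (Projectivization.mk ℂ (w i) (hw i))) (J + 1) = ⊤ := by
      rw [eq_top_iff, ← flagSpan_veronese_eq_top (hw := hw) hdet hJ 0 1]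
      refine flagSpan_mono fun m => ?_
      fin_cases m <;> simp
    refine ⟨?_, fun i k _ => by rw [htop, flagSpan_veronese_eq_top hdet hJ]⟩
    rw [flagSpan_eq_top_iff.1 htop, finrank_flagSpan_veronese hdet (by lia), hJ]
  · intro J hJ
    have hJn : ∀ i, J i ≤ n := fun i => by
      have := Finset.single_le_sum (f := J) (fun _ _ => Nat.zero_le _) (Finset.mem_univ i)
      lia
    have hx := exists_polarOp_binaryForm (hw := hw) hdet (show ∑ i, J i + 1 ≤ n by lia)
    rw [show n - 1 - ∑ i, J i = 1 by lia] at hx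
    simp only [pow_one] at hx
    choose x hx e using hx
    obtain ⟨e0, e3⟩ := relation_of_pairing_eq (hdet 1 2 (by decide)) (hdet 1 3 (by decide)) h
    obtain ⟨a, ha⟩ : ∃ a, a = det₂ (w 0) (w 2) / det₂ (w 1) (w 2) := ⟨_, rfl⟩
    obtain ⟨b, hb⟩ : ∃ b, b = -det₂ (w 0) (w 1) / det₂ (w 1) (w 2) := ⟨_, rfl⟩
    obtain ⟨c, hc⟩ : ∃ c, c = -det₂ (w 0) (w 1) / det₂ (w 1) (w 3) := ⟨_, rfl⟩
    rw [← ha, ← hb] at e0 e3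
    rw [← hc] at e3
    have hc0 : c ≠ 0 := hc ▸ div_ne_zero (neg_ne_zero.2 (hdet 0 1 (by decide)))
      (hdet 1 3 (by decide))
    -- The coefficients are those of the relations between the points `w i`; the operator carries
    -- these relations back to the quotient.
    refine ⟨![x 0, a • x 1, b • x 2, c • x 3], ?_, fun hn => ?_, fun hn => ?_, ?_, ?_⟩
    · intro i
      fin_cases i
      exacts [hx 0, Submodule.smul_mem _ _ (hx 1), Submodule.smul_mem _ _ (hx 2),
        Submodule.smul_mem _ _ (hx 3)]
    · have h0 := polarOp_binaryForm hJn hn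
      rw [show ![x 0, a • x 1, b • x 2, c • x 3] 0 = x 0 from rfl, e] at h0
      exact linForm_ne_zero (hw 0) h0
    · have h0 := polarOp_binaryForm hJn hn
      rw [show ![x 0, a • x 1, b • x 2, c • x 3] 3 = c • x 3 from rfl, map_smul, map_smul, e] at h0
      exact linForm_ne_zero (hw 3) ((smul_eq_zero.1 h0).resolve_left hc0)
    · refine mem_flagSpan_veronese hdet hJ ?_
      change polarOp w J Finset.univ (binaryForm n (x 0 - (a • x 1 + b • x 2))) = 0
      simp only [map_sub, map_add, map_smul, e]
      rw [← linForm_add_smul, ← e0, sub_self]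
    · refine mem_flagSpan_veronese hdet hJ ?_
      change polarOp w J Finset.univ (binaryForm n (c • x 3 - (r • a • x 1 + b • x 2))) = 0
      simp only [map_sub, map_add, map_smul, e]
      rw [smul_smul, ← linForm_add_smul, mul_smul, ← e3]
      simpa [sub_eq_zero] using (linForm_add_smul c 0 (w 3) 0).symm

end veroneseFlags

/-! ### The characterization of equality -/

theorem isExtremal_veronese_of_isRegularSimplex (n : ℕ) {ξ : Fin 4 → CP1} (h : IsRegularSimplex ξ)
    (ho : PositivelyOriented ξ) : IsExtremal (fun i => veronese n (ξ i)) regularRatio := by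
  obtain ⟨w, hw, rfl⟩ := exists_eq_mk ξ
  exact isExtremal_veronese (fun i k hik => det₂_ne_zero_of_im_ne_zero
    ((positivelyOriented_mk_iff hw).1 ho).ne' hik) (h.pairing_eq ho).2

theorem mainTheorem4 (n : ℕ) (F : Fin 4 → CompleteFlag n) :
    flagB n F = (n : ℝ) * ((n : ℝ) ^ 2 - 1) / 6 * maxSimplexVolume ↔
      ∃ (g : GL (Fin n) ℂ) (ξ : Fin 4 → CP1),
        IsRegularSimplex ξ ∧ PositivelyOriented ξ ∧ ∀ i, F i = g • veronese n (ξ i) := by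
  rw [flagB_eq_iff_isExtremal]
  constructor
  · intro h
    -- Extremal quadruples of equal cross-ratio are all congruent, so a single regular simplex
    -- serves as the model for every `F`.
    obtain ⟨g, hg⟩ := h.exists_smul_eq (isExtremal_veronese_of_isRegularSimplex n
      isRegularSimplex_regularSimplex positivelyOriented_regularSimplex) regularRatio_ne_zero
    exact ⟨g, _, isRegularSimplex_regularSimplex, positivelyOriented_regularSimplex, hg⟩
  · rintro ⟨g, ξ, h, ho, hF⟩
    obtain rfl : F = fun i => g • veronese n (ξ i) := funext hF
    exact (isExtremal_veronese_of_isRegularSimplex n h ho).smul g
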